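/- **Setting.** Fix dimensions $d_C,d_\mu,d_\delta$, known matrices $B\in\mathbb R^{d_C\times d_\mu}$, $D\in\mathbb R^{d_C\times d_\delta}$, known vectors $d_n\in\mathbb R^{d_C}$ ($n\ge 1$), and a level $\alpha\in(0,1)$. For each $n$ let $\mathcal F_n$ be a set of distributions $F$ of the sample of size $n$; $\mu_F\in\mathbb R^{d_\mu}$ and $\Pi_F\in\mathbb R^{d_\mu\times d_\delta}$ are the true reduced-form parameters under $F$, $C_F=B\Pi_F+D$ and $b_F=d_n-B\mu_F$. The null distributions are $\mathcal F_{n0}=\{F\in\mathcal F_n: C_F\delta\le b_F\text{ for some }\delta\in\mathbb R^{d_\delta}\}$, assumed non-empty for every $n$. Let $\overline\mu_n,\overline\Pi_n$ be estimators of $\mu_F,\Pi_F$, let $\overline\Omega_n$ be an estimator of the asymptotic variance of $(\overline\mu_n',\mathrm{vec}(\overline\Pi_n)')'$, let $\widehat\Upsilon_n$ be a $d_\mu\times d_\mu$ weight matrix, and put $\overline C_n=B\overline\Pi_n+D$. For a matrix $\Omega$ and $\delta\in\mathbb R^{d_\delta}$ write $$\Sigma(\Omega,\delta)=\begin{pmatrix}I_{d_\mu}\\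 \delta\otimes I_{d_\mu}\end{pmatrix}'\Omega\begin{pmatrix}I_{d_\mu}\\ \delta\otimes I_{d_\mu}\end{pmatrix},$$ and for $K\subseteq\{1,\dots,d_C\}$ let $I_KM$ be the submatrix of the rows of $M$ with index in $K$. **The test.** Let $\widetilde\mu_n$ be the $\mu$-part of a minimizer of $n(\overline\mu_n-\mu)'\widehat\Upsilon_n(\overline\mu_n-\mu)$ over $\{(\mu,\delta):B\mu+\overline C_n\delta\le d_n\}$, let $\widetilde\delta_n$ be the point of smallest Euclidean norm of $\{\delta:B\widetilde\mu_n+\overline C_n\delta\le d_n\}$, and let $\widetilde\Sigma_n=\Sigma(\overline\Omega_n,\widetilde\delta_n)$. The two-step QLR statistic is $$T_n=\min_{\mu,\delta:\,B\mu+\overline C_n\delta\le d_n} n(\overline\mu_n-\mu)'\widetilde\Sigma_n^{-1}(\overline\mu_n-\mu).$$ Let $(\widehat\mu_n,\widehat\delta_n)$ be any solution of this problem, $\widehat K=\{j: e_j'\overline C_n\widehat\delta_n=e_j'(d_n-B\widehat\mu_n)\}$, and $$\widehat s_n=\mathrm{rk}(I_{\widehat K}[B,D])-\mathrm{rk}(I_{\widehat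 K}\overline C_n).$$ Let $cv(s,\alpha)$ be the $1-\alpha$ quantile of the $\chi^2$ distribution with $s$ degrees of freedom (the point mass at $0$ if $s=0$). The GCC test rejects when $T_n>cv(\widehat s_n,\alpha)$. **Assumption 1.** For every sequence $\{F_n\}_{n\ge1}$ with $F_n\in\mathcal F_{n0}$ and every subsequence of the indices there are a further subsequence $\{n_q\}$, vectors $\mu_\infty,d_\infty$, a matrix $\Pi_\infty$, a positive semi-definite $\Omega_\infty$ and a positive definite $\Upsilon_\infty$ such that (i) $\mu_{F_{n_q}}\to\mu_\infty$, $\Pi_{F_{n_q}}\to\Pi_\infty$, $d_{n_q}\to d_\infty$; (ii) $\sqrt{n_q}\,\big((\overline\mu_{n_q}-\mu_{F_{n_q}})',\mathrm{vec}(\overline\Pi_{n_q}-\Pi_{F_{n_q}})'\big)'\to_d N(0,\Omega_\infty)$; (iii) $\Sigma(\Omega_\infty,\delta^*_\infty)$ is positive definite, where $\delta^*_\infty$ is the point of smallest norm of $\{\delta:B\mu_\infty+(D+B\Pi_\infty)\delta\le d_\infty\}$; (iv) $\overline\Omega_{n_q}\to_p\Omega_\infty$; (v) $\widehat\Upsilon_{n_q}\to_p\Upsilon_\infty$;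 (vi) $\{\delta:B\mu_\infty+(D+B\Pi_\infty)\delta\le d_\infty\}\ne\emptyset$. Here the distribution of the estimators at sample size $n_q$ is taken under $F_{n_q}$. **Assumption 2 (stable rank).** Let $K^=\subseteq\{1,\dots,d_C\}$ be a set of indices of inequalities that come from equalities, each of which is written as a pair of opposing inequalities. For every sequence $\{F_n\}$ with $F_n\in\mathcal F_{n0}$ and every subsequence along which (i) holds with limits $\mu_\infty,\Pi_\infty,d_\infty$, put $C_\infty=B\Pi_\infty+D$ and $b_\infty=d_\infty-B\mu_\infty$; then there is a further subsequence $\{n_q\}$ along which $$P_{F_{n_q}}\big(\mathrm{rk}(I_K\overline C_{n_q})=\mathrm{rk}(I_KC_{F_{n_q}})=\mathrm{rk}(I_KC_\infty)\big)\to1$$ for every $K\supseteq K^=$ for which some $x\in\mathbb R^{d_\delta}$ satisfies $C_\infty x\le b_\infty$ and $I_K(C_\infty x-b_\infty)=0$. **Theorem.** If Assumptions 1 and 2 hold, then $$\limsup_{n\to\infty}\ \sup_{F\in\mathcal F_{n0}}P_F\big(T_n>cv(\widehat s_n,\alpha)\big)\le\alpha.$$ -/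

import Mathlib

open MeasureTheory ProbabilityTheory Filter Topology
open scoped Matrix

namespace GCC

noncomputable section

/-! ### Generic notions -/

/-- `x` solves the problem of minimizing `f` over `S`. -/
def IsArgmin {E : Type*} (f : E → ℝ) (S : Set E) (x : E) : Prop :=
  x ∈ S ∧ ∀ y ∈ S, f x ≤ f y

/-- A minimizer of `f` over `S` (an arbitrary element of `E` if there is none). -/
def argmin {E : Type*} [Nonempty E] (f : E → ℝ) (S : Set E) : E :=
  Classical.epsilon (IsArgmin f S)

/-- The Euclidean norm of a coordinate vector. -/
def euclNorm {k : ℕ} (x : Fin k → ℝ) : ℝ := ‖WithLp.toLp 2 x‖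

/-- The polyhedron `{δ : C δ ≤ b}` (coordinatewise inequalities). -/
def poly {dC dδ : ℕ} (C : Matrix (Fin dC) (Fin dδ) ℝ) (b : Fin dC → ℝ) : Set (Fin dδ → ℝ) :=
  {δ | C *ᵥ δ ≤ b}

/-- The point of smallest Euclidean norm of `{δ : C δ ≤ b}`. -/
def minNormPoint {dC dδ : ℕ} (C : Matrix (Fin dC) (Fin dδ) ℝ) (b : Fin dC → ℝ) : Fin dδ → ℝ :=
  argmin euclNorm (poly C b)

/-- `I_K M`: the rows of `M` with index in `K`. -/
def rows {dC : ℕ} {ι : Type*} (K : Set (Fin dC)) (M : Matrix (Fin dC) ι ℝ) : Matrix K ι ℝ :=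
  M.submatrix Subtype.val id

/-- The chi-squared distribution with `s` degrees of freedom: the law of the sum of the squares of
`s` independent standard normal variables (a point mass at `0` if `s = 0`). -/
def chiSq (s : ℕ) : Measure ℝ :=
  (Measure.pi fun _ : Fin s => gaussianReal 0 1).map fun z => ∑ i, z i ^ 2

/-- The `1 - α` quantile of the chi-squared distribution with `s` degrees of freedom. -/
def cv (s : ℕ) (α : ℝ) : ℝ := sInf {x : ℝ | 1 - α ≤ cdf (chiSq s) x}

/-- Convergence in probability to a constant, for variables `X q` that may live on different
probability spaces. -/
def TendstoInProb {Ω : ℕ → Type*} [∀ q, MeasurableSpace (Ω q)] {E : Type*} [TopologicalSpace E]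
    (P : ∀ q, Measure (Ω q)) (X : ∀ q, Ω q → E) (c : E) : Prop :=
  ∀ U ∈ 𝓝 c, Tendsto (fun q => P q {ω | X q ω ∉ U}) atTop (𝓝 0)

/-- Coordinates of `(μ', vec(Π)')'`: the entries of `μ`, then the entries of `Π` column by column,
with `Sum.inr (j, i)` the position of the entry in row `i` and column `j`. -/
abbrev StackIdx (dμ dδ : ℕ) : Type := Fin dμ ⊕ (Fin dδ × Fin dμ)

/-- The vector `(μ', vec(Π)')'`. -/
def stack {dμ dδ : ℕ} (μ : Fin dμ → ℝ) (Pi : Matrix (Fin dμ) (Fin dδ) ℝ) : StackIdx dμ dδ → ℝ :=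
  Sum.elim μ (Matrix.vec Pi)

/-- The matrix with blocks `I` and `δ ⊗ I` on top of each other; its transpose maps
`(μ', vec(Π)')'` to `μ + Π δ`. -/
def loading {dμ dδ : ℕ} (δ : Fin dδ → ℝ) : Matrix (StackIdx dμ dδ) (Fin dμ) ℝ :=
  Matrix.fromRows 1 (Matrix.of fun p i => δ p.1 * (1 : Matrix (Fin dμ) (Fin dμ) ℝ) p.2 i)

/-- The variance matrix of `μ + Π δ` when `Ω` is that of `(μ', vec(Π)')'`. -/
def sandwich {dμ dδ : ℕ} (Om : Matrix (StackIdx dμ dδ) (StackIdx dμ dδ) ℝ) (δ : Fin dδ → ℝ) :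
    Matrix (Fin dμ) (Fin dμ) ℝ :=
  (loading (dμ := dμ) δ).transpose * Om * loading δ

/-- The subsets of inequalities that can be simultaneously active in `C x ≤ b`. -/
def Activ {dC dδ : ℕ} (C : Matrix (Fin dC) (Fin dδ) ℝ) (b : Fin dC → ℝ) : Set (Set (Fin dC)) :=
  {K | ∃ x : Fin dδ → ℝ, C *ᵥ x ≤ b ∧ ∀ j ∈ K, (C *ᵥ x) j = b j}

/-! ### The two quadratic programs, for given values of the estimators -/

section Programs

/-- The set of `(μ, δ)` with `B μ + C δ ≤ d`. -/
def feasible {dC dμ dδ : ℕ} (B : Matrix (Fin dC) (Fin dμ) ℝ) (C : Matrix (Fin dC) (Fin dδ) ℝ)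
    (d : Fin dC → ℝ) : Set ((Fin dμ → ℝ) × (Fin dδ → ℝ)) :=
  {p | B *ᵥ p.1 + C *ᵥ p.2 ≤ d}

/-- The criterion `n (μbar - μ)' W (μbar - μ)`, as a function of `(μ, δ)`. -/
def qform {dμ dδ : ℕ} (n : ℕ+) (W : Matrix (Fin dμ) (Fin dμ) ℝ) (mubar : Fin dμ → ℝ)
    (p : (Fin dμ → ℝ) × (Fin dδ → ℝ)) : ℝ :=
  ((n : ℕ) : ℝ) * ((mubar - p.1) ⬝ᵥ (W *ᵥ (mubar - p.1)))

end Programs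

/-! ### The testing problem -/

/-- The data of the testing problem: `C = B Π + D` and `b = d - B μ`, where `B`, `D` and `d = d n`
are known and `μ`, `Π` are estimated. `Sample n` is the sample space at sample size `n`, and
`model n` is the parameter space for the distribution `F` of the sample; `muF n F` and `PiF n F`
are the true values of `μ` and `Π` under `F`. -/
structure Setup (dC dμ dδ : ℕ) where
  B : Matrix (Fin dC) (Fin dμ) ℝ
  D : Matrix (Fin dC) (Fin dδ) ℝ
  d : ℕ+ → Fin dC → ℝ
  /-- the indices of the inequalities that were originally equalities ... -/
  Keq : Set (Fin dC)
  /-- ... each of which is written as a pair of opposing inequalities -/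
  Keq_pair : ∀ j ∈ Keq, ∃ j', B j' = -B j ∧ D j' = -D j ∧ ∀ n, d n j' = -d n j
  Sample : ℕ+ → Type*
  sampleMeas : ∀ n, MeasurableSpace (Sample n)
  model : ∀ n, Set (ProbabilityMeasure (Sample n))
  muF : ∀ n, ProbabilityMeasure (Sample n) → Fin dμ → ℝ
  PiF : ∀ n, ProbabilityMeasure (Sample n) → Matrix (Fin dμ) (Fin dδ) ℝ
  /-- the estimator of `μ` -/
  muBar : ∀ n, Sample n → Fin dμ → ℝ
  /-- the estimator of `Π` -/
  PiBar : ∀ n, Sample n → Matrix (Fin dμ) (Fin dδ) ℝ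
  /-- the estimator of the asymptotic variance of `(muBar', vec(PiBar)')'` -/
  OmBar : ∀ n, Sample n → Matrix (StackIdx dμ dδ) (StackIdx dμ dδ) ℝ
  /-- the preliminary weight matrix -/
  Ups : ∀ n, Sample n → Matrix (Fin dμ) (Fin dμ) ℝ
  measurable_muBar : ∀ n i, Measurable fun ω => muBar n ω i
  measurable_PiBar : ∀ n i j, Measurable fun ω => PiBar n ω i j
  measurable_OmBar : ∀ n i j, Measurable fun ω => OmBar n ω i j
  measurable_Ups : ∀ n i j, Measurable fun ω => Ups n ω i j

attribute [instance] Setup.sampleMeas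

namespace Setup

/-- The true Jacobian `C_F = B Π_F + D`. -/
def CF {dC dμ dδ : ℕ} (S : Setup dC dμ dδ) (n : ℕ+) (F : ProbabilityMeasure (S.Sample n)) :
    Matrix (Fin dC) (Fin dδ) ℝ :=
  S.B * S.PiF n F + S.D

/-- The true intercept `b_F = d_n - B μ_F`. -/
def bF {dC dμ dδ : ℕ} (S : Setup dC dμ dδ) (n : ℕ+) (F : ProbabilityMeasure (S.Sample n)) :
    Fin dC → ℝ :=
  S.d n - S.B *ᵥ S.muF n F

/-- The distributions in the model that satisfy the null hypothesis `C_F δ ≤ b_F` for some `δ`. -/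
def null {dC dμ dδ : ℕ} (S : Setup dC dμ dδ) (n : ℕ+) : Set (ProbabilityMeasure (S.Sample n)) :=
  {F | F ∈ S.model n ∧ ∃ δ : Fin dδ → ℝ, S.CF n F *ᵥ δ ≤ S.bF n F}

/-- The estimated Jacobian. -/
def CBar {dC dμ dδ : ℕ} (S : Setup dC dμ dδ) (n : ℕ+) (ω : S.Sample n) :
    Matrix (Fin dC) (Fin dδ) ℝ :=
  S.B * S.PiBar n ω + S.D

/-- The constraint set of both quadratic programs. -/
def constr {dC dμ dδ : ℕ} (S : Setup dC dμ dδ) (n : ℕ+) (ω : S.Sample n) :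
    Set ((Fin dμ → ℝ) × (Fin dδ → ℝ)) :=
  feasible S.B (S.CBar n ω) (S.d n)

/-- The first-step estimator of `μ`. -/
def muTilde {dC dμ dδ : ℕ} (S : Setup dC dμ dδ) (n : ℕ+) (ω : S.Sample n) : Fin dμ → ℝ :=
  (argmin (qform n (S.Ups n ω) (S.muBar n ω)) (S.constr n ω)).1

/-- The first-step estimator of `δ`: the point of smallest norm of `{δ : CBar δ ≤ d - B muTilde}`. -/
def deltaTilde {dC dμ dδ : ℕ} (S : Setup dC dμ dδ) (n : ℕ+) (ω : S.Sample n) : Fin dδ → ℝ :=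
  minNormPoint (S.CBar n ω) (S.d n - S.B *ᵥ S.muTilde n ω)

/-- The second-step variance estimator. -/
def SigTilde {dC dμ dδ : ℕ} (S : Setup dC dμ dδ) (n : ℕ+) (ω : S.Sample n) :
    Matrix (Fin dμ) (Fin dμ) ℝ :=
  sandwich (S.OmBar n ω) (S.deltaTilde n ω)

/-- The criterion function of the second-step program. -/
def crit {dC dμ dδ : ℕ} (S : Setup dC dμ dδ) (n : ℕ+) (ω : S.Sample n) :
    (Fin dμ → ℝ) × (Fin dδ → ℝ) → ℝ :=
  qform n (S.SigTilde n ω)⁻¹ (S.muBar n ω)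

/-- The two-step QLR statistic: the minimum of the criterion over the constraint set. -/
def T {dC dμ dδ : ℕ} (S : Setup dC dμ dδ) (n : ℕ+) (ω : S.Sample n) : ℝ :=
  sInf (S.crit n ω '' S.constr n ω)

/-- The set of active inequalities at `(μ, δ)`. -/
def active {dC dμ dδ : ℕ} (S : Setup dC dμ dδ) (n : ℕ+) (ω : S.Sample n)
    (p : (Fin dμ → ℝ) × (Fin dδ → ℝ)) : Set (Fin dC) :=
  {j | (S.CBar n ω *ᵥ p.2) j = (S.d n - S.B *ᵥ p.1) j}

/-- The degrees of freedom `rk (I_K [B, D]) - rk (I_K CBar)`, with `K` the set of active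
inequalities at `p`. -/
def dof {dC dμ dδ : ℕ} (S : Setup dC dμ dδ) (n : ℕ+) (ω : S.Sample n)
    (p : (Fin dμ → ℝ) × (Fin dδ → ℝ)) : ℕ :=
  (rows (S.active n ω p) (Matrix.fromCols S.B S.D)).rank -
    (rows (S.active n ω p) (S.CBar n ω)).rank

/-- `√n` times the estimation error of `(μ', vec(Π)')'`. -/
def scaledError {dC dμ dδ : ℕ} (S : Setup dC dμ dδ) (n : ℕ+)
    (F : ProbabilityMeasure (S.Sample n)) (ω : S.Sample n) :
    EuclideanSpace ℝ (StackIdx dμ dδ) :=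
  Real.sqrt (n : ℕ) •
    WithLp.toLp 2 (stack (S.muBar n ω - S.muF n F) (S.PiBar n ω - S.PiF n F))

/-- Along the subsequence `φ`, the true values of `μ` and `Π`, and `d`, converge to the given
limits. -/
def ParamLimit {dC dμ dδ : ℕ} (S : Setup dC dμ dδ) (F : ∀ n, ProbabilityMeasure (S.Sample n))
    (φ : ℕ → ℕ+) (mu0 : Fin dμ → ℝ) (Pi0 : Matrix (Fin dμ) (Fin dδ) ℝ) (d0 : Fin dC → ℝ) : Prop :=
  Tendsto (fun q => S.muF (φ q) (F (φ q))) atTop (𝓝 mu0) ∧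
  Tendsto (fun q => S.PiF (φ q) (F (φ q))) atTop (𝓝 Pi0) ∧
  Tendsto (fun q => S.d (φ q)) atTop (𝓝 d0)

/-- Asymptotic normality of the reduced-form estimators and consistency of the variance
estimator, along subsequences of null distributions. -/
def AsymptoticNormality {dC dμ dδ : ℕ} (S : Setup dC dμ dδ) : Prop :=
  ∀ F : ∀ n, ProbabilityMeasure (S.Sample n), (∀ n, F n ∈ S.null n) →
  ∀ φ : ℕ → ℕ+, StrictMono φ →
  ∃ ψ : ℕ → ℕ, StrictMono ψ ∧
  ∃ (mu0 : Fin dμ → ℝ) (d0 : Fin dC → ℝ) (Pi0 : Matrix (Fin dμ) (Fin dδ) ℝ)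
    (Om0 : Matrix (StackIdx dμ dδ) (StackIdx dμ dδ) ℝ) (Ups0 : Matrix (Fin dμ) (Fin dμ) ℝ),
    Om0.PosSemidef ∧ Ups0.PosDef ∧
    S.ParamLimit F (φ ∘ ψ) mu0 Pi0 d0 ∧
    TendstoInDistribution
      (fun q => S.scaledError (φ (ψ q)) (F (φ (ψ q)))) atTop id
      (fun q => (F (φ (ψ q)) : Measure (S.Sample (φ (ψ q)))))
      (multivariateGaussian 0 Om0) ∧
    (sandwich Om0 (minNormPoint (S.B * Pi0 + S.D) (d0 - S.B *ᵥ mu0))).PosDef ∧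
    TendstoInProb (fun q => (F (φ (ψ q)) : Measure (S.Sample (φ (ψ q)))))
      (fun q => S.OmBar (φ (ψ q))) Om0 ∧
    TendstoInProb (fun q => (F (φ (ψ q)) : Measure (S.Sample (φ (ψ q)))))
      (fun q => S.Ups (φ (ψ q))) Ups0 ∧
    (poly (S.B * Pi0 + S.D) (d0 - S.B *ᵥ mu0)).Nonempty

/-- The stable rank condition on the Jacobian. -/
def StableRank {dC dμ dδ : ℕ} (S : Setup dC dμ dδ) : Prop :=
  ∀ F : ∀ n, ProbabilityMeasure (S.Sample n), (∀ n, F n ∈ S.null n) →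
  ∀ φ : ℕ → ℕ+, StrictMono φ →
  ∀ (mu0 : Fin dμ → ℝ) (Pi0 : Matrix (Fin dμ) (Fin dδ) ℝ) (d0 : Fin dC → ℝ),
    S.ParamLimit F φ mu0 Pi0 d0 →
  ∃ ψ : ℕ → ℕ, StrictMono ψ ∧
  ∀ K ∈ Activ (S.B * Pi0 + S.D) (d0 - S.B *ᵥ mu0), S.Keq ⊆ K →
    Tendsto
      (fun q => (F (φ (ψ q)) : Measure (S.Sample (φ (ψ q))))
        {ω | (rows K (S.CBar (φ (ψ q)) ω)).rank
              = (rows K (S.CF (φ (ψ q)) (F (φ (ψ q))))).rank ∧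
             (rows K (S.CF (φ (ψ q)) (F (φ (ψ q))))).rank
              = (rows K (S.B * Pi0 + S.D)).rank})
      atTop (𝓝 1)

end Setup

end

end GCC

/-! If the limsup exceeds α, there are null distributions along a subsequence whose rejection
probabilities stay above some a > α, while all quantities in the assumptions converge. Rank
stability makes the polyhedra lower semicontinuous (`exists_tendsto_poly`), so there are points δ_q
feasible under the true parameters with δ_q → δ*, the smallest-norm point of the limit polyhedron.
Passing to a further subsequence, each scaled slack √n (b_F - C_F δ_q)_j tends to some σ_j ≥ 0, for
j in a set J, or to infinity.

In the limit experiment, y = x_μ + x_Π δ* is normal with variance Σ = Σ(Ω_∞, δ*). It is projected,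
in the metric of Σ⁻¹, on the set of p such that (B'v)'p ≤ v'σ for every v ≥ 0 supported in J with
v'C_∞ = 0. The residual has the form Σ B'l for a multiplier l of this kind. `LimitReject` asks that
the residual be nonzero and that its squared length reach the critical value for the dimension of
{B'v : supp v ⊆ supp l, v'C_∞ = 0}. By `finrank_multSpace` that dimension is the rank difference
used by the test, with supp l in place of the sample active set.

`rejection_limit` shows that limits of scaled errors of rejecting samples fall in this region.
Optimal multipliers can be chosen bounded, hence convergent. Rank stability approximates limit
multipliers by sample ones, so the limit inequalities are inherited. The support of the limit
multiplier lies in the sample active set, so the sample critical value is no smaller than the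
limiting one. `le_measure_of_tendstoInDistribution` turns this pathwise statement into a ≤ P(limit
rejection).

It remains to bound that probability by α. After whitening, a standard Gaussian z is written as p +
r, with p the projection and r in a cone inside a subspace W_S attached to the support S of l.
Tightness of the inequalities fixes the component f of p in W_S, so slices parallel to W_S are
translated cones f + C, and ⟪f, r⟫ ≥ 0 on C because 0 satisfies all inequalities. In polar
coordinates around the apex the Gaussian density is the centred one times a factor decreasing in the
radius; hence ‖r‖ is stochastically dominated by the norm of a standard Gaussian on W_S
(`stdGaussian_cone_le`), and the conditional rejection probability is at most α. A point with
several types is assigned to one of least dimension, where the critical value is smallest; the types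
become disjoint and the bounds add up to α (`stdGaussian_region_le`). -/

namespace GCC

noncomputable section

/-! ### Sign-restricted multipliers -/

section Cones

variable {ι m : Type*}

/-- Multipliers supported in `K` and nonnegative outside of `E`. -/
def signCone (K E : Set ι) : Set (ι → ℝ) :=
  {l | (∀ j, j ∉ K → l j = 0) ∧ ∀ j, j ∉ E → 0 ≤ l j}

lemma signCone_smul {K E : Set ι} {l : ι → ℝ} (hl : l ∈ signCone K E) {c : ℝ} (hc : 0 ≤ c) :
    c • l ∈ signCone K E :=
  ⟨fun j hj => by simp [hl.1 j hj], fun j hj => mul_nonneg hc (hl.2 j hj)⟩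

lemma signCone_add {K E : Set ι} {l l' : ι → ℝ} (hl : l ∈ signCone K E)
    (hl' : l' ∈ signCone K E) : l + l' ∈ signCone K E :=
  ⟨fun j hj => by simp [hl.1 j hj, hl'.1 j hj], fun j hj => add_nonneg (hl.2 j hj) (hl'.2 j hj)⟩

lemma zero_mem_signCone (K E : Set ι) : (0 : ι → ℝ) ∈ signCone K E :=
  ⟨fun _ _ => rfl, fun _ _ => le_rfl⟩

lemma isClosed_signCone (K E : Set ι) : IsClosed (signCone K E) := by
  have h : signCone K E = (⋂ j, ⋂ (_ : j ∉ K), {l : ι → ℝ | l j = 0}) ∩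
      ⋂ j, ⋂ (_ : j ∉ E), {l : ι → ℝ | 0 ≤ l j} := by
    ext l; simp [signCone]
  rw [h]
  exact (isClosed_iInter fun j => isClosed_iInter fun _ =>
      isClosed_eq (continuous_apply j) continuous_const).inter
    (isClosed_iInter fun j => isClosed_iInter fun _ =>
      isClosed_le continuous_const (continuous_apply j))

/-- A sequence in a finite type is constant along some subsequence. -/
lemma exists_subseq_const {α : Type*} [Finite α] (f : ℕ → α) :
    ∃ a, ∃ φ : ℕ → ℕ, StrictMono φ ∧ ∀ n, f (φ n) = a := by
  obtain ⟨a, ha⟩ := Finite.exists_infinite_fiber f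
  have h : ∃ᶠ n in atTop, f n = a := by
    rw [Nat.frequently_atTop_iff_infinite]
    exact Set.infinite_coe_iff.mp ha
  obtain ⟨φ, hφ, h⟩ := extraction_of_frequently_atTop h
  exact ⟨a, φ, hφ, h⟩

variable [Fintype ι]

lemma tendsto_vecMul {α : Type*} {F : Filter α} {f : α → ι → ℝ} {v : ι → ℝ}
    {A : α → Matrix ι m ℝ} {A0 : Matrix ι m ℝ} (hf : Tendsto f F (𝓝 v))
    (hA : Tendsto A F (𝓝 A0)) : Tendsto (fun k => f k ᵥ* A k) F (𝓝 (v ᵥ* A0)) := by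
  have h : Continuous fun p : (ι → ℝ) × Matrix ι m ℝ => p.1 ᵥ* p.2 :=
    Continuous.matrix_vecMul continuous_fst continuous_snd
  exact (h.tendsto (v, A0)).comp (hf.prodMk_nhds hA)

lemma tendsto_mulVec {α n : Type*} [Fintype n] {F : Filter α} {f : α → n → ℝ} {v : n → ℝ}
    {A : α → Matrix m n ℝ} {A0 : Matrix m n ℝ} (hA : Tendsto A F (𝓝 A0))
    (hf : Tendsto f F (𝓝 v)) : Tendsto (fun k => A k *ᵥ f k) F (𝓝 (A0 *ᵥ v)) := by
  have h : Continuous fun p : Matrix m n ℝ × (n → ℝ) => p.1 *ᵥ p.2 :=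
    Continuous.matrix_mulVec continuous_fst continuous_snd
  exact (h.tendsto (A0, v)).comp (hA.prodMk_nhds hf)

/-- Uniformly bounded multipliers: if the kernels of `A n` approximate the kernel of the limit,
then images under `A n` of sign-restricted multipliers that are bounded are the images of bounded
multipliers. -/
theorem bounded_multipliers [Finite m] {K E : Set ι} {A : ℕ → Matrix ι m ℝ}
    {A0 : Matrix ι m ℝ} (hA : Tendsto A atTop (𝓝 A0)) {l : ℕ → ι → ℝ}
    (hl : ∀ n, l n ∈ signCone K E) {M : ℝ} (hM : ∀ n j, |(l n ᵥ* A n) j| ≤ M)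
    (hker : ∀ v ∈ signCone K E, v ᵥ* A0 = 0 → ∃ κ : ℕ → ι → ℝ, Tendsto κ atTop (𝓝 v) ∧
      (∀ᶠ n in atTop, κ n ᵥ* A n = 0) ∧ ∀ n j, κ n j ≠ 0 → j ∈ K ∧ (v j ≠ 0 ∨ j ∈ E)) :
    ∃ (l' : ℕ → ι → ℝ) (R : ℝ), (∀ n, l' n ∈ signCone K E) ∧
      (∀ n, l' n ᵥ* A n = l n ᵥ* A n) ∧ ∀ n, ‖l' n‖ ≤ R := by
  -- Among all sign-restricted multipliers with the prescribed image take one of least norm. If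
  -- these were unbounded, a kernel direction could be removed to shorten one of them.
  have hex : ∀ n, ∃ w ∈ {w | w ∈ signCone K E ∧ w ᵥ* A n = l n ᵥ* A n},
      ∀ w' ∈ {w | w ∈ signCone K E ∧ w ᵥ* A n = l n ᵥ* A n}, ‖w‖ ≤ ‖w'‖ := by
    intro n
    have hc : IsClosed {w | w ∈ signCone K E ∧ w ᵥ* A n = l n ᵥ* A n} :=
      (isClosed_signCone K E).inter (isClosed_eq
        (Continuous.matrix_vecMul continuous_id continuous_const) continuous_const)
    obtain ⟨w, hw, hw'⟩ := hc.exists_infDist_eq_dist ⟨l n, hl n, rfl⟩ 0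
    refine ⟨w, hw, fun w' hw'' => ?_⟩
    have := Metric.infDist_le_dist_of_mem (x := (0 : ι → ℝ)) hw''
    rw [hw'] at this
    simpa [dist_eq_norm] using this
  choose w hw hmin using hex
  by_contra hcon
  push Not at hcon
  have hunb : ∀ R : ℕ, ∃ n, (R : ℝ) < ‖w n‖ := fun R =>
    hcon w R (fun n => (hw n).1) (fun n => (hw n).2)
  have hfreq : ∀ R : ℕ, ∃ᶠ n in atTop, (R : ℝ) < ‖w n‖ := by
    intro R
    rw [frequently_atTop]
    intro N
    obtain ⟨R', hR'⟩ := exists_nat_ge (∑ k ∈ Finset.range N, ‖w k‖)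
    obtain ⟨n, hn⟩ := hunb (max R R')
    refine ⟨n, ?_, lt_of_le_of_lt (by exact_mod_cast le_max_left _ _) hn⟩
    by_contra hlt
    push Not at hlt
    have h1 : ‖w n‖ ≤ ∑ k ∈ Finset.range N, ‖w k‖ :=
      Finset.single_le_sum (f := fun k => ‖w k‖) (fun k _ => norm_nonneg _)
        (Finset.mem_range.mpr hlt)
    have h2 : (R' : ℝ) ≤ ((max R R' : ℕ) : ℝ) := by exact_mod_cast le_max_right _ _
    linarith
  obtain ⟨φ, hφ, hlt⟩ := extraction_forall_of_frequently hfreq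
  have hpos : ∀ k, 0 < ‖w (φ k)‖ := fun k => lt_of_le_of_lt (Nat.cast_nonneg k) (hlt k)
  have hinv : Tendsto (fun k => ‖w (φ k)‖⁻¹) atTop (𝓝 0) := by
    refine Tendsto.inv_tendsto_atTop ?_
    exact tendsto_atTop_mono (fun k => (hlt k).le) tendsto_natCast_atTop_atTop
  -- The images are bounded while the norms diverge, so a limit point of the normalized multipliers
  -- is a unit vector of the cone annihilated by `A0`.
  set s : ℕ → ι → ℝ := fun k => ‖w (φ k)‖⁻¹ • w (φ k) with hs
  have hsn : ∀ k, s k ∈ Metric.sphere (0 : ι → ℝ) 1 := fun k => by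
    simp [hs, norm_smul, (hpos k).ne']
  obtain ⟨v, hv, τ, hτ, hlim⟩ := (isCompact_sphere (0 : ι → ℝ) 1).tendsto_subseq hsn
  have hvc : v ∈ signCone K E := (isClosed_signCone K E).mem_of_tendsto hlim
    (Eventually.of_forall fun k => signCone_smul (hw _).1 (inv_nonneg.mpr (norm_nonneg _)))
  have hφτ : Tendsto (fun k => φ (τ k)) atTop atTop := hφ.tendsto_atTop.comp hτ.tendsto_atTop
  have hv0 : v ᵥ* A0 = 0 := by
    have h1 : Tendsto (fun k => s (τ k) ᵥ* A (φ (τ k))) atTop (𝓝 (v ᵥ* A0)) :=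
      tendsto_vecMul hlim (hA.comp hφτ)
    refine tendsto_nhds_unique h1 ?_
    rw [tendsto_pi_nhds]
    intro j
    have h2 : ∀ k, (s (τ k) ᵥ* A (φ (τ k))) j =
        ‖w (φ (τ k))‖⁻¹ * (l (φ (τ k)) ᵥ* A (φ (τ k))) j := fun k => by
      simp only [hs, Matrix.smul_vecMul, (hw _).2, Pi.smul_apply, smul_eq_mul]
    simp only [h2]
    have h3 := (hinv.comp hτ.tendsto_atTop).mul_const M
    rw [zero_mul] at h3
    refine squeeze_zero_norm (fun k => ?_) h3
    rw [Real.norm_eq_abs, abs_mul, abs_of_nonneg (inv_nonneg.mpr (norm_nonneg _))]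
    exact mul_le_mul_of_nonneg_left (hM _ j) (inv_nonneg.mpr (norm_nonneg _))
  obtain ⟨κ, hκ, hκ0, hκs⟩ := hker v hvc hv0
  have hκ' : Tendsto (fun k => κ (φ (τ k))) atTop (𝓝 v) := hκ.comp hφτ
  -- the reduced multiplier, normalized
  have hd : Tendsto (fun k => s (τ k) - (1 / 2 : ℝ) • κ (φ (τ k))) atTop
      (𝓝 (v - (1 / 2 : ℝ) • v)) := hlim.sub (hκ'.const_smul _)
  have hdn : Tendsto (fun k => ‖s (τ k) - (1 / 2 : ℝ) • κ (φ (τ k))‖) atTop (𝓝 (1 / 2)) := by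
    have h1 : ‖v - (1 / 2 : ℝ) • v‖ = 1 / 2 := by
      have h2 : v - (1 / 2 : ℝ) • v = (1 / 2 : ℝ) • v := by
        ext j; simp; ring
      rw [h2, norm_smul]
      have h3 : ‖v‖ = 1 := by simpa using hv
      rw [h3]; norm_num
    have h4 := hd.norm
    rwa [h1] at h4
  have e1 : ∀ᶠ k in atTop, ‖s (τ k) - (1 / 2 : ℝ) • κ (φ (τ k))‖ < 1 :=
    hdn.eventually (gt_mem_nhds (by norm_num))
  have e2 : ∀ᶠ k in atTop, κ (φ (τ k)) ᵥ* A (φ (τ k)) = 0 := hφτ.eventually hκ0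
  have e3 : ∀ᶠ k in atTop, ∀ j, j ∉ E → v j ≠ 0 →
      0 ≤ (s (τ k) - (1 / 2 : ℝ) • κ (φ (τ k))) j := by
    rw [eventually_all]
    intro j
    by_cases hj : j ∉ E ∧ v j ≠ 0
    · have hvj : 0 < v j := lt_of_le_of_ne (hvc.2 j hj.1) (Ne.symm hj.2)
      have h1 := tendsto_pi_nhds.mp hd j
      have h2 : (0 : ℝ) < (v - (1 / 2 : ℝ) • v) j := by
        simp only [Pi.sub_apply, Pi.smul_apply, smul_eq_mul]; linarith
      filter_upwards [h1.eventually (lt_mem_nhds h2)] with k hk _ _ using hk.le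
    · exact Eventually.of_forall fun k h1 h2 => absurd ⟨h1, h2⟩ hj
  -- Removing half of the approximating kernel vector keeps the image and leaves about half of each
  -- nonzero coordinate of `v`, so signs survive; the norm drops to about 1/2, against minimality of
  -- `w`.
  obtain ⟨k, k1, k2, k3⟩ := (e1.and (e2.and e3)).exists
  set n := φ (τ k) with hn
  have hmem : s (τ k) - (1 / 2 : ℝ) • κ n ∈ signCone K E := by
    have hsc : s (τ k) ∈ signCone K E :=
      signCone_smul (hw _).1 (inv_nonneg.mpr (norm_nonneg _))
    refine ⟨fun j hj => ?_, fun j hj => ?_⟩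
    · have : κ n j = 0 := by
        by_contra h
        exact hj (hκs n j h).1
      simp [hsc.1 j hj, this]
    · by_cases hvj : v j = 0
      · have : κ n j = 0 := by
          by_contra h
          rcases (hκs n j h).2 with h' | h'
          · exact h' hvj
          · exact hj h'
        simpa [this] using hsc.2 j hj
      · exact k3 j hj hvj
  have hfin := hmin n (‖w n‖ • (s (τ k) - (1 / 2 : ℝ) • κ n))
    ⟨signCone_smul hmem (norm_nonneg _), by
      have h1 : s (τ k) ᵥ* A n = ‖w n‖⁻¹ • (l n ᵥ* A n) := by
        rw [← (hw n).2]; exact Matrix.smul_vecMul _ _ _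
      have h2 : ((1 / 2 : ℝ) • κ n) ᵥ* A n = 0 := by
        rw [Matrix.smul_vecMul, k2, smul_zero]
      rw [Matrix.smul_vecMul, Matrix.sub_vecMul, h1, h2, sub_zero, smul_smul,
        mul_inv_cancel₀ (hpos (τ k)).ne', one_smul]⟩
  rw [norm_smul, norm_norm] at hfin
  have := mul_lt_mul_of_pos_left k1 (hpos (τ k))
  rw [← hn] at this
  linarith

/-- Bounded multipliers for a fixed matrix. -/
theorem bounded_multipliers_const [Finite m] {K E : Set ι} (A : Matrix ι m ℝ) {l : ℕ → ι → ℝ}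
    (hl : ∀ n, l n ∈ signCone K E) {M : ℝ} (hM : ∀ n j, |(l n ᵥ* A) j| ≤ M) :
    ∃ (l' : ℕ → ι → ℝ) (R : ℝ), (∀ n, l' n ∈ signCone K E) ∧
      (∀ n, l' n ᵥ* A = l n ᵥ* A) ∧ ∀ n, ‖l' n‖ ≤ R :=
  bounded_multipliers (A := fun _ => A) tendsto_const_nhds hl hM fun v hv hv0 =>
    ⟨fun _ => v, tendsto_const_nhds, Eventually.of_forall fun _ => hv0, fun _ j hj =>
      ⟨by by_contra h; exact hj (hv.1 j h), Or.inl hj⟩⟩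

/-- Finitely generated cones are closed. -/
theorem isClosed_image_signCone [Fintype m] (K E : Set ι) (A : Matrix ι m ℝ) :
    IsClosed ((fun l => l ᵥ* A) '' signCone K E) := by
  refine isClosed_of_closure_subset fun x hx => ?_
  obtain ⟨u, hu, hux⟩ := mem_closure_iff_seq_limit.mp hx
  choose l hl hlu using hu
  obtain ⟨M, hM⟩ := (Metric.isBounded_range_of_tendsto u hux).exists_norm_le
  -- A convergent sequence in the image has bounded preimages, and a cluster point of these maps to
  -- the limit.
  obtain ⟨l', R, h1, h2, h3⟩ := bounded_multipliers_const (M := M) A hl (fun n j => by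
    have h1 := hM (u n) ⟨n, rfl⟩
    have h2 := norm_le_pi_norm (u n) j
    rw [← hlu n] at h1 h2
    exact h2.trans h1)
  obtain ⟨v, -, φ, hφ, hv⟩ := (isCompact_closedBall (0 : ι → ℝ) R).tendsto_subseq
    (x := l') (fun n => by simpa using h3 n)
  refine ⟨v, (isClosed_signCone K E).mem_of_tendsto hv (Eventually.of_forall fun n => h1 _), ?_⟩
  have h4 : Tendsto (fun n => l' (φ n) ᵥ* A) atTop (𝓝 (v ᵥ* A)) :=
    ((Continuous.matrix_vecMul continuous_id continuous_const).tendsto v).comp hv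
  refine tendsto_nhds_unique h4 ((hux.comp hφ.tendsto_atTop).congr fun n => ?_)
  simp [h2, ← hlu]

/-- Farkas' lemma. -/
theorem farkas [Fintype m] (K E : Set ι) (A : Matrix ι m ℝ) (g : m → ℝ)
    (h : ∀ u : m → ℝ, (∀ j ∈ K, j ∉ E → (A *ᵥ u) j ≤ 0) → (∀ j ∈ K, j ∈ E → (A *ᵥ u) j = 0) →
      g ⬝ᵥ u ≤ 0) :
    ∃ l ∈ signCone K E, l ᵥ* A = g := by
  classical
  by_contra hcon
  set S := (fun l => l ᵥ* A) '' signCone K E with hS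
  have hg : g ∉ S := fun ⟨l, hl, hlg⟩ => hcon ⟨l, hl, hlg⟩
  have hconv : Convex ℝ S := by
    rintro _ ⟨l, hl, rfl⟩ _ ⟨l', hl', rfl⟩ a b ha hb _
    exact ⟨a • l + b • l', signCone_add (signCone_smul hl ha) (signCone_smul hl' hb), by
      simp [Matrix.add_vecMul, Matrix.smul_vecMul]⟩
  -- Separate `g` from the closed cone. The vector `y` representing the separating functional then
  -- satisfies the premises of `h` but has `g ⬝ᵥ y > 0`.
  obtain ⟨f, u, hf, hu⟩ := geometric_hahn_banach_closed_point hconv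
    (isClosed_image_signCone K E A) hg
  have hu0 : 0 < u := by
    simpa using hf 0 ⟨0, zero_mem_signCone K E, by simp⟩
  have hneg : ∀ l ∈ signCone K E, f (l ᵥ* A) ≤ 0 := by
    intro l hl
    by_contra! hpos
    -- Were the functional positive somewhere on the cone, rescaling would make it attain the value
    -- `u` exactly.
    have := hf _ ⟨(u / f (l ᵥ* A)) • l, signCone_smul hl (div_nonneg hu0.le hpos.le), rfl⟩
    simp only [Matrix.smul_vecMul, map_smul, smul_eq_mul] at this
    rw [div_mul_cancel₀ _ hpos.ne'] at this
    exact lt_irrefl _ this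
  set y : m → ℝ := fun i => f (Pi.single i 1) with hy
  have hfy : ∀ x : m → ℝ, f x = x ⬝ᵥ y := by
    intro x
    conv_lhs => rw [pi_eq_sum_univ' x, map_sum]
    refine Finset.sum_congr rfl fun i _ => ?_
    rw [map_smul, smul_eq_mul]
  have hrow : ∀ j, f (Pi.single j (1 : ℝ) ᵥ* A) = (A *ᵥ y) j := by
    intro j
    rw [hfy, Matrix.single_one_vecMul]
    rfl
  have := h y (fun j hj _ => by
      rw [← hrow]
      exact hneg _ ⟨fun i hi => Pi.single_eq_of_ne (by rintro rfl; exact hi hj) _, fun i _ => by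
        by_cases hij : i = j
        · subst hij; simp
        · simp [hij]⟩)
    (fun j hj hjE => by
      have hz : ∀ c : ℝ, Pi.single j c ∈ signCone K E := fun c =>
        ⟨fun i hi => Pi.single_eq_of_ne (by rintro rfl; exact hi hj) _, fun i hi => by
          rw [Pi.single_eq_of_ne (by rintro rfl; exact hi hjE)]⟩
      refine le_antisymm (by rw [← hrow]; exact hneg _ (hz 1)) ?_
      have h1 := hneg _ (hz (-1))
      rw [Pi.single_neg, Matrix.neg_vecMul, map_neg, hrow] at h1
      linarith)
  rw [← hfy] at this
  linarith

/-- First-order conditions for the minimization of a quadratic function over a polyhedron, with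
multipliers supported by the active constraints. -/
theorem exists_multipliers [Fintype m] (A : Matrix ι m ℝ) (b : ι → ℝ) (q : (m → ℝ) → ℝ)
    (z g : m → ℝ) (c : (m → ℝ) → ℝ) (hz : A *ᵥ z ≤ b)
    (hq : ∀ u (t : ℝ), q (z + t • u) = q z - t * (g ⬝ᵥ u) + t ^ 2 * c u)
    (hmin : ∀ z', A *ᵥ z' ≤ b → q z ≤ q z') :
    ∃ l ∈ signCone {j | (A *ᵥ z) j = b j} ∅, l ᵥ* A = g := by
  refine farkas _ _ A g fun u hu _ => ?_
  have hfeas : ∀ᶠ t : ℝ in 𝓝[>] 0, A *ᵥ (z + t • u) ≤ b := by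
    simp only [Pi.le_def, eventually_all]
    intro j
    by_cases hj : (A *ᵥ z) j = b j
    · have h1 := hu j hj (by simp)
      filter_upwards [self_mem_nhdsWithin] with t ht
      rw [Matrix.mulVec_add, Matrix.mulVec_smul, Pi.add_apply, Pi.smul_apply, smul_eq_mul, hj]
      nlinarith [Set.mem_Ioi.mp ht]
    · have h1 : (A *ᵥ z) j < b j := lt_of_le_of_ne (hz j) hj
      have h2 : Tendsto (fun t : ℝ => (A *ᵥ (z + t • u)) j) (𝓝[>] 0) (𝓝 ((A *ᵥ z) j)) := by
        have h3 : Continuous fun t : ℝ => (A *ᵥ z) j + t * (A *ᵥ u) j := by fun_prop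
        have h4 := (h3.tendsto 0).mono_left (nhdsWithin_le_nhds (s := Set.Ioi 0))
        simpa [Matrix.mulVec_add, Matrix.mulVec_smul] using h4
      filter_upwards [h2.eventually (gt_mem_nhds h1)] with t ht using ht.le
  -- Here `g` is minus the gradient at the minimizer. Dividing the minimality inequality by the step
  -- length `t` leaves only the second-order remainder.
  have hle : ∀ᶠ t : ℝ in 𝓝[>] 0, g ⬝ᵥ u ≤ t * c u := by
    filter_upwards [hfeas, self_mem_nhdsWithin] with t ht ht0
    have h1 := hmin _ ht
    rw [hq] at h1
    have ht0 : 0 < t := ht0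
    nlinarith
  have hlim : Tendsto (fun t : ℝ => t * c u) (𝓝[>] 0) (𝓝 0) := by
    have h3 : Continuous fun t : ℝ => t * c u := by fun_prop
    have h4 := (h3.tendsto 0).mono_left (nhdsWithin_le_nhds (s := Set.Ioi 0))
    simpa using h4
  exact ge_of_tendsto hlim hle

end Cones

/-! ### Approximation of kernels under rank stability -/

section Kernels

variable {κ m : Type*} [Fintype κ] [Fintype m]

lemma continuous_toCLM [DecidableEq m] : Continuous fun M : Matrix κ m ℝ =>
    LinearMap.toContinuousLinearMap (Matrix.toLin' M) :=
  LinearMap.continuous_of_finiteDimensional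
    ((LinearMap.toContinuousLinearMap (𝕜 := ℝ) (E := m → ℝ) (F' := κ → ℝ)).toLinearMap ∘ₗ
      (Matrix.toLin' (R := ℝ) (m := κ) (n := m)).toLinearMap)

/-- If `M n → M0` and the ranks are eventually those of the limit, each vector of the kernel of
`M0` is a limit of vectors of the kernels of `M n`. -/
theorem exists_tendsto_ker_mulVec {M : ℕ → Matrix κ m ℝ} {M0 : Matrix κ m ℝ}
    (hM : Tendsto M atTop (𝓝 M0)) (hr : ∀ᶠ n in atTop, (M n).rank = M0.rank) {v : m → ℝ}
    (hv : M0 *ᵥ v = 0) :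
    ∃ w : ℕ → m → ℝ, Tendsto w atTop (𝓝 v) ∧ ∀ᶠ n in atTop, M n *ᵥ w n = 0 := by
  classical
  set F : Matrix κ m ℝ → ((m → ℝ) →L[ℝ] (κ → ℝ)) := fun M =>
    LinearMap.toContinuousLinearMap (Matrix.toLin' M) with hF
  have hFa : ∀ M x, F M x = M *ᵥ x := fun M x => rfl
  -- On a complement of the limit kernel, `M0` is bounded below, and this persists under
  -- perturbation. The approximants will be `v` minus a small correction in `U`.
  obtain ⟨U, hU⟩ := Submodule.exists_isCompl (LinearMap.ker (Matrix.toLin' M0))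
  have hinj : Function.Injective ((Matrix.toLin' M0).comp U.subtype) := by
    rw [← LinearMap.ker_eq_bot]
    rw [LinearMap.ker_eq_bot']
    intro u hu
    have h1 : (u : m → ℝ) ∈ LinearMap.ker (Matrix.toLin' M0) := hu
    have h2 := (Submodule.disjoint_def.mp hU.disjoint) _ h1 u.2
    exact Subtype.ext h2
  obtain ⟨c, hc, hanti⟩ := LinearMap.exists_antilipschitzWith _ (LinearMap.ker_eq_bot.mpr hinj)
  have hlow : ∀ u ∈ U, ‖u‖ ≤ c * ‖M0 *ᵥ u‖ := by
    intro u hu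
    have := hanti.le_mul_dist (⟨u, hu⟩ : U) 0
    simpa [dist_eq_norm] using this
  have hc' : (0 : ℝ) < c := hc
  have hnorm : ∀ᶠ n in atTop, ‖F (M n) - F M0‖ < 1 / (2 * c) := by
    have h1 : Tendsto (fun n => ‖F (M n) - F M0‖) atTop (𝓝 ‖F M0 - F M0‖) :=
      (((continuous_toCLM.tendsto M0).comp hM).sub_const _).norm
    rw [sub_self, norm_zero] at h1
    exact h1.eventually (gt_mem_nhds (by positivity))
  have hlow' : ∀ᶠ n in atTop, ∀ u ∈ U, ‖u‖ ≤ 2 * c * ‖M n *ᵥ u‖ := by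
    filter_upwards [hnorm] with n hn u hu
    have h1 := hlow u hu
    have h2 : ‖M n *ᵥ u - M0 *ᵥ u‖ ≤ 1 / (2 * c) * ‖u‖ := by
      have := (F (M n) - F M0).le_opNorm u
      exact this.trans (mul_le_mul_of_nonneg_right hn.le (norm_nonneg _))
    have h3 : ‖M0 *ᵥ u‖ ≤ ‖M n *ᵥ u‖ + 1 / (2 * c) * ‖u‖ := by
      have := norm_sub_norm_le (M0 *ᵥ u) (M n *ᵥ u)
      rw [norm_sub_rev] at this
      linarith
    have h4 : (c : ℝ) * (1 / (2 * c) * ‖u‖) = ‖u‖ / 2 := by field_simp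
    nlinarith
  -- `M n` is injective on `U`, whose dimension is the common rank, so `U` already maps onto the
  -- whole range of `M n`. The lower bound makes the solution of order `‖M n *ᵥ v‖`, which tends to
  -- 0.
  have hsol : ∀ᶠ n in atTop, ∃ u ∈ U, M n *ᵥ u = M n *ᵥ v := by
    filter_upwards [hlow', hr] with n hn hrn
    have hinjn : Function.Injective ((Matrix.toLin' (M n)).comp U.subtype) := by
      rw [← LinearMap.ker_eq_bot, LinearMap.ker_eq_bot']
      intro u hu
      have h1 : M n *ᵥ (u : m → ℝ) = 0 := hu
      have h2 := hn u u.2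
      rw [h1, norm_zero, mul_zero] at h2
      exact Subtype.ext (norm_le_zero_iff.mp h2)
    have hdim : Module.finrank ℝ U = M0.rank := by
      have h1 := Submodule.finrank_add_eq_of_isCompl hU
      have h2 := LinearMap.finrank_range_add_finrank_ker (Matrix.toLin' M0)
      have h3 : M0.rank = Module.finrank ℝ (LinearMap.range (Matrix.toLin' M0)) := by
        rw [Matrix.rank_eq_finrank_range_toLin M0 (Pi.basisFun ℝ κ) (Pi.basisFun ℝ m),
          Matrix.toLin_eq_toLin']
      omega
    have hle : LinearMap.range ((Matrix.toLin' (M n)).comp U.subtype) ≤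
        LinearMap.range (Matrix.toLin' (M n)) := LinearMap.range_comp_le_range _ _
    have heq := Submodule.eq_of_le_of_finrank_eq hle (by
      rw [LinearMap.finrank_range_of_inj hinjn, hdim, ← hrn,
        Matrix.rank_eq_finrank_range_toLin (M n) (Pi.basisFun ℝ κ) (Pi.basisFun ℝ m),
          Matrix.toLin_eq_toLin'])
    have hmem : M n *ᵥ v ∈ LinearMap.range ((Matrix.toLin' (M n)).comp U.subtype) := by
      rw [heq]; exact ⟨v, rfl⟩
    obtain ⟨u, hu⟩ := hmem
    exact ⟨u, u.2, hu⟩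
  have hch : ∀ n, ∃ u : m → ℝ, (∃ u ∈ U, M n *ᵥ u = M n *ᵥ v) → u ∈ U ∧ M n *ᵥ u = M n *ᵥ v := by
    intro n
    by_cases h : ∃ u ∈ U, M n *ᵥ u = M n *ᵥ v
    · obtain ⟨u, h1, h2⟩ := h
      exact ⟨u, fun _ => ⟨h1, h2⟩⟩
    · exact ⟨0, fun h' => absurd h' h⟩
  choose u hu using hch
  refine ⟨fun n => v - u n, ?_, ?_⟩
  · have h1 : Tendsto (fun n => M n *ᵥ v) atTop (𝓝 0) := by
      rw [← hv]
      exact ((Continuous.matrix_mulVec continuous_id continuous_const).tendsto M0).comp hM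
    have h2 : Tendsto (fun n => 2 * c * ‖M n *ᵥ v‖) atTop (𝓝 0) := by
      simpa using (h1.norm.const_mul (2 * (c : ℝ)))
    have h3 : Tendsto u atTop (𝓝 0) := by
      refine squeeze_zero_norm' ?_ h2
      filter_upwards [hlow', hsol] with n hn hs
      have := hn (u n) (hu n hs).1
      rwa [(hu n hs).2] at this
    simpa using h3.const_sub v
  · filter_upwards [hsol] with n hs
    rw [Matrix.mulVec_sub, (hu n hs).2, sub_self]

end Kernels

/-! ### Rows and supports -/

section Rows

variable {dC : ℕ} {m : Type*}

/-- Extension by zero of a vector with coordinates in `K`. -/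
def extendZero (K : Set (Fin dC)) (w : K → ℝ) : Fin dC → ℝ := by
  classical exact fun j => if h : j ∈ K then w ⟨j, h⟩ else 0

lemma extendZero_mem {K : Set (Fin dC)} (w : K → ℝ) {j : Fin dC} (h : j ∈ K) :
    extendZero K w j = w ⟨j, h⟩ := dif_pos h

lemma extendZero_notMem {K : Set (Fin dC)} (w : K → ℝ) {j : Fin dC} (h : j ∉ K) :
    extendZero K w j = 0 := dif_neg h

lemma extendZero_restrict {K : Set (Fin dC)} {v : Fin dC → ℝ} (hv : ∀ j, j ∉ K → v j = 0) :
    extendZero K (fun j => v j) = v := by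
  ext j
  by_cases h : j ∈ K
  · rw [extendZero_mem _ h]
  · rw [extendZero_notMem _ h, hv j h]

lemma vecMul_rows (K : Set (Fin dC)) [Fintype K] (w : K → ℝ) (M : Matrix (Fin dC) m ℝ) :
    w ᵥ* rows K M = extendZero K w ᵥ* M := by
  classical
  ext i
  simp only [Matrix.vecMul, dotProduct, rows, Matrix.submatrix_apply, id]
  rw [← Finset.sum_subset (Finset.subset_univ (Finset.univ.filter (· ∈ K)))]
  · rw [← Finset.sum_subtype (p := (· ∈ K)) (Finset.univ.filter (· ∈ K)) (by simp)
      (fun j => extendZero K w j * M j i) |>.symm]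
    exact Finset.sum_congr rfl fun j _ => by rw [extendZero_mem w j.2]
  · intro j _ hj
    rw [extendZero_notMem w (by simpa using hj), zero_mul]

/-- Rank stability of the rows in `K` lets multipliers supported in `K` that annihilate the limit
be approximated. -/
lemma exists_tendsto_ker_rows [Fintype m] {K : Set (Fin dC)} {C : ℕ → Matrix (Fin dC) m ℝ}
    {C0 : Matrix (Fin dC) m ℝ} (hC : Tendsto C atTop (𝓝 C0))
    (hr : ∀ᶠ n in atTop, (rows K (C n)).rank = (rows K C0).rank) {v : Fin dC → ℝ}
    (hs : ∀ j, j ∉ K → v j = 0) (hv : v ᵥ* C0 = 0) :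
    ∃ w : ℕ → Fin dC → ℝ, Tendsto w atTop (𝓝 v) ∧ (∀ᶠ n in atTop, w n ᵥ* C n = 0) ∧
      ∀ n j, j ∉ K → w n j = 0 := by
  classical
  obtain ⟨w, hw, hw0⟩ := exists_tendsto_ker_mulVec (M := fun n => (rows K (C n))ᵀ)
    (M0 := (rows K C0)ᵀ) (v := fun j : K => v j)
    (by
      have h : Continuous fun M : Matrix (Fin dC) m ℝ => (rows K M)ᵀ :=
        (continuous_id.matrix_submatrix _ _).matrix_transpose
      exact (h.tendsto C0).comp hC)
    (by simpa only [Matrix.rank_transpose] using hr)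
    (by rw [Matrix.mulVec_transpose, vecMul_rows, extendZero_restrict hs, hv])
  refine ⟨fun n => extendZero K (w n), ?_, ?_, fun n j hj => extendZero_notMem _ hj⟩
  · rw [tendsto_pi_nhds] at hw ⊢
    intro j
    by_cases hj : j ∈ K
    · simpa only [extendZero_mem _ hj] using hw ⟨j, hj⟩
    · simp only [extendZero_notMem _ hj, hs j hj, tendsto_const_nhds]
  · filter_upwards [hw0] with n hn
    rwa [Matrix.mulVec_transpose, vecMul_rows] at hn

variable {dμ dδ : ℕ}

/-- The vectors `B' l` with `l` supported in `K` and `C' l = 0`. -/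
def multSpace (B : Matrix (Fin dC) (Fin dμ) ℝ) (C : Matrix (Fin dC) (Fin dδ) ℝ)
    (K : Set (Fin dC)) : Submodule ℝ (Fin dμ → ℝ) where
  carrier := {w | ∃ l : Fin dC → ℝ, (∀ j, j ∉ K → l j = 0) ∧ l ᵥ* C = 0 ∧ l ᵥ* B = w}
  zero_mem' := ⟨0, by simp⟩
  add_mem' := by
    rintro _ _ ⟨l, h1, h2, rfl⟩ ⟨l', h1', h2', rfl⟩
    exact ⟨l + l', fun j hj => by simp [h1 j hj, h1' j hj], by simp [Matrix.add_vecMul, h2, h2'],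
      by simp [Matrix.add_vecMul]⟩
  smul_mem' := by
    rintro c _ ⟨l, h1, h2, rfl⟩
    exact ⟨c • l, fun j hj => by simp [h1 j hj], by simp [Matrix.smul_vecMul, h2],
      by simp [Matrix.smul_vecMul]⟩

lemma multSpace_mono (B : Matrix (Fin dC) (Fin dμ) ℝ) (C : Matrix (Fin dC) (Fin dδ) ℝ)
    {K K' : Set (Fin dC)} (h : K ⊆ K') : multSpace B C K ≤ multSpace B C K' := by
  rintro _ ⟨l, h1, h2, rfl⟩
  exact ⟨l, fun j hj => h1 j fun h' => hj (h h'), h2, rfl⟩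

lemma rank_add_finrank_ker_vecMul {κ m : Type*} [Fintype κ] [Fintype m] (M : Matrix κ m ℝ) :
    M.rank + Module.finrank ℝ (LinearMap.ker M.vecMulLinear) = Fintype.card κ := by
  classical
  have h := LinearMap.finrank_range_add_finrank_ker M.vecMulLinear
  have h2 : M.rank = Module.finrank ℝ (LinearMap.range M.vecMulLinear) := by
    rw [← Matrix.rank_transpose, Matrix.rank_eq_finrank_range_toLin Mᵀ (Pi.basisFun ℝ m)
      (Pi.basisFun ℝ κ), Matrix.toLin_eq_toLin', Matrix.toLin'_apply', Matrix.mulVecLin_transpose]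
  rw [h2, h, Module.finrank_fintype_fun_eq_card]

lemma ker_vecMulLinear_fromCols {κ : Type*} [Fintype κ] (P : Matrix κ (Fin dμ) ℝ)
    (Q : Matrix κ (Fin dδ) ℝ) (v : κ → ℝ) :
    v ᵥ* Matrix.fromCols P Q = 0 ↔ v ᵥ* P = 0 ∧ v ᵥ* Q = 0 := by
  rw [Matrix.vecMul_fromCols]
  constructor
  · intro h
    exact ⟨funext fun i => congrFun h (Sum.inl i), funext fun i => congrFun h (Sum.inr i)⟩
  · rintro ⟨h1, h2⟩
    ext (i | i)
    · simp [h1]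
    · simp [h2]

/-- Rank-nullity for `P` restricted to the left kernel of `Q`: the kernel of that restriction is the
left kernel of `[P, Q]`. -/
lemma finrank_map_ker {κ : Type*} [Fintype κ] (P : Matrix κ (Fin dμ) ℝ)
    (Q : Matrix κ (Fin dδ) ℝ) :
    Module.finrank ℝ ((LinearMap.ker Q.vecMulLinear).map P.vecMulLinear) + Q.rank =
      (Matrix.fromCols P Q).rank := by
  have h1 := rank_add_finrank_ker_vecMul Q
  have h2 := rank_add_finrank_ker_vecMul (Matrix.fromCols P Q)
  have h3 := LinearMap.finrank_range_add_finrank_ker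
    (P.vecMulLinear.domRestrict (LinearMap.ker Q.vecMulLinear))
  rw [LinearMap.range_domRestrict] at h3
  have h4 : Module.finrank ℝ (LinearMap.ker
      (P.vecMulLinear.domRestrict (LinearMap.ker Q.vecMulLinear))) =
      Module.finrank ℝ (LinearMap.ker (Matrix.fromCols P Q).vecMulLinear) := by
    have h5 : (LinearMap.ker (P.vecMulLinear.domRestrict (LinearMap.ker Q.vecMulLinear))).map
        (LinearMap.ker Q.vecMulLinear).subtype =
        LinearMap.ker (Matrix.fromCols P Q).vecMulLinear := by
      ext v
      simp only [Submodule.mem_map, LinearMap.mem_ker, LinearMap.domRestrict_apply,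
        Matrix.vecMulLinear_apply, Submodule.subtype_apply, Subtype.exists, exists_and_right,
        exists_eq_right, ker_vecMulLinear_fromCols]
      constructor
      · rintro ⟨h1, h2⟩; exact ⟨h2, h1⟩
      · rintro ⟨h1, h2⟩; exact ⟨h2, h1⟩
    rw [← h5]
    exact (LinearEquiv.finrank_eq (Submodule.equivMapOfInjective _
      (Submodule.subtype_injective _) _))
  omega

lemma multSpace_eq_map (B : Matrix (Fin dC) (Fin dμ) ℝ) (C : Matrix (Fin dC) (Fin dδ) ℝ)
    (K : Set (Fin dC)) [Fintype K] :
    multSpace B C K =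
      (LinearMap.ker (rows K C).vecMulLinear).map (rows K B).vecMulLinear := by
  ext w
  simp only [Submodule.mem_map, LinearMap.mem_ker, Matrix.vecMulLinear_apply, vecMul_rows]
  constructor
  · rintro ⟨l, h1, h2, rfl⟩
    exact ⟨fun j => l j, by rw [extendZero_restrict h1, h2], by rw [extendZero_restrict h1]⟩
  · rintro ⟨l, h1, rfl⟩
    exact ⟨extendZero K l, fun j hj => extendZero_notMem _ hj, h1, rfl⟩

/-- The dimension of `multSpace` is the difference of ranks that defines the degrees of freedom. -/
theorem finrank_multSpace (B : Matrix (Fin dC) (Fin dμ) ℝ) (D : Matrix (Fin dC) (Fin dδ) ℝ)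
    (Pi : Matrix (Fin dμ) (Fin dδ) ℝ) (K : Set (Fin dC)) :
    Module.finrank ℝ (multSpace B (B * Pi + D) K) =
      (rows K (Matrix.fromCols B D)).rank - (rows K (B * Pi + D)).rank := by
  classical
  have h1 := finrank_map_ker (rows K B) (rows K (B * Pi + D))
  rw [← multSpace_eq_map] at h1
  -- Column operations turn `[B, BΠ + D]` into `[B, D]`; both have the same left kernel. Since `h1`
  -- is an additive identity, the natural subtraction in the conclusion is not truncated.
  have h2 : (Matrix.fromCols (rows K B) (rows K (B * Pi + D))).rank =
      (rows K (Matrix.fromCols B D)).rank := by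
    have h3 := rank_add_finrank_ker_vecMul (Matrix.fromCols (rows K B) (rows K (B * Pi + D)))
    have h4 := rank_add_finrank_ker_vecMul (rows K (Matrix.fromCols B D))
    have h5 : LinearMap.ker (Matrix.fromCols (rows K B) (rows K (B * Pi + D))).vecMulLinear =
        LinearMap.ker (rows K (Matrix.fromCols B D)).vecMulLinear := by
      ext v
      rw [LinearMap.mem_ker, LinearMap.mem_ker, Matrix.vecMulLinear_apply,
        Matrix.vecMulLinear_apply, ker_vecMulLinear_fromCols, vecMul_rows, vecMul_rows,
        vecMul_rows, ker_vecMulLinear_fromCols, Matrix.vecMul_add, ← Matrix.vecMul_vecMul]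
      constructor
      · rintro ⟨h1, h2⟩; exact ⟨h1, by simpa [h1] using h2⟩
      · rintro ⟨h1, h2⟩; exact ⟨h1, by simp [h1, h2]⟩
    rw [h5] at h3
    omega
  omega

end Rows

/-! ### Minimizers -/

section Minimizers

lemma argmin_spec {E : Type*} [Nonempty E] {f : E → ℝ} {S : Set E} (h : ∃ x, IsArgmin f S x) :
    IsArgmin f S (argmin f S) :=
  Classical.epsilon_spec h

lemma exists_isArgmin {n : ℕ} {f : (Fin n → ℝ) → ℝ} {S : Set (Fin n → ℝ)} (hf : Continuous f)
    (hS : IsClosed S) (hne : S.Nonempty) (hb : ∀ M, ∃ R, ∀ x, f x ≤ M → ‖x‖ ≤ R) :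
    ∃ x, IsArgmin f S x := by
  obtain ⟨x0, hx0⟩ := hne
  obtain ⟨R, hR⟩ := hb (f x0)
  obtain ⟨x, hx, hmin⟩ := ((isCompact_closedBall (0 : Fin n → ℝ) R).inter_left hS).exists_isMinOn
    ⟨x0, hx0, by simpa using hR x0 le_rfl⟩ hf.continuousOn
  refine ⟨x, hx.1, fun y hy => ?_⟩
  by_cases h : f y ≤ f x0
  · exact hmin ⟨hy, by simpa using hR y h⟩
  · exact (hmin ⟨hx0, by simpa using hR x0 le_rfl⟩).trans (not_le.mp h).le

lemma sq_le_dotProduct_self {n : Type*} [Fintype n] (x : n → ℝ) (i : n) : x i ^ 2 ≤ x ⬝ᵥ x := by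
  have := Finset.single_le_sum (f := fun i => x i * x i) (fun _ _ => mul_self_nonneg _)
    (Finset.mem_univ i)
  simpa [dotProduct, sq] using this

lemma dotProduct_self_nonneg' {n : Type*} [Fintype n] (x : n → ℝ) : 0 ≤ x ⬝ᵥ x :=
  Finset.sum_nonneg fun _ _ => mul_self_nonneg _

lemma norm_le_sqrt_dotProduct {n : Type*} [Fintype n] (x : n → ℝ) : ‖x‖ ≤ √(x ⬝ᵥ x) := by
  refine (pi_norm_le_iff_of_nonneg (Real.sqrt_nonneg _)).mpr fun i => ?_
  exact Real.abs_le_sqrt (sq_le_dotProduct_self x i)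

lemma euclNorm_eq {k : ℕ} (x : Fin k → ℝ) : euclNorm x = √(x ⬝ᵥ x) := by
  rw [euclNorm, EuclideanSpace.norm_eq]
  simp [dotProduct, sq]

lemma continuous_euclNorm {k : ℕ} : Continuous (euclNorm (k := k)) := by
  have h : (euclNorm (k := k)) = fun x => √(x ⬝ᵥ x) := funext euclNorm_eq
  rw [h]
  simp only [dotProduct]
  fun_prop

lemma norm_le_euclNorm {k : ℕ} (x : Fin k → ℝ) : ‖x‖ ≤ euclNorm x := by
  rw [euclNorm_eq]; exact norm_le_sqrt_dotProduct x

variable {dC dμ dδ : ℕ}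

lemma isClosed_poly (C : Matrix (Fin dC) (Fin dδ) ℝ) (b : Fin dC → ℝ) : IsClosed (poly C b) :=
  isClosed_le (Continuous.matrix_mulVec continuous_const continuous_id) continuous_const

lemma isArgmin_minNormPoint {C : Matrix (Fin dC) (Fin dδ) ℝ} {b : Fin dC → ℝ}
    (h : (poly C b).Nonempty) : IsArgmin euclNorm (poly C b) (minNormPoint C b) :=
  argmin_spec (exists_isArgmin continuous_euclNorm (isClosed_poly C b) h fun M =>
    ⟨M, fun x hx => (norm_le_euclNorm x).trans hx⟩)

/-- Strict convexity, through the parallelogram law: the midpoint of two distinct feasible points of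
smallest norm would be shorter. -/
lemma eq_minNormPoint {C : Matrix (Fin dC) (Fin dδ) ℝ} {b : Fin dC → ℝ} {x : Fin dδ → ℝ}
    (hx : x ∈ poly C b) (hle : euclNorm x ≤ euclNorm (minNormPoint C b)) :
    x = minNormPoint C b := by
  set y := minNormPoint C b with hy
  have hmin := isArgmin_minNormPoint ⟨x, hx⟩
  rw [← hy] at hmin
  have hmid : (1 / 2 : ℝ) • (x + y) ∈ poly C b := by
    have h1 : C *ᵥ x ≤ b := hx
    have h2 : C *ᵥ y ≤ b := hmin.1
    intro j
    rw [Matrix.mulVec_smul, Matrix.mulVec_add]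
    simp only [Pi.smul_apply, Pi.add_apply, smul_eq_mul]
    have := h1 j
    have := h2 j
    linarith
  have h3 := hmin.2 _ hmid
  rw [euclNorm_eq, euclNorm_eq] at h3 hle
  have h3' := (Real.sqrt_le_sqrt_iff (dotProduct_self_nonneg' _)).mp h3
  have hle' := (Real.sqrt_le_sqrt_iff (dotProduct_self_nonneg' _)).mp hle
  have hpar : (x - y) ⬝ᵥ (x - y) ≤ 0 := by
    simp only [smul_dotProduct, dotProduct_smul, smul_eq_mul, add_dotProduct, dotProduct_add] at h3'
    simp only [sub_dotProduct, dotProduct_sub]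
    have h4 := dotProduct_comm x y
    linarith
  have h5 : x - y = 0 := by
    ext i
    have := sq_le_dotProduct_self (x - y) i
    have h6 : ((x - y) i) ^ 2 = 0 := le_antisymm (this.trans hpar) (sq_nonneg _)
    simpa using h6
  exact sub_eq_zero.mp h5

/-- The `μ`-section of the constraint set is closed. -/
lemma isClosed_fst_feasible (B : Matrix (Fin dC) (Fin dμ) ℝ) (C : Matrix (Fin dC) (Fin dδ) ℝ)
    (d : Fin dC → ℝ) : IsClosed {u : Fin dμ → ℝ | ∃ v, (u, v) ∈ feasible B C d} := by
  -- A point `u` is feasible for some `v` exactly when `d - B u` is `C v` plus a nonnegative slack.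
  -- This is membership in a cone generated by the columns of `C`, with free signs, and the unit
  -- vectors, with nonnegative weights.
  have h1 := isClosed_image_signCone (Set.univ : Set (Fin dδ ⊕ Fin dC)) (Set.range Sum.inl)
    (Matrix.fromRows Cᵀ (1 : Matrix (Fin dC) (Fin dC) ℝ))
  have h2 : Continuous fun u : Fin dμ → ℝ => d - B *ᵥ u :=
    continuous_const.sub (Continuous.matrix_mulVec continuous_const continuous_id)
  convert! h1.preimage h2 using 1
  ext u
  simp only [Set.mem_ofPred_eq, Set.mem_preimage, Set.mem_image, feasible]
  constructor
  · rintro ⟨v, hv⟩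
    refine ⟨Sum.elim v (d - B *ᵥ u - C *ᵥ v), ⟨fun j hj => absurd trivial hj, ?_⟩, ?_⟩
    · rintro (j | j) hj
      · exact absurd ⟨j, rfl⟩ hj
      · have := hv j
        simp only [Pi.add_apply] at this
        simp only [Sum.elim_inr, Pi.sub_apply]
        linarith
    · rw [Matrix.sumElim_vecMul_fromRows, Matrix.vecMul_transpose, Matrix.vecMul_one]
      abel
  · rintro ⟨l, ⟨-, hl⟩, hle⟩
    refine ⟨fun i => l (Sum.inl i), fun j => ?_⟩
    have h3 : l = Sum.elim (fun i => l (Sum.inl i)) (fun i => l (Sum.inr i)) := by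
      ext (i | i) <;> rfl
    rw [h3, Matrix.sumElim_vecMul_fromRows, Matrix.vecMul_transpose, Matrix.vecMul_one] at hle
    have h4 := congrFun hle j
    have h5 := hl (Sum.inr j) (by rintro ⟨i, hi⟩; cases hi)
    simp only [Pi.add_apply, Pi.sub_apply] at h4 ⊢
    linarith

/-- The criterion does not involve δ, so it is not coercive jointly. It is coercive in μ, and the
projection of the feasible set on μ is closed, which suffices. -/
lemma exists_isArgmin_qform {B : Matrix (Fin dC) (Fin dμ) ℝ} {C : Matrix (Fin dC) (Fin dδ) ℝ}
    {d : Fin dC → ℝ} (hne : (feasible B C d).Nonempty) (n : ℕ+) {W : Matrix (Fin dμ) (Fin dμ) ℝ}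
    {c : ℝ} (hc : 0 < c) (hW : ∀ x, c * (x ⬝ᵥ x) ≤ x ⬝ᵥ (W *ᵥ x)) (mubar : Fin dμ → ℝ) :
    ∃ p, IsArgmin (qform n W mubar) (feasible B C d) p := by
  have hn : (0 : ℝ) < ((n : ℕ) : ℝ) := by exact_mod_cast n.pos
  obtain ⟨u, ⟨v, huv⟩, hu⟩ := exists_isArgmin
    (f := fun u : Fin dμ → ℝ => ((n : ℕ) : ℝ) * ((mubar - u) ⬝ᵥ (W *ᵥ (mubar - u))))
    (S := {u | ∃ v, (u, v) ∈ feasible B C d})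
    (by
      simp only [dotProduct, Matrix.mulVec]
      fun_prop)
    (isClosed_fst_feasible B C d)
    (by obtain ⟨p, hp⟩ := hne; exact ⟨p.1, p.2, hp⟩)
    (by
      intro M
      refine ⟨‖mubar‖ + √(M / (((n : ℕ) : ℝ) * c)), fun x hx => ?_⟩
      have h1 : (mubar - x) ⬝ᵥ (mubar - x) ≤ M / (((n : ℕ) : ℝ) * c) := by
        rw [le_div_iff₀ (by positivity)]
        have := mul_le_mul_of_nonneg_left (hW (mubar - x)) hn.le
        nlinarith
      have h2 := (norm_le_sqrt_dotProduct (mubar - x)).trans (Real.sqrt_le_sqrt h1)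
      have h3 : ‖x‖ ≤ ‖mubar‖ + ‖mubar - x‖ := by
        have := norm_sub_norm_le x mubar
        rw [norm_sub_rev] at this
        linarith
      linarith)
  exact ⟨(u, v), huv, fun p hp => hu p.1 ⟨p.2, hp⟩⟩

end Minimizers

/-! ### Continuity of polyhedra under rank stability -/

section Polyhedra

variable {dC dδ : ℕ}

lemma exists_isArgmin_dist {C : Matrix (Fin dC) (Fin dδ) ℝ} {b : Fin dC → ℝ}
    (h : (poly C b).Nonempty) (x0 : Fin dδ → ℝ) :
    ∃ x, IsArgmin (fun x => (x0 - x) ⬝ᵥ (x0 - x)) (poly C b) x := by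
  refine exists_isArgmin (by simp only [dotProduct]; fun_prop) (isClosed_poly C b) h fun M =>
    ⟨‖x0‖ + √M, fun x hx => ?_⟩
  have h2 := (norm_le_sqrt_dotProduct (x0 - x)).trans (Real.sqrt_le_sqrt hx)
  have h3 := norm_sub_norm_le x x0
  rw [norm_sub_rev] at h3
  linarith

lemma tendsto_dotProduct {α n : Type*} [Fintype n] {F : Filter α} {f g : α → n → ℝ}
    {v w : n → ℝ} (hf : Tendsto f F (𝓝 v)) (hg : Tendsto g F (𝓝 w)) :
    Tendsto (fun k => f k ⬝ᵥ g k) F (𝓝 (v ⬝ᵥ w)) := by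
  have h : Continuous fun p : (n → ℝ) × (n → ℝ) => p.1 ⬝ᵥ p.2 := by
    simp only [dotProduct]; fun_prop
  exact (h.tendsto (v, w)).comp (hf.prodMk_nhds hg)

/-- The squared distance from `x0` to the polyhedra vanishes, along a subsequence. -/
lemma dist_poly_subseq {C : ℕ → Matrix (Fin dC) (Fin dδ) ℝ} {C0 : Matrix (Fin dC) (Fin dδ) ℝ}
    {b : ℕ → Fin dC → ℝ} {b0 : Fin dC → ℝ} (hC : Tendsto C atTop (𝓝 C0))
    (hb : Tendsto b atTop (𝓝 b0)) {E : Set (Fin dC)}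
    (hE : ∀ n, ∀ x ∈ poly (C n) (b n), ∀ j ∈ E, (C n *ᵥ x) j = b n j)
    (hE0 : ∀ x ∈ poly C0 b0, ∀ j ∈ E, (C0 *ᵥ x) j = b0 j)
    (hr : ∀ K ∈ Activ C0 b0, E ⊆ K →
      ∀ᶠ n in atTop, (rows K (C n)).rank = (rows K C0).rank)
    {x0 : Fin dδ → ℝ} (hx0 : x0 ∈ poly C0 b0) {x : ℕ → Fin dδ → ℝ}
    (hx : ∀ n, IsArgmin (fun x => (x0 - x) ⬝ᵥ (x0 - x)) (poly (C n) (b n)) (x n)) :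
    ∃ φ : ℕ → ℕ, Tendsto (fun k => (x0 - x (φ k)) ⬝ᵥ (x0 - x (φ k))) atTop (𝓝 0) := by
  obtain ⟨K, φ, hφ, hK⟩ := exists_subseq_const
    (fun n => {j | (C n *ᵥ x n) j = b n j})
  have hEK : E ⊆ K := by
    intro j hj
    rw [← hK 0]
    exact hE _ _ (hx _).1 j hj
  -- multipliers of the projection problem
  have hmult : ∀ n, ∃ l ∈ signCone {j | (C n *ᵥ x n) j = b n j} ∅,
      l ᵥ* C n = (2 : ℝ) • (x0 - x n) := fun n => by
    refine exists_multipliers (C n) (b n) (fun x => (x0 - x) ⬝ᵥ (x0 - x)) (x n) _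
      (fun u => u ⬝ᵥ u) (hx n).1 (fun u t => ?_) (hx n).2
    simp only [sub_dotProduct, dotProduct_sub, add_dotProduct, dotProduct_add, smul_dotProduct,
      dotProduct_smul, smul_eq_mul]
    have h1 := dotProduct_comm u x0
    have h2 := dotProduct_comm u (x n)
    have h3 := dotProduct_comm x0 (x n)
    rw [h1, h2]
    ring
  choose l hl hlC using hmult
  set Q : ℕ → ℝ := fun n => (x0 - x n) ⬝ᵥ (x0 - x n) with hQ
  have hQ0 : ∀ n, 0 ≤ Q n := fun n => dotProduct_self_nonneg' _
  -- The extra column makes replacement multipliers keep the value of `v ⬝ᵥ (C n *ᵥ x0 - b n)`. For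
  -- the projection multipliers this value measures the squared distance, by complementary
  -- slackness.
  set A : ℕ → Matrix (Fin dC) (Fin dδ ⊕ Unit) ℝ := fun n =>
    Matrix.fromCols (C n) (Matrix.of fun j _ => (C n *ᵥ x0 - b n) j) with hA
  have hAv : ∀ n v, v ᵥ* A n = Sum.elim (v ᵥ* C n) (fun _ => v ⬝ᵥ (C n *ᵥ x0 - b n)) := by
    intro n v
    rw [hA, Matrix.vecMul_fromCols]
    rfl
  -- multipliers supported in the active set
  have hsupp : ∀ n v, (∀ j, j ∉ {j | (C n *ᵥ x n) j = b n j} → v j = 0) →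
      v ⬝ᵥ (C n *ᵥ x0 - b n) = (v ᵥ* C n) ⬝ᵥ (x0 - x n) := by
    intro n v hv
    rw [← Matrix.dotProduct_mulVec, Matrix.mulVec_sub, dotProduct_sub, dotProduct_sub]
    congr 1
    refine Finset.sum_congr rfl fun j _ => ?_
    by_cases hj : (C n *ᵥ x n) j = b n j
    · rw [hj]
    · rw [hv j hj, zero_mul, zero_mul]
  -- No bound on the squared distance `Q` is available yet; dividing by `1 + Q` bounds all images by
  -- 2 regardless.
  set s : ℕ → Fin dC → ℝ := fun n => (1 + Q n)⁻¹ • l n with hs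
  have hpos : ∀ n, 0 < 1 + Q n := fun n => by linarith [hQ0 n]
  have hsc : ∀ n, s n ∈ signCone {j | (C n *ᵥ x n) j = b n j} ∅ := fun n =>
    signCone_smul (hl n) (inv_nonneg.mpr (hpos n).le)
  have hsC : ∀ n, s n ᵥ* C n = (2 * (1 + Q n)⁻¹) • (x0 - x n) := fun n => by
    simp only [hs, Matrix.smul_vecMul, hlC, smul_smul]
    rw [mul_comm]
  have hsb : ∀ n, s n ⬝ᵥ (C n *ᵥ x0 - b n) = 2 * (Q n / (1 + Q n)) := fun n => by
    rw [hsupp n _ (hsc n).1, hsC, smul_dotProduct, smul_eq_mul]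
    simp only [hQ]; ring
  have hA0 : Tendsto (fun k => A (φ k)) atTop
      (𝓝 (Matrix.fromCols C0 (Matrix.of fun j _ => (C0 *ᵥ x0 - b0) j))) := by
    have h1 := hC.comp hφ.tendsto_atTop
    have h2 := (tendsto_mulVec h1 (tendsto_const_nhds (x := x0))).sub (hb.comp hφ.tendsto_atTop)
    refine tendsto_pi_nhds.mpr fun j => tendsto_pi_nhds.mpr fun i => ?_
    rcases i with i | i
    · exact tendsto_pi_nhds.mp (tendsto_pi_nhds.mp h1 j) i
    · exact tendsto_pi_nhds.mp h2 j
  have hbd : ∀ n j, |(s n ᵥ* A n) j| ≤ 2 := by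
    intro n j
    rw [hAv]
    rcases j with i | i
    · simp only [Sum.elim_inl, hsC, Pi.smul_apply, smul_eq_mul]
      have h1 := sq_le_dotProduct_self (x0 - x n) i
      have h2 : |(x0 - x n) i| ≤ 1 + Q n := by
        have h3 : (x0 - x n) i ^ 2 ≤ Q n := h1
        rw [← sq_abs] at h3
        nlinarith [abs_nonneg ((x0 - x n) i), sq_nonneg (|(x0 - x n) i| - 1)]
      rw [abs_mul, abs_of_nonneg (by have := hpos n; positivity), mul_assoc]
      have h4 : (1 + Q n)⁻¹ * |(x0 - x n) i| ≤ 1 := by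
        rw [inv_mul_le_iff₀ (hpos n)]; linarith
      linarith
    · simp only [Sum.elim_inr, hsb]
      rw [abs_of_nonneg (by have := hpos n; have := hQ0 n; positivity)]
      have : Q n / (1 + Q n) ≤ 1 := by rw [div_le_one (hpos n)]; linarith
      linarith
  have hscE : ∀ k, s (φ k) ∈ signCone K E := fun k => by
    have h1 := hsc (φ k)
    rw [hK k] at h1
    exact ⟨h1.1, fun j _ => h1.2 j (by simp)⟩
  -- sign-restricted elements of the limit kernel
  have hsign : ∀ v ∈ signCone K E, v ⬝ᵥ (C0 *ᵥ x0 - b0) ≤ 0 ∧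
      (v ⬝ᵥ (C0 *ᵥ x0 - b0) = 0 → ∀ j, v j ≠ 0 → (C0 *ᵥ x0) j = b0 j) := by
    intro v hv
    have h1 : ∀ j ∈ Finset.univ, v j * (C0 *ᵥ x0 - b0) j ≤ 0 := by
      intro j _
      by_cases hj : j ∈ E
      · simp [hE0 x0 hx0 j hj]
      · have h2 : (C0 *ᵥ x0) j ≤ b0 j := hx0 j
        exact mul_nonpos_of_nonneg_of_nonpos (hv.2 j hj) (by simpa using h2)
    refine ⟨Finset.sum_nonpos h1, fun h0 j hj => ?_⟩
    have h2 := (Finset.sum_eq_zero_iff_of_nonpos h1).mp h0 j (Finset.mem_univ j)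
    have h3 := (mul_eq_zero.mp h2).resolve_left hj
    simpa [sub_eq_zero] using h3
  obtain ⟨l', R, hl', himg, hR⟩ := bounded_multipliers (K := K) (E := E) hA0 hscE
    (M := 2) (fun k j => hbd (φ k) j) (by
      intro v hv hv0
      rw [Matrix.vecMul_fromCols] at hv0
      have hvC : v ᵥ* C0 = 0 := funext fun i => congrFun hv0 (Sum.inl i)
      have hvb : v ⬝ᵥ (C0 *ᵥ x0 - b0) = 0 := congrFun hv0 (Sum.inr ())
      -- The extra coordinate of the kernel condition is a sum of nonpositive terms equal to 0, so
      -- `v` is supported on inequalities active at `x0`. Thus rank stability applies to `K0`.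
      set K0 : Set (Fin dC) := {j | v j ≠ 0 ∨ j ∈ E} with hK0
      have hact : K0 ∈ Activ C0 b0 := by
        refine ⟨x0, hx0, fun j hj => ?_⟩
        rcases hj with hj | hj
        · exact (hsign v hv).2 hvb j hj
        · exact hE0 x0 hx0 j hj
      have hK0K : K0 ⊆ K := by
        rintro j (hj | hj)
        · by_contra h
          exact hj (hv.1 j h)
        · exact hEK hj
      obtain ⟨κ, h1, h2, h3⟩ := exists_tendsto_ker_rows (C := fun k => C (φ k))
        (hC.comp hφ.tendsto_atTop)
        (hφ.tendsto_atTop.eventually (hr K0 hact fun j hj => Or.inr hj))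
        (v := v) (fun j hj => by by_contra h; exact hj (Or.inl h)) hvC
      refine ⟨κ, h1, ?_, fun k j hj => ?_⟩
      · filter_upwards [h2] with k hk
        rw [hAv, hk, hsupp, hk, zero_dotProduct]
        · ext (i | i) <;> rfl
        · intro j hj
          refine h3 k j fun h => hj ?_
          rw [hK k]
          exact hK0K h
      · have h4 : j ∈ K0 := by by_contra h; exact hj (h3 k j h)
        exact ⟨hK0K h4, h4⟩)
  obtain ⟨v, -, τ, hτ, hv⟩ := (isCompact_closedBall (0 : Fin dC → ℝ) R).tendsto_subseq
    (x := l') (fun n => by simpa using hR n)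
  have hvc : v ∈ signCone K E :=
    (isClosed_signCone K E).mem_of_tendsto hv (Eventually.of_forall fun n => hl' _)
  have hφτ : Tendsto (fun k => φ (τ k)) atTop atTop := hφ.tendsto_atTop.comp hτ.tendsto_atTop
  have hlim : Tendsto (fun k => 2 * (Q (φ (τ k)) / (1 + Q (φ (τ k))))) atTop
      (𝓝 (v ⬝ᵥ (C0 *ᵥ x0 - b0))) := by
    have h1 := tendsto_dotProduct hv
      ((tendsto_mulVec (hC.comp hφτ) (tendsto_const_nhds (x := x0))).sub (hb.comp hφτ))
    refine h1.congr fun k => ?_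
    have h2 := himg (τ k)
    rw [hAv, hAv] at h2
    have h3 := congrFun h2 (Sum.inr ())
    simp only [Sum.elim_inr, hsb] at h3
    exact h3
  -- Feasibility of `x0` in the limit makes this nonpositive, while it is a limit of the nonnegative
  -- numbers 2Q/(1 + Q).
  have hzero : v ⬝ᵥ (C0 *ᵥ x0 - b0) = 0 := by
    refine le_antisymm (hsign v hvc).1 (ge_of_tendsto' hlim fun k => ?_)
    have := hpos (φ (τ k)); have := hQ0 (φ (τ k)); positivity
  rw [hzero] at hlim
  refine ⟨fun k => φ (τ k), ?_⟩
  have hy : Tendsto (fun k => Q (φ (τ k)) / (1 + Q (φ (τ k)))) atTop (𝓝 0) := by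
    have := hlim.const_mul (1 / 2)
    simpa using this
  -- With t = Q/(1 + Q), the distance is recovered as Q = t/(1 - t).
  have h5 := hy.div (hy.const_sub 1) (by norm_num)
  simp only [sub_zero, zero_div] at h5
  refine h5.congr fun k => ?_
  have h6 := (hpos (φ (τ k))).ne'
  change Q (φ (τ k)) / (1 + Q (φ (τ k))) / (1 - Q (φ (τ k)) / (1 + Q (φ (τ k)))) = Q (φ (τ k))
  rw [one_sub_div h6, add_sub_cancel_right, div_div_div_cancel_right₀ h6, div_one]

/-- Lower semicontinuity of polyhedra under rank stability. -/
theorem exists_tendsto_poly {C : ℕ → Matrix (Fin dC) (Fin dδ) ℝ}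
    {C0 : Matrix (Fin dC) (Fin dδ) ℝ}
    {b : ℕ → Fin dC → ℝ} {b0 : Fin dC → ℝ} (hC : Tendsto C atTop (𝓝 C0))
    (hb : Tendsto b atTop (𝓝 b0)) {E : Set (Fin dC)}
    (hE : ∀ n, ∀ x ∈ poly (C n) (b n), ∀ j ∈ E, (C n *ᵥ x) j = b n j)
    (hE0 : ∀ x ∈ poly C0 b0, ∀ j ∈ E, (C0 *ᵥ x) j = b0 j)
    (hr : ∀ K ∈ Activ C0 b0, E ⊆ K →
      ∀ᶠ n in atTop, (rows K (C n)).rank = (rows K C0).rank)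
    (hne : ∀ n, (poly (C n) (b n)).Nonempty)
    {x0 : Fin dδ → ℝ} (hx0 : x0 ∈ poly C0 b0) :
    ∃ x : ℕ → Fin dδ → ℝ, (∀ n, x n ∈ poly (C n) (b n)) ∧ Tendsto x atTop (𝓝 x0) := by
  -- The approximants are the nearest points to `x0`; vanishing of the distance is then checked on
  -- subsequences.
  choose x hx using fun n => exists_isArgmin_dist (hne n) x0
  refine ⟨x, fun n => (hx n).1, ?_⟩
  refine tendsto_of_subseq_tendsto fun ns hns => ?_
  obtain ⟨φ, hφ⟩ := dist_poly_subseq (C := fun n => C (ns n)) (b := fun n => b (ns n))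
    (x := fun n => x (ns n)) (hC.comp hns) (hb.comp hns)
    (fun n => hE _) hE0 (fun K h1 h2 => hns.eventually (hr K h1 h2)) hx0 (fun n => hx _)
  refine ⟨φ, tendsto_iff_norm_sub_tendsto_zero.mpr ?_⟩
  have h1 := hφ.sqrt
  rw [Real.sqrt_zero] at h1
  refine squeeze_zero (fun k => norm_nonneg _) (fun k => ?_) h1
  rw [norm_sub_rev]
  exact norm_le_sqrt_dotProduct _

/-- Continuity of the point of smallest norm under rank stability. -/
theorem tendsto_minNormPoint {C : ℕ → Matrix (Fin dC) (Fin dδ) ℝ}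
    {C0 : Matrix (Fin dC) (Fin dδ) ℝ}
    {b : ℕ → Fin dC → ℝ} {b0 : Fin dC → ℝ} (hC : Tendsto C atTop (𝓝 C0))
    (hb : Tendsto b atTop (𝓝 b0)) {E : Set (Fin dC)}
    (hE : ∀ n, ∀ x ∈ poly (C n) (b n), ∀ j ∈ E, (C n *ᵥ x) j = b n j)
    (hE0 : ∀ x ∈ poly C0 b0, ∀ j ∈ E, (C0 *ᵥ x) j = b0 j)
    (hr : ∀ K ∈ Activ C0 b0, E ⊆ K →
      ∀ᶠ n in atTop, (rows K (C n)).rank = (rows K C0).rank)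
    (hne : ∀ n, (poly (C n) (b n)).Nonempty) (hne0 : (poly C0 b0).Nonempty) :
    Tendsto (fun n => minNormPoint (C n) (b n)) atTop (𝓝 (minNormPoint C0 b0)) := by
  -- Feasible points converging to the limit minimizer bound the smallest norms from above. Every
  -- cluster point of the smallest-norm points is feasible in the limit with no larger norm, hence
  -- equals the unique minimizer.
  obtain ⟨x, hx, hlim⟩ := exists_tendsto_poly hC hb hE hE0 hr hne
    (isArgmin_minNormPoint hne0).1
  have hle : ∀ n, euclNorm (minNormPoint (C n) (b n)) ≤ euclNorm (x n) := fun n =>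
    (isArgmin_minNormPoint (hne n)).2 _ (hx n)
  have hlimN : Tendsto (fun n => euclNorm (x n)) atTop (𝓝 (euclNorm (minNormPoint C0 b0))) :=
    (continuous_euclNorm.tendsto _).comp hlim
  obtain ⟨R, hR⟩ := (Metric.isBounded_range_of_tendsto _ hlimN).exists_norm_le
  refine tendsto_of_subseq_tendsto fun ns hns => ?_
  obtain ⟨z, -, φ, hφ, hz⟩ := (isCompact_closedBall (0 : Fin dδ → ℝ) R).tendsto_subseq
    (x := fun k => minNormPoint (C (ns k)) (b (ns k))) (fun k => by
      rw [mem_closedBall_zero_iff]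
      refine ((norm_le_euclNorm _).trans (hle _)).trans ?_
      exact (le_abs_self _).trans (hR _ ⟨ns k, rfl⟩))
  have hnφ : Tendsto (fun k => ns (φ k)) atTop atTop := hns.comp hφ.tendsto_atTop
  refine ⟨φ, ?_⟩
  have hzp : z ∈ poly C0 b0 :=
    le_of_tendsto_of_tendsto' (tendsto_mulVec (hC.comp hnφ) hz) (hb.comp hnφ)
      (fun k => (isArgmin_minNormPoint (hne _)).1)
  have hzn : euclNorm z ≤ euclNorm (minNormPoint C0 b0) :=
    le_of_tendsto_of_tendsto' ((continuous_euclNorm.tendsto z).comp hz) (hlimN.comp hnφ)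
      (fun k => hle _)
  rw [← eq_minNormPoint hzp hzn]
  exact hz

end Polyhedra

/-! ### Limits of multipliers of the quadratic programs -/

section Limits

variable {dC dμ dδ : ℕ}

/-- The limit of the multipliers of the quadratic programs is a multiplier of the limit
experiment. -/
theorem limit_multiplier (B : Matrix (Fin dC) (Fin dμ) ℝ) (D : Matrix (Fin dC) (Fin dδ) ℝ)
    {E K J : Set (Fin dC)} {Pi : ℕ → Matrix (Fin dμ) (Fin dδ) ℝ}
    {Pi0 : Matrix (Fin dμ) (Fin dδ) ℝ} (hPi : Tendsto Pi atTop (𝓝 Pi0))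
    {y r : ℕ → Fin dμ → ℝ} {y0 r0 : Fin dμ → ℝ} (hy : Tendsto y atTop (𝓝 y0))
    (hr : Tendsto r atTop (𝓝 r0)) {l s : ℕ → Fin dC → ℝ} {l0 σ : Fin dC → ℝ}
    (hl : Tendsto l atTop (𝓝 l0)) {W : ℕ → Matrix (Fin dμ) (Fin dμ) ℝ}
    {S0 : Matrix (Fin dμ) (Fin dμ) ℝ} (hS0 : S0.PosDef) (hW : Tendsto W atTop (𝓝 S0⁻¹))
    (hσ : ∀ j ∈ J, Tendsto (fun k => s k j) atTop (𝓝 (σ j)))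
    (hσ' : ∀ j, j ∉ J → Tendsto (fun k => s k j) atTop atTop)
    (hs0 : ∀ k j, 0 ≤ s k j) (hsE : ∀ k, ∀ j ∈ E, s k j = 0)
    (hrank : ∀ K0, E ⊆ K0 → K0 ⊆ J → ∀ k,
      (rows K0 (B * Pi k + D)).rank = (rows K0 (B * Pi0 + D)).rank)
    (hle : ∀ k v, (∀ j, j ∉ E → 0 ≤ v j) → v ᵥ* (B * Pi k + D) = 0 →
      (v ᵥ* B) ⬝ᵥ (y k - r k) ≤ v ⬝ᵥ s k)
    (heq : ∀ k, (l k ᵥ* B) ⬝ᵥ (y k - r k) = l k ⬝ᵥ s k)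
    (hker : ∀ k, l k ᵥ* (B * Pi k + D) = 0)
    (hlB : ∀ k, ((1 / 2 : ℝ) • (W k + (W k)ᵀ)) *ᵥ r k = l k ᵥ* B)
    (hlK : ∀ k, l k ∈ signCone K ∅) (hEK : E ⊆ K) {c : ℕ → ℝ} (hc : Monotone c)
    (hc0 : 0 ≤ c 0) (hc1 : 0 < c 1)
    (hT : ∀ k, c ((rows K (Matrix.fromCols B D)).rank - (rows K (B * Pi k + D)).rank) <
      r k ⬝ᵥ (W k *ᵥ r k)) :
    (∀ j, 0 ≤ l0 j) ∧ (∀ j, j ∉ J → l0 j = 0) ∧ l0 ᵥ* (B * Pi0 + D) = 0 ∧ l0 ᵥ* B ≠ 0 ∧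
      (∀ v : Fin dC → ℝ, (∀ j, 0 ≤ v j) → (∀ j, j ∉ J → v j = 0) → v ᵥ* (B * Pi0 + D) = 0 →
        (v ᵥ* B) ⬝ᵥ (y0 - S0 *ᵥ (l0 ᵥ* B)) ≤ v ⬝ᵥ σ) ∧
      (l0 ᵥ* B) ⬝ᵥ (y0 - S0 *ᵥ (l0 ᵥ* B)) = l0 ⬝ᵥ σ ∧
      c (Module.finrank ℝ (multSpace B (B * Pi0 + D) {j | l0 j ≠ 0})) ≤
        (l0 ᵥ* B) ⬝ᵥ (S0 *ᵥ (l0 ᵥ* B)) := by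
  have hC : Tendsto (fun k => B * Pi k + D) atTop (𝓝 (B * Pi0 + D)) := by
    have h : Continuous fun P : Matrix (Fin dμ) (Fin dδ) ℝ => B * P + D := by fun_prop
    exact (h.tendsto Pi0).comp hPi
  have hEJ : E ⊆ J := by
    intro j hj
    by_contra h
    have h1 := hσ' j h
    simp only [fun k => hsE k j hj] at h1
    exact not_tendsto_const_atTop _ _ h1
  have hdet : IsUnit S0.det := hS0.det_pos.ne'.isUnit
  have hsymm : (S0⁻¹)ᵀ = S0⁻¹ := by
    have h1 : S0ᵀ = S0 := hS0.isHermitian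
    rw [Matrix.transpose_nonsing_inv, h1]
  have hl0 : l0 ∈ signCone K ∅ :=
    (isClosed_signCone K ∅).mem_of_tendsto hl (Eventually.of_forall hlK)
  have hpos : ∀ j, 0 ≤ l0 j := fun j => hl0.2 j (by simp)
  have hlim : Tendsto (fun k => l k ⬝ᵥ s k) atTop (𝓝 ((l0 ᵥ* B) ⬝ᵥ (y0 - r0))) :=
    (tendsto_dotProduct (tendsto_vecMul hl tendsto_const_nhds) (hy.sub hr)).congr heq
  have hterm : ∀ k j, 0 ≤ l k j * s k j := fun k j =>
    mul_nonneg ((hlK k).2 j (by simp)) (hs0 k j)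
  -- The products of multipliers and slacks are nonnegative with a convergent sum, so a slack that
  -- diverges forces a zero limit multiplier.
  have hsuppJ : ∀ j, j ∉ J → l0 j = 0 := by
    intro j hj
    by_contra hne
    have h1 : 0 < l0 j := lt_of_le_of_ne (hpos j) (Ne.symm hne)
    have h2 : Tendsto (fun k => l k j * s k j) atTop atTop :=
      (tendsto_pi_nhds.mp hl j).pos_mul_atTop h1 (hσ' j hj)
    have h3 : Tendsto (fun k => l k ⬝ᵥ s k) atTop atTop :=
      tendsto_atTop_mono (fun k => Finset.single_le_sum (f := fun j => l k j * s k j)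
        (fun j _ => hterm k j) (Finset.mem_univ j)) h2
    exact not_tendsto_nhds_of_tendsto_atTop h3 _ hlim
  have hker0 : l0 ᵥ* (B * Pi0 + D) = 0 :=
    tendsto_nhds_unique (tendsto_vecMul hl hC) (by simp only [hker]; exact tendsto_const_nhds)
  -- the limit residual
  have hr0 : S0⁻¹ *ᵥ r0 = l0 ᵥ* B := by
    have h1 : Tendsto (fun k => ((1 / 2 : ℝ) • (W k + (W k)ᵀ)) *ᵥ r k) atTop
        (𝓝 (((1 / 2 : ℝ) • (S0⁻¹ + (S0⁻¹)ᵀ)) *ᵥ r0)) := by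
      refine tendsto_mulVec ?_ hr
      have h : Continuous fun P : Matrix (Fin dμ) (Fin dμ) ℝ => (1 / 2 : ℝ) • (P + Pᵀ) := by
        fun_prop
      exact (h.tendsto _).comp hW
    have h2 := tendsto_nhds_unique h1
      ((tendsto_vecMul hl (tendsto_const_nhds (x := B))).congr fun k => (hlB k).symm)
    rw [hsymm, ← two_smul ℝ, smul_smul] at h2
    simpa using h2
  have hr0' : S0 *ᵥ (l0 ᵥ* B) = r0 := by
    rw [← hr0, Matrix.mulVec_mulVec, Matrix.mul_nonsing_inv _ hdet, Matrix.one_mulVec]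
  have hTlim : Tendsto (fun k => r k ⬝ᵥ (W k *ᵥ r k)) atTop
      (𝓝 ((l0 ᵥ* B) ⬝ᵥ (S0 *ᵥ (l0 ᵥ* B)))) := by
    have h1 := tendsto_dotProduct hr (tendsto_mulVec hW hr)
    rw [hr0, ← hr0', dotProduct_comm, hr0'] at h1
    rwa [hr0']
  -- inequalities satisfied by the projection
  have hproj : ∀ v : Fin dC → ℝ, (∀ j, 0 ≤ v j) → (∀ j, j ∉ J → v j = 0) →
      v ᵥ* (B * Pi0 + D) = 0 → (v ᵥ* B) ⬝ᵥ (y0 - r0) ≤ v ⬝ᵥ σ := by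
    intro v hv hvJ hv0
    set K0 : Set (Fin dC) := {j | v j ≠ 0} ∪ E with hK0
    have hK0J : K0 ⊆ J := by
      rintro j (hj | hj)
      · by_contra h; exact hj (hvJ j h)
      · exact hEJ hj
    obtain ⟨w, h1, h2, h3⟩ := exists_tendsto_ker_rows hC
      (Eventually.of_forall (hrank K0 Set.subset_union_right hK0J)) (v := v)
      (fun j hj => by by_contra h; exact hj (Or.inl h)) hv0
    have h4 : Tendsto (fun k => w k ⬝ᵥ s k) atTop (𝓝 (v ⬝ᵥ σ)) := by
      refine tendsto_finsetSum _ fun j _ => ?_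
      by_cases hj : j ∈ J
      · exact (tendsto_pi_nhds.mp h1 j).mul (hσ j hj)
      · have h5 : ∀ k, w k j = 0 := fun k => h3 k j fun h => hj (hK0J h)
        simp [h5, hvJ j hj]
    -- Outside `E` the approximants vanish where `v` does and are eventually positive elsewhere. On
    -- `E` signs may be lost, which `hle` allows.
    have h5 : ∀ᶠ k in atTop, ∀ j, j ∉ E → 0 ≤ w k j := by
      rw [eventually_all]
      intro j
      by_cases hvj : v j = 0
      · refine Eventually.of_forall fun k hj => ?_
        rw [h3 k j]
        rintro (h | h)
        · exact h hvj
        · exact hj h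
      · have h6 : 0 < v j := lt_of_le_of_ne (hv j) (Ne.symm hvj)
        filter_upwards [(tendsto_pi_nhds.mp h1 j).eventually (lt_mem_nhds h6)] with k hk _
          using hk.le
    refine le_of_tendsto_of_tendsto
      (tendsto_dotProduct (tendsto_vecMul h1 (tendsto_const_nhds (x := B))) (hy.sub hr)) h4 ?_
    filter_upwards [h2, h5] with k hk hk'
    exact hle k _ hk' hk
  -- dimension count
  have hdim : ∀ k, Module.finrank ℝ (multSpace B (B * Pi k + D) K) =
      (rows K (Matrix.fromCols B D)).rank - (rows K (B * Pi k + D)).rank := fun k =>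
    finrank_multSpace B D (Pi k) K
  simp only [← hdim] at hT
  -- With zero degrees of freedom `l k ᵥ* B = 0`, so the quadratic form vanishes and cannot exceed
  -- `c 0 ≥ 0`. Hence the limit statistic is at least `c 1 > 0`, which rules out a zero limit
  -- residual.
  have hone : ∀ k, 1 ≤ Module.finrank ℝ (multSpace B (B * Pi k + D) K) := by
    intro k
    by_contra h
    have h1 : Module.finrank ℝ (multSpace B (B * Pi k + D) K) = 0 := by omega
    have h2 := Submodule.finrank_eq_zero.mp h1
    have h3 : l k ᵥ* B ∈ multSpace B (B * Pi k + D) K := ⟨l k, (hlK k).1, hker k, rfl⟩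
    rw [h2, Submodule.mem_bot] at h3
    have h4 := hT k
    have h5 : r k ⬝ᵥ (W k *ᵥ r k) = r k ⬝ᵥ (((1 / 2 : ℝ) • (W k + (W k)ᵀ)) *ᵥ r k) := by
      rw [Matrix.smul_mulVec, Matrix.add_mulVec, dotProduct_smul, dotProduct_add,
        Matrix.mulVec_transpose, dotProduct_comm (r k) (r k ᵥ* W k), ← Matrix.dotProduct_mulVec,
        smul_eq_mul]
      ring
    rw [h1, h5, hlB, h3, dotProduct_zero] at h4
    linarith
  have hcT : c 1 ≤ (l0 ᵥ* B) ⬝ᵥ (S0 *ᵥ (l0 ᵥ* B)) :=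
    ge_of_tendsto' hTlim fun k => (hc (hone k)).trans (hT k).le
  refine ⟨hpos, hsuppJ, hker0, ?_, by rw [hr0']; exact hproj, ?_, ?_⟩
  · intro h
    rw [h, zero_dotProduct] at hcT
    linarith
  · rw [hr0']
    refine le_antisymm (hproj l0 hpos hsuppJ hker0) ?_
    classical
    -- Only the terms in `J` are known to converge to those of `l0 ⬝ᵥ σ`; the dropped ones are
    -- nonnegative, which suffices for the remaining inequality.
    have h1 : Tendsto (fun k => ∑ j, if j ∈ J then l k j * s k j else 0) atTop (𝓝 (l0 ⬝ᵥ σ)) := by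
      refine tendsto_finsetSum _ fun j _ => ?_
      by_cases hj : j ∈ J
      · simp only [hj, if_true]
        exact (tendsto_pi_nhds.mp hl j).mul (hσ j hj)
      · simp [hj, hsuppJ j hj]
    refine le_of_tendsto_of_tendsto' h1 hlim fun k => Finset.sum_le_sum fun j _ => ?_
    split_ifs
    · exact le_rfl
    · exact hterm k j
  -- The sample active set contains the support of `l0` together with `E`. On that smaller set the
  -- ranks agree with the limit, so its dimension carries over to the sample and can only grow when
  -- passing to `K`.
  · refine ge_of_tendsto' hTlim fun k => le_trans (hc ?_) (hT k).le
    set K0 : Set (Fin dC) := {j | l0 j ≠ 0} ∪ E with hK0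
    have hK0J : K0 ⊆ J := by
      rintro j (hj | hj)
      · by_contra h; exact hj (hsuppJ j h)
      · exact hEJ hj
    have hK0K : K0 ⊆ K := by
      rintro j (hj | hj)
      · by_contra h; exact hj (hl0.1 j h)
      · exact hEK hj
    calc Module.finrank ℝ (multSpace B (B * Pi0 + D) {j | l0 j ≠ 0})
        ≤ Module.finrank ℝ (multSpace B (B * Pi0 + D) K0) :=
          Submodule.finrank_mono (multSpace_mono _ _ Set.subset_union_left)
      _ = Module.finrank ℝ (multSpace B (B * Pi k + D) K0) := by
          rw [finrank_multSpace, finrank_multSpace, hrank K0 Set.subset_union_right hK0J k]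
      _ ≤ _ := Submodule.finrank_mono (multSpace_mono _ _ hK0K)

/-- The criterion in terms of the scaled residual. -/
lemma qform_eq (n : ℕ+) (W : Matrix (Fin dμ) (Fin dμ) ℝ) (mubar : Fin dμ → ℝ)
    (p : (Fin dμ → ℝ) × (Fin dδ → ℝ)) :
    qform n W mubar p = (√((n : ℕ) : ℝ) • (mubar - p.1)) ⬝ᵥ
      (W *ᵥ (√((n : ℕ) : ℝ) • (mubar - p.1))) := by
  rw [qform, Matrix.mulVec_smul, smul_dotProduct, dotProduct_smul, smul_eq_mul, smul_eq_mul,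
    ← mul_assoc, Real.mul_self_sqrt (Nat.cast_nonneg _)]

/-- First-order conditions for the quadratic program. -/
theorem qform_multipliers (B : Matrix (Fin dC) (Fin dμ) ℝ) (C : Matrix (Fin dC) (Fin dδ) ℝ)
    (d : Fin dC → ℝ) (n : ℕ+) (W : Matrix (Fin dμ) (Fin dμ) ℝ) (mubar : Fin dμ → ℝ)
    {p : (Fin dμ → ℝ) × (Fin dδ → ℝ)} (hp : IsArgmin (qform n W mubar) (feasible B C d) p) :
    ∃ l ∈ signCone {j | (C *ᵥ p.2) j = (d - B *ᵥ p.1) j} ∅, l ᵥ* C = 0 ∧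
      ((1 / 2 : ℝ) • (W + Wᵀ)) *ᵥ (√((n : ℕ) : ℝ) • (mubar - p.1)) = l ᵥ* B := by
  have hn : (0 : ℝ) < ((n : ℕ) : ℝ) := by exact_mod_cast n.pos
  have hA : ∀ z : Fin dμ ⊕ Fin dδ → ℝ, Matrix.fromCols B C *ᵥ z =
      B *ᵥ (z ∘ Sum.inl) + C *ᵥ (z ∘ Sum.inr) := fun z => Matrix.fromCols_mulVec _ _ _
  obtain ⟨l, hl, hlA⟩ := exists_multipliers (Matrix.fromCols B C) d
    (fun z => qform n W mubar (z ∘ Sum.inl, z ∘ Sum.inr)) (Sum.elim p.1 p.2)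
    (Sum.elim (((n : ℕ) : ℝ) • ((W + Wᵀ) *ᵥ (mubar - p.1))) 0)
    (fun u => ((n : ℕ) : ℝ) * ((u ∘ Sum.inl) ⬝ᵥ (W *ᵥ (u ∘ Sum.inl))))
    (by rw [hA]; exact hp.1)
    (by
      intro u t
      have h1 : (Sum.elim p.1 p.2 + t • u) ∘ Sum.inl = p.1 + t • (u ∘ Sum.inl) := rfl
      have h2 : Sum.elim (((n : ℕ) : ℝ) • ((W + Wᵀ) *ᵥ (mubar - p.1))) (0 : Fin dδ → ℝ) ⬝ᵥ u =
          (((n : ℕ) : ℝ) • ((W + Wᵀ) *ᵥ (mubar - p.1))) ⬝ᵥ (u ∘ Sum.inl) := by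
        simp [dotProduct, Fintype.sum_sum_type]
      simp only [qform, h1, h2, Sum.elim_comp_inl]
      set x := mubar - p.1 with hx
      set w := u ∘ Sum.inl
      have h3 : mubar - (p.1 + t • w) = x - t • w := by rw [hx]; abel
      have h4 : (Wᵀ *ᵥ x) ⬝ᵥ w = x ⬝ᵥ (W *ᵥ w) := by
        rw [Matrix.mulVec_transpose, Matrix.dotProduct_mulVec]
      rw [h3, Matrix.mulVec_sub, Matrix.mulVec_smul, sub_dotProduct, dotProduct_sub,
        dotProduct_sub, smul_dotProduct, smul_dotProduct, dotProduct_smul, dotProduct_smul,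
        smul_dotProduct, Matrix.add_mulVec, add_dotProduct, h4, dotProduct_comm (W *ᵥ x) w]
      simp only [smul_eq_mul]
      ring)
    (by
      intro z hz
      rw [hA] at hz
      exact hp.2 (z ∘ Sum.inl, z ∘ Sum.inr) hz)
  rw [Matrix.vecMul_fromCols] at hlA
  have hlB : l ᵥ* B = ((n : ℕ) : ℝ) • ((W + Wᵀ) *ᵥ (mubar - p.1)) :=
    funext fun i => congrFun hlA (Sum.inl i)
  have hlC : l ᵥ* C = 0 := funext fun i => congrFun hlA (Sum.inr i)
  have hset : {j | (Matrix.fromCols B C *ᵥ Sum.elim p.1 p.2) j = d j} =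
      {j | (C *ᵥ p.2) j = (d - B *ᵥ p.1) j} := by
    ext j
    simp only [hA, Set.mem_ofPred_eq, Sum.elim_comp_inl, Sum.elim_comp_inr, Pi.add_apply,
      Pi.sub_apply]
    constructor <;> intro h <;> linarith
  rw [hset] at hl
  have hsq := Real.mul_self_sqrt hn.le
  have hsp := Real.sqrt_pos.mpr hn
  -- The gradient involves n(W + Wᵀ); dividing by 2√n leaves the symmetrized weight applied to the
  -- √n-scaled residual.
  refine ⟨(1 / (2 * √((n : ℕ) : ℝ))) • l, signCone_smul hl (by positivity), ?_, ?_⟩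
  · rw [Matrix.smul_vecMul, hlC, smul_zero]
  · rw [Matrix.smul_vecMul, hlB, Matrix.mulVec_smul, Matrix.smul_mulVec, smul_smul, smul_smul]
    congr 1
    field_simp
    rw [sq, hsq]

/-- Multipliers of the quadratic programs can be chosen bounded. -/
theorem exists_bounded_multiplier {ι m : Type*} [Fintype ι] [Fintype m] (A : Matrix ι m ℝ)
    (M : ℝ) : ∃ R, ∀ (K : Set ι), ∀ l ∈ signCone K ∅, (∀ j, |(l ᵥ* A) j| ≤ M) →
      ∃ l' ∈ signCone K ∅, l' ᵥ* A = l ᵥ* A ∧ ‖l'‖ ≤ R := by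
  have h : ∀ K : Set ι, ∃ R, ∀ l ∈ signCone K ∅, (∀ j, |(l ᵥ* A) j| ≤ M) →
      ∃ l' ∈ signCone K ∅, l' ᵥ* A = l ᵥ* A ∧ ‖l'‖ ≤ R := by
    intro K
    by_contra hcon
    push Not at hcon
    choose l hl hb hbad using fun n : ℕ => hcon n
    obtain ⟨l', R, h1, h2, h3⟩ := bounded_multipliers_const A hl hb
    obtain ⟨n, hn⟩ := exists_nat_ge R
    exact absurd (hbad n (l' n) (h1 n) (h2 n)) (not_lt.mpr ((h3 n).trans hn))
  choose R hR using h
  obtain ⟨R0, hR0⟩ := Finite.exists_le R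
  refine ⟨R0, fun K l hl hb => ?_⟩
  obtain ⟨l', h1, h2, h3⟩ := hR K l hl hb
  exact ⟨l', h1, h2, h3.trans (hR0 K)⟩

/-- Matrices close to a positive definite one are uniformly coercive. -/
lemma eventually_coercive {W : ℕ → Matrix (Fin dμ) (Fin dμ) ℝ}
    {W0 : Matrix (Fin dμ) (Fin dμ) ℝ} (hW0 : W0.PosDef) (hW : Tendsto W atTop (𝓝 W0)) :
    ∃ c : ℝ, 0 < c ∧ ∀ᶠ k in atTop, ∀ x, c * (x ⬝ᵥ x) ≤ x ⬝ᵥ (W k *ᵥ x) := by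
  -- coercivity of the limit in the supremum norm
  have h1 : ∃ m : ℝ, 0 < m ∧ ∀ x, m * ‖x‖ ^ 2 ≤ x ⬝ᵥ (W0 *ᵥ x) := by
    -- The unit sphere is empty when `dμ = 0`.
    rcases (Metric.sphere (0 : Fin dμ → ℝ) 1).eq_empty_or_nonempty with he | hne
    · refine ⟨1, one_pos, fun x => ?_⟩
      have hx : x = 0 := by
        by_contra hx
        have : ‖x‖⁻¹ • x ∈ Metric.sphere (0 : Fin dμ → ℝ) 1 := by
          simp [norm_smul, norm_ne_zero_iff.mpr hx]
        rw [he] at this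
        exact this
      simp [hx]
    · have hf : Continuous fun x : Fin dμ → ℝ => x ⬝ᵥ (W0 *ᵥ x) := by
        simp only [dotProduct, Matrix.mulVec]; fun_prop
      obtain ⟨x0, hx0, hmin⟩ := (isCompact_sphere (0 : Fin dμ → ℝ) 1).exists_isMinOn hne
        hf.continuousOn
      have hx00 : x0 ≠ 0 := by
        rintro rfl
        simp at hx0
      refine ⟨x0 ⬝ᵥ (W0 *ᵥ x0), by simpa using hW0.dotProduct_mulVec_pos hx00, fun x => ?_⟩
      by_cases hx : x = 0
      · simp [hx]
      have hxn : ‖x‖ ≠ 0 := norm_ne_zero_iff.mpr hx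
      have h2 : x0 ⬝ᵥ (W0 *ᵥ x0) ≤ (‖x‖⁻¹ • x) ⬝ᵥ (W0 *ᵥ (‖x‖⁻¹ • x)) :=
        hmin (by simp [norm_smul, hxn])
      rw [Matrix.mulVec_smul, smul_dotProduct, dotProduct_smul, smul_eq_mul, smul_eq_mul] at h2
      have h3 := mul_le_mul_of_nonneg_right h2 (sq_nonneg ‖x‖)
      refine h3.trans_eq ?_
      field_simp
  obtain ⟨m, hm, hmW⟩ := h1
  have h2 : Tendsto (fun k => ∑ i, ∑ j, |(W k - W0) i j|) atTop (𝓝 0) := by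
    have h : Continuous fun P : Matrix (Fin dμ) (Fin dμ) ℝ => ∑ i, ∑ j, |(P - W0) i j| := by
      fun_prop
    have h3 := (h.tendsto W0).comp hW
    simpa [Function.comp_def] using h3
  -- Half of the coercivity is spent on the perturbation. The factor `dμ` compares the Euclidean and
  -- supremum norms, and the added 1 covers `dμ = 0`.
  refine ⟨m / (2 * (dμ + 1)), by positivity, ?_⟩
  filter_upwards [h2.eventually (gt_mem_nhds (half_pos hm))] with k hk x
  have h3 : |x ⬝ᵥ ((W k - W0) *ᵥ x)| ≤ (∑ i, ∑ j, |(W k - W0) i j|) * ‖x‖ ^ 2 := by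
    simp only [dotProduct, Matrix.mulVec, Finset.mul_sum, Finset.sum_mul]
    refine (Finset.abs_sum_le_sum_abs _ _).trans (Finset.sum_le_sum fun i _ => ?_)
    refine (Finset.abs_sum_le_sum_abs _ _).trans (Finset.sum_le_sum fun j _ => ?_)
    rw [abs_mul, abs_mul]
    have hi : |x i| ≤ ‖x‖ := norm_le_pi_norm x i
    have hj : |x j| ≤ ‖x‖ := norm_le_pi_norm x j
    have h5 : |x i| * |x j| ≤ ‖x‖ * ‖x‖ := mul_le_mul hi hj (abs_nonneg _) (norm_nonneg _)
    nlinarith [abs_nonneg ((W k - W0) i j)]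
  have h4 : x ⬝ᵥ x ≤ dμ * ‖x‖ ^ 2 := by
    have h5 : ∀ i ∈ Finset.univ, x i * x i ≤ ‖x‖ ^ 2 := fun i _ => by
      have hi : |x i| ≤ ‖x‖ := norm_le_pi_norm x i
      rw [← abs_mul_abs_self]
      nlinarith [abs_nonneg (x i)]
    simpa [dotProduct] using Finset.sum_le_card_nsmul _ _ _ h5
  have h5 := hmW x
  rw [Matrix.sub_mulVec, dotProduct_sub] at h3
  have h6 := (abs_le.mp h3).1
  have h7 : m / (2 * (dμ + 1)) * (x ⬝ᵥ x) ≤ m / 2 * ‖x‖ ^ 2 := by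
    have h8 : m / (2 * (dμ + 1)) * (x ⬝ᵥ x) ≤ m / (2 * (dμ + 1)) * ((dμ + 1) * ‖x‖ ^ 2) := by
      refine mul_le_mul_of_nonneg_left ?_ (by positivity)
      nlinarith [sq_nonneg ‖x‖]
    refine h8.trans_eq ?_
    field_simp
  nlinarith [sq_nonneg ‖x‖]

end Limits

/-! ### Limits of rejecting samples -/

section Rejections

variable {dC dμ dδ : ℕ}

/-- Solutions of the quadratic programs exist eventually, and their scaled residuals are
bounded. -/
lemma eventually_residual_bounded {B : Matrix (Fin dC) (Fin dμ) ℝ}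
    {C : ℕ → Matrix (Fin dC) (Fin dδ) ℝ} {d : ℕ → Fin dC → ℝ} {N : ℕ → ℕ+}
    {W : ℕ → Matrix (Fin dμ) (Fin dμ) ℝ} {W0 : Matrix (Fin dμ) (Fin dμ) ℝ} (hW0 : W0.PosDef)
    (hW : Tendsto W atTop (𝓝 W0)) {mubar y : ℕ → Fin dμ → ℝ} {y0 : Fin dμ → ℝ}
    (hy : Tendsto y atTop (𝓝 y0)) {p0 : ℕ → (Fin dμ → ℝ) × (Fin dδ → ℝ)}
    (hp0 : ∀ k, p0 k ∈ feasible B (C k) (d k))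
    (hp0y : ∀ k, √((N k : ℕ) : ℝ) • (mubar k - (p0 k).1) = y k) :
    (∀ᶠ k in atTop, ∃ p, IsArgmin (qform (N k) (W k) (mubar k)) (feasible B (C k) (d k)) p) ∧
    ∃ R, ∀ᶠ k in atTop, ∀ p, IsArgmin (qform (N k) (W k) (mubar k)) (feasible B (C k) (d k)) p →
      ‖√((N k : ℕ) : ℝ) • (mubar k - p.1)‖ ≤ R := by
  obtain ⟨c, hc, hcW⟩ := eventually_coercive hW0 hW
  refine ⟨?_, ?_⟩
  · filter_upwards [hcW] with k hk
    exact exists_isArgmin_qform ⟨p0 k, hp0 k⟩ (N k) hc hk (mubar k)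
  -- The optimal value is at most the value at `p0 k`, which converges; coercivity turns this into a
  -- bound on the residual.
  have h1 : Tendsto (fun k => y k ⬝ᵥ (W k *ᵥ y k)) atTop (𝓝 (y0 ⬝ᵥ (W0 *ᵥ y0))) :=
    tendsto_dotProduct hy (tendsto_mulVec hW hy)
  refine ⟨√((y0 ⬝ᵥ (W0 *ᵥ y0) + 1) / c), ?_⟩
  filter_upwards [hcW, h1.eventually (gt_mem_nhds (lt_add_one _))] with k hk hk' p hp
  refine (norm_le_sqrt_dotProduct _).trans (Real.sqrt_le_sqrt ?_)
  rw [le_div_iff₀ hc, mul_comm]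
  refine (hk _).trans ?_
  have h2 := hp.2 _ (hp0 k)
  rw [qform_eq, qform_eq, hp0y] at h2
  exact h2.trans hk'.le

lemma tendsto_matrix_inv {n : ℕ} {W : ℕ → Matrix (Fin n) (Fin n) ℝ} {W0 : Matrix (Fin n) (Fin n) ℝ}
    (h0 : W0.det ≠ 0) (hW : Tendsto W atTop (𝓝 W0)) :
    Tendsto (fun k => (W k)⁻¹) atTop (𝓝 W0⁻¹) := by
  simp only [Matrix.inv_def, Ring.inverse_eq_inv']
  have h1 : Tendsto (fun k => (W k).det) atTop (𝓝 W0.det) :=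
    ((Continuous.matrix_det continuous_id).tendsto W0).comp hW
  have h2 : Tendsto (fun k => (W k).adjugate) atTop (𝓝 W0.adjugate) :=
    ((Continuous.matrix_adjugate continuous_id).tendsto W0).comp hW
  exact (h1.inv₀ h0).smul h2

lemma tendsto_sandwich {Om : ℕ → Matrix (StackIdx dμ dδ) (StackIdx dμ dδ) ℝ}
    {Om0 : Matrix (StackIdx dμ dδ) (StackIdx dμ dδ) ℝ} (hOm : Tendsto Om atTop (𝓝 Om0))
    {δ : ℕ → Fin dδ → ℝ} {δ0 : Fin dδ → ℝ} (hδ : Tendsto δ atTop (𝓝 δ0)) :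
    Tendsto (fun k => sandwich (Om k) (δ k)) atTop (𝓝 (sandwich Om0 δ0)) := by
  have hl : Continuous fun δ : Fin dδ → ℝ => loading (dμ := dμ) δ := by
    refine continuous_pi fun i => continuous_pi fun j => ?_
    rcases i with i | i
    · exact continuous_const
    · exact (continuous_apply i.1).mul continuous_const
  have h1 : Tendsto (fun k => loading (dμ := dμ) (δ k)) atTop (𝓝 (loading δ0)) :=
    (hl.tendsto δ0).comp hδ
  have h2 : Tendsto (fun k => (loading (dμ := dμ) (δ k))ᵀ) atTop (𝓝 (loading δ0)ᵀ) :=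
    ((hl.matrix_transpose).tendsto δ0).comp hδ
  have hm : ∀ {a b e : Type} [Fintype b] {P : ℕ → Matrix a b ℝ} {P0 : Matrix a b ℝ}
      {Q : ℕ → Matrix b e ℝ} {Q0 : Matrix b e ℝ}, Tendsto P atTop (𝓝 P0) → Tendsto Q atTop (𝓝 Q0) →
      Tendsto (fun k => P k * Q k) atTop (𝓝 (P0 * Q0)) := by
    intro a b e _ P P0 Q Q0 hP hQ
    have h : Continuous fun p : Matrix a b ℝ × Matrix b e ℝ => p.1 * p.2 :=
      continuous_fst.matrix_mul continuous_snd
    exact (h.tendsto (P0, Q0)).comp (hP.prodMk_nhds hQ)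
  exact hm (hm h2 hOm) h1

/-- Inequalities that come from equalities bind at every feasible point. -/
lemma feasible_pair {B : Matrix (Fin dC) (Fin dμ) ℝ} {D : Matrix (Fin dC) (Fin dδ) ℝ}
    {d : Fin dC → ℝ} {j j' : Fin dC} (hB : B j' = -B j) (hD : D j' = -D j) (hd : d j' = -d j)
    (Pi : Matrix (Fin dμ) (Fin dδ) ℝ) {u : Fin dμ → ℝ} {v : Fin dδ → ℝ}
    (h : (B * Pi + D) *ᵥ v ≤ d - B *ᵥ u) :
    ((B * Pi + D) *ᵥ v) j = (d - B *ᵥ u) j := by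
  have h1 : ∀ w : Fin dμ → ℝ, (B *ᵥ w) j' = -(B *ᵥ w) j := fun w => by
    simp only [Matrix.mulVec, hB, neg_dotProduct]
  have h2 : (D *ᵥ v) j' = -(D *ᵥ v) j := by
    simp only [Matrix.mulVec, hD, neg_dotProduct]
  have h3 := h j
  have h4 := h j'
  simp only [Matrix.add_mulVec, ← Matrix.mulVec_mulVec, _root_.Pi.add_apply, _root_.Pi.sub_apply,
    h1, h2, hd]
    at h3 h4 ⊢
  linarith

lemma mem_feasible_iff {B : Matrix (Fin dC) (Fin dμ) ℝ} {C : Matrix (Fin dC) (Fin dδ) ℝ}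
    {d : Fin dC → ℝ} {p : (Fin dμ → ℝ) × (Fin dδ → ℝ)} :
    p ∈ feasible B C d ↔ C *ᵥ p.2 ≤ d - B *ᵥ p.1 := by
  rw [le_sub_iff_add_le']
  rfl

lemma sInf_image_of_isArgmin {E : Type*} {f : E → ℝ} {S : Set E} {x : E} (h : IsArgmin f S x) :
    sInf (f '' S) = f x :=
  IsLeast.csInf_eq ⟨⟨x, h.1, rfl⟩, by rintro _ ⟨y, hy, rfl⟩; exact h.2 y hy⟩

/-- A limit of scaled estimation errors of rejecting samples lies in the rejection region of the
limit experiment. -/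
theorem rejection_limit (B : Matrix (Fin dC) (Fin dμ) ℝ) (D : Matrix (Fin dC) (Fin dδ) ℝ)
    {E J : Set (Fin dC)} {N : ℕ → ℕ+} (hN : Tendsto (fun k => ((N k : ℕ) : ℝ)) atTop atTop)
    {muF muBar : ℕ → Fin dμ → ℝ} {PiF PiBar : ℕ → Matrix (Fin dμ) (Fin dδ) ℝ}
    {d : ℕ → Fin dC → ℝ} {Om : ℕ → Matrix (StackIdx dμ dδ) (StackIdx dμ dδ) ℝ}
    {Ups : ℕ → Matrix (Fin dμ) (Fin dμ) ℝ} {mu0 xmu : Fin dμ → ℝ}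
    {Pi0 xPi : Matrix (Fin dμ) (Fin dδ) ℝ} {d0 : Fin dC → ℝ}
    {Om0 : Matrix (StackIdx dμ dδ) (StackIdx dμ dδ) ℝ} {Ups0 : Matrix (Fin dμ) (Fin dμ) ℝ}
    (hmu : Tendsto muF atTop (𝓝 mu0)) (hPi : Tendsto PiF atTop (𝓝 Pi0))
    (hd : Tendsto d atTop (𝓝 d0))
    (hx : Tendsto (fun k => √((N k : ℕ) : ℝ) • (muBar k - muF k)) atTop (𝓝 xmu))
    (hX : Tendsto (fun k => √((N k : ℕ) : ℝ) • (PiBar k - PiF k)) atTop (𝓝 xPi))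
    (hOm : Tendsto Om atTop (𝓝 Om0)) (hUps : Tendsto Ups atTop (𝓝 Ups0)) (hUps0 : Ups0.PosDef)
    {δ0 : Fin dδ → ℝ} (hδ0 : δ0 = minNormPoint (B * Pi0 + D) (d0 - B *ᵥ mu0))
    (hne0 : (poly (B * Pi0 + D) (d0 - B *ᵥ mu0)).Nonempty)
    (hSig : (sandwich Om0 δ0).PosDef)
    (hpair : ∀ j ∈ E, ∃ j', B j' = -B j ∧ D j' = -D j ∧ ∀ k, d k j' = -d k j)
    {δ : ℕ → Fin dδ → ℝ} (hδ : ∀ k, δ k ∈ poly (B * PiF k + D) (d k - B *ᵥ muF k))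
    (hδlim : Tendsto δ atTop (𝓝 δ0)) {σ : Fin dC → ℝ}
    (hσ : ∀ j ∈ J, Tendsto (fun k => √((N k : ℕ) : ℝ) *
      (d k - B *ᵥ muF k - (B * PiF k + D) *ᵥ δ k) j) atTop (𝓝 (σ j)))
    (hσ' : ∀ j, j ∉ J → Tendsto (fun k => √((N k : ℕ) : ℝ) *
      (d k - B *ᵥ muF k - (B * PiF k + D) *ᵥ δ k) j) atTop atTop)
    (hrank : ∀ K ∈ Activ (B * Pi0 + D) (d0 - B *ᵥ mu0), E ⊆ K → ∀ k,
      (rows K (B * PiBar k + D)).rank = (rows K (B * Pi0 + D)).rank)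
    {c : ℕ → ℝ} (hc : Monotone c) (hc0 : 0 ≤ c 0) (hc1 : 0 < c 1)
    {muT : ℕ → Fin dμ → ℝ}
    (hmuT : ∀ k, muT k =
      (argmin (qform (N k) (Ups k) (muBar k)) (feasible B (B * PiBar k + D) (d k))).1)
    {W : ℕ → Matrix (Fin dμ) (Fin dμ) ℝ}
    (hW : ∀ k, W k =
      (sandwich (Om k) (minNormPoint (B * PiBar k + D) (d k - B *ᵥ muT k)))⁻¹)
    {hat : ℕ → (Fin dμ → ℝ) × (Fin dδ → ℝ)}
    (hhat : ∀ k, (∃ p, IsArgmin (qform (N k) (W k) (muBar k))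
      (feasible B (B * PiBar k + D) (d k)) p) →
      IsArgmin (qform (N k) (W k) (muBar k)) (feasible B (B * PiBar k + D) (d k)) (hat k))
    {Kh : ℕ → Set (Fin dC)}
    (hKh : ∀ k, Kh k = {j | ((B * PiBar k + D) *ᵥ (hat k).2) j = (d k - B *ᵥ (hat k).1) j})
    (hT : ∀ k, c ((rows (Kh k) (Matrix.fromCols B D)).rank -
        (rows (Kh k) (B * PiBar k + D)).rank) <
      sInf (qform (N k) (W k) (muBar k) '' feasible B (B * PiBar k + D) (d k))) :
    ∃ l0 : Fin dC → ℝ, (∀ j, 0 ≤ l0 j) ∧ (∀ j, j ∉ J → l0 j = 0) ∧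
      l0 ᵥ* (B * Pi0 + D) = 0 ∧ l0 ᵥ* B ≠ 0 ∧
      (∀ v : Fin dC → ℝ, (∀ j, 0 ≤ v j) → (∀ j, j ∉ J → v j = 0) → v ᵥ* (B * Pi0 + D) = 0 →
        (v ᵥ* B) ⬝ᵥ (xmu + xPi *ᵥ δ0 - sandwich Om0 δ0 *ᵥ (l0 ᵥ* B)) ≤ v ⬝ᵥ σ) ∧
      (l0 ᵥ* B) ⬝ᵥ (xmu + xPi *ᵥ δ0 - sandwich Om0 δ0 *ᵥ (l0 ᵥ* B)) = l0 ⬝ᵥ σ ∧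
      c (Module.finrank ℝ (multSpace B (B * Pi0 + D) {j | l0 j ≠ 0})) ≤
        (l0 ᵥ* B) ⬝ᵥ (sandwich Om0 δ0 *ᵥ (l0 ᵥ* B)) := by
  set q : ℕ → ℝ := fun k => √((N k : ℕ) : ℝ) with hq
  have hqpos : ∀ k, 0 < q k := fun k => Real.sqrt_pos.mpr (by exact_mod_cast (N k).pos)
  have hqinf : Tendsto q atTop atTop := Real.tendsto_sqrt_atTop.comp hN
  have hqinv : Tendsto (fun k => (q k)⁻¹) atTop (𝓝 0) := hqinf.inv_tendsto_atTop
  set C0 := B * Pi0 + D with hC0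
  set b0 := d0 - B *ᵥ mu0 with hb0
  have hcont : Continuous fun P : Matrix (Fin dμ) (Fin dδ) ℝ => B * P + D := by fun_prop
  -- consistency
  have hPiB : Tendsto PiBar atTop (𝓝 Pi0) := by
    have h1 := (hqinv.smul hX).add hPi
    rw [zero_smul, zero_add] at h1
    refine h1.congr fun k => ?_
    rw [inv_smul_smul₀ (hqpos k).ne', sub_add_cancel]
  have hmuB : Tendsto muBar atTop (𝓝 mu0) := by
    have h1 := (hqinv.smul hx).add hmu
    rw [zero_smul, zero_add] at h1
    refine h1.congr fun k => ?_
    rw [inv_smul_smul₀ (hqpos k).ne', sub_add_cancel]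
  have hCB : Tendsto (fun k => B * PiBar k + D) atTop (𝓝 C0) := (hcont.tendsto _).comp hPiB
  -- a feasible point
  set y : ℕ → Fin dμ → ℝ := fun k =>
    q k • (muBar k - muF k) + (q k • (PiBar k - PiF k)) *ᵥ δ k with hy
  have hylim : Tendsto y atTop (𝓝 (xmu + xPi *ᵥ δ0)) := hx.add (tendsto_mulVec hX hδlim)
  -- Moving μ_F by -(Π̄ - Π_F)δ cancels the estimation error in C̄δ, so the slack of the true
  -- constraints is preserved exactly. The scaled residual of this point is `y k`.
  set p0 : ℕ → (Fin dμ → ℝ) × (Fin dδ → ℝ) := fun k =>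
    (muF k - (PiBar k - PiF k) *ᵥ δ k, δ k) with hp0
  have hp0f : ∀ k, p0 k ∈ feasible B (B * PiBar k + D) (d k) := by
    intro k
    rw [mem_feasible_iff]
    have h1 : (B * PiF k + D) *ᵥ δ k ≤ d k - B *ᵥ muF k := hδ k
    simp only [hp0]
    rw [Matrix.mulVec_sub, Matrix.mulVec_mulVec]
    have h2 : (B * PiBar k + D) *ᵥ δ k = (B * PiF k + D) *ᵥ δ k +
        (B * (PiBar k - PiF k)) *ᵥ δ k := by
      rw [← Matrix.add_mulVec]
      congr 1
      rw [Matrix.mul_sub]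
      abel
    rw [h2]
    intro j
    have := h1 j
    simp only [Pi.add_apply, Pi.sub_apply] at this ⊢
    linarith
  have hp0y : ∀ k, √((N k : ℕ) : ℝ) • (muBar k - (p0 k).1) = y k := by
    intro k
    simp only [hp0, hy, hq]
    rw [Matrix.smul_mulVec, ← smul_add]
    congr 1
    abel
  -- first step
  obtain ⟨hex1, R1, hR1⟩ := eventually_residual_bounded hUps0 hUps hylim hp0f hp0y
  have hmuTarg : ∀ᶠ k in atTop, IsArgmin (qform (N k) (Ups k) (muBar k))
      (feasible B (B * PiBar k + D) (d k))
      (argmin (qform (N k) (Ups k) (muBar k)) (feasible B (B * PiBar k + D) (d k))) := by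
    filter_upwards [hex1] with k hk using argmin_spec hk
  have hmuTlim : Tendsto muT atTop (𝓝 mu0) := by
    have h1 : Tendsto (fun k => muBar k - muT k) atTop (𝓝 0) := by
      have h2 := hqinv.mul_const R1
      rw [zero_mul] at h2
      refine squeeze_zero_norm' ?_ h2
      filter_upwards [hR1, hmuTarg] with k hk hk'
      have h3 := hk _ hk'
      rw [← hmuT, norm_smul, Real.norm_eq_abs, abs_of_pos (hqpos k)] at h3
      rwa [le_inv_mul_iff₀ (hqpos k)]
    have h2 := hmuB.sub h1
    simpa using h2
  -- second step
  have hbT : Tendsto (fun k => d k - B *ᵥ muT k) atTop (𝓝 b0) :=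
    hd.sub (tendsto_mulVec tendsto_const_nhds hmuTlim)
  have hpair0 : ∀ x ∈ poly C0 b0, ∀ j ∈ E, (C0 *ᵥ x) j = b0 j := by
    intro x hx j hj
    obtain ⟨j', h1, h2, h3⟩ := hpair j hj
    refine feasible_pair h1 h2 ?_ Pi0 hx
    refine tendsto_nhds_unique (tendsto_pi_nhds.mp hd j') ?_
    simp only [h3]
    exact (tendsto_pi_nhds.mp hd j).neg
  have hδT : Tendsto (fun k => minNormPoint (B * PiBar k + D) (d k - B *ᵥ muT k)) atTop
      (𝓝 δ0) := by
    -- For early indices the first-step program may have no solution, and then the polyhedron at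
    -- `muT k` may be empty; the sequence is shifted past them.
    obtain ⟨n0, hn0⟩ := eventually_atTop.mp hmuTarg
    rw [← tendsto_add_atTop_iff_nat n0, hδ0]
    refine tendsto_minNormPoint ((tendsto_add_atTop_iff_nat n0).mpr hCB)
      ((tendsto_add_atTop_iff_nat n0).mpr hbT) (E := E) ?_ hpair0
      (fun K h1 h2 => Eventually.of_forall fun k => hrank K h1 h2 _) ?_ hne0
    · intro k x hx j hj
      obtain ⟨j', h1, h2, h3⟩ := hpair j hj
      exact feasible_pair h1 h2 (h3 _) _ hx
    · intro k
      have h1 := (hn0 (k + n0) (by omega)).1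
      rw [mem_feasible_iff, ← hmuT] at h1
      exact ⟨_, h1⟩
  set S0 := sandwich Om0 δ0 with hS0
  have hWlim : Tendsto W atTop (𝓝 S0⁻¹) := by
    have h1 := tendsto_matrix_inv hSig.det_pos.ne' (tendsto_sandwich hOm hδT)
    simpa only [← hW] using h1
  obtain ⟨hex2, R2, hR2⟩ := eventually_residual_bounded hSig.inv hWlim hylim hp0f hp0y
  obtain ⟨n0, hn0⟩ := eventually_atTop.mp (hex2.and hR2)
  have harg : ∀ k, n0 ≤ k → IsArgmin (qform (N k) (W k) (muBar k))
      (feasible B (B * PiBar k + D) (d k)) (hat k) := fun k hk => hhat k (hn0 k hk).1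
  set r : ℕ → Fin dμ → ℝ := fun k => q k • (muBar k - (hat k).1) with hr
  -- subsequences
  obtain ⟨r0, -, φ₁, hφ₁, hr0⟩ := (isCompact_closedBall (0 : Fin dμ → ℝ) R2).tendsto_subseq
    (x := fun k => r (k + n0)) (fun k => by
      rw [mem_closedBall_zero_iff]
      exact (hn0 _ (Nat.le_add_left _ _)).2 _ (harg _ (Nat.le_add_left _ _)))
  obtain ⟨K, φ₂, hφ₂, hK⟩ := exists_subseq_const (fun k => Kh (φ₁ k + n0))
  set φ : ℕ → ℕ := fun k => φ₁ (φ₂ k) + n0 with hφ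
  have hφn : ∀ k, n0 ≤ φ k := fun k => Nat.le_add_left _ _
  have hφlim : Tendsto φ atTop atTop :=
    tendsto_atTop_mono (fun k => Nat.le_add_right _ n0) (hφ₁.tendsto_atTop.comp hφ₂.tendsto_atTop)
  have hrφ : Tendsto (fun k => r (φ k)) atTop (𝓝 r0) := hr0.comp hφ₂.tendsto_atTop
  have hKφ : ∀ k, Kh (φ k) = K := hK
  choose l hlK hlC hlB using fun k => qform_multipliers B (B * PiBar (φ k) + D) (d (φ k)) (N (φ k))
    (W (φ k)) (muBar (φ k)) (harg (φ k) (hφn k))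
  have hlK' : ∀ k, l k ∈ signCone K ∅ := fun k => by
    rw [← hKφ k, hKh]; exact hlK k
  -- bounded multipliers
  have hv : Tendsto (fun k => l k ᵥ* B) atTop (𝓝 (((1 / 2 : ℝ) • (S0⁻¹ + (S0⁻¹)ᵀ)) *ᵥ r0)) := by
    refine Tendsto.congr (fun k => hlB k) (tendsto_mulVec ?_ hrφ)
    have h : Continuous fun P : Matrix (Fin dμ) (Fin dμ) ℝ => (1 / 2 : ℝ) • (P + Pᵀ) := by
      fun_prop
    exact (h.tendsto _).comp (hWlim.comp hφlim)
  -- Because `l` annihilates the estimated Jacobian, its images under both `B` and `D` are bounded.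
  -- Working with the fixed matrix `[B, D]` gives bounded multipliers without any rank condition.
  have hlD : ∀ k, l k ᵥ* D = -((l k ᵥ* B) ᵥ* PiBar (φ k)) := fun k => by
    have h1 := hlC k
    rw [Matrix.vecMul_add, ← Matrix.vecMul_vecMul] at h1
    exact eq_neg_of_add_eq_zero_right h1
  have hvD : Tendsto (fun k => l k ᵥ* D) atTop
      (𝓝 (-((((1 / 2 : ℝ) • (S0⁻¹ + (S0⁻¹)ᵀ)) *ᵥ r0) ᵥ* Pi0))) := by
    simp only [hlD]
    exact (tendsto_vecMul hv (hPiB.comp hφlim)).neg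
  obtain ⟨M1, hM1⟩ := (Metric.isBounded_range_of_tendsto _ hv).exists_norm_le
  obtain ⟨M2, hM2⟩ := (Metric.isBounded_range_of_tendsto _ hvD).exists_norm_le
  obtain ⟨R, hR⟩ := exists_bounded_multiplier (Matrix.fromCols B D) (max M1 M2)
  have hbd : ∀ k, ∃ l' ∈ signCone K ∅, l' ᵥ* Matrix.fromCols B D = l k ᵥ* Matrix.fromCols B D ∧
      ‖l'‖ ≤ R := fun k => hR K (l k) (hlK' k) (fun j => by
    rw [Matrix.vecMul_fromCols]
    rcases j with i | i
    · exact ((norm_le_pi_norm (l k ᵥ* B) i).trans (hM1 _ ⟨k, rfl⟩)).trans (le_max_left _ _)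
    · exact ((norm_le_pi_norm (l k ᵥ* D) i).trans (hM2 _ ⟨k, rfl⟩)).trans (le_max_right _ _))
  choose l' hl'K hl'A hl'R using hbd
  have hl'B : ∀ k, l' k ᵥ* B = l k ᵥ* B := fun k => by
    have h1 := hl'A k
    rw [Matrix.vecMul_fromCols, Matrix.vecMul_fromCols] at h1
    exact funext fun i => congrFun h1 (Sum.inl i)
  have hl'D : ∀ k, l' k ᵥ* D = l k ᵥ* D := fun k => by
    have h1 := hl'A k
    rw [Matrix.vecMul_fromCols, Matrix.vecMul_fromCols] at h1
    exact funext fun i => congrFun h1 (Sum.inr i)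
  have hl'C : ∀ k, l' k ᵥ* (B * PiBar (φ k) + D) = 0 := fun k => by
    rw [← hlC k, Matrix.vecMul_add, Matrix.vecMul_add, ← Matrix.vecMul_vecMul,
      ← Matrix.vecMul_vecMul, hl'B, hl'D]
  obtain ⟨l0, -, τ, hτ, hl0⟩ := (isCompact_closedBall (0 : Fin dC → ℝ) R).tendsto_subseq
    (x := l') (fun k => by simpa using hl'R k)
  set θ : ℕ → ℕ := fun k => φ (τ k) with hθ
  have hθlim : Tendsto θ atTop atTop := hφlim.comp hτ.tendsto_atTop
  have hKθ : ∀ k, Kh (θ k) = K := fun k => hKφ _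
  have hargθ : ∀ k, IsArgmin (qform (N (θ k)) (W (θ k)) (muBar (θ k)))
      (feasible B (B * PiBar (θ k) + D) (d (θ k))) (hat (θ k)) := fun k => harg _ (hφn _)
  set s : ℕ → Fin dC → ℝ := fun k => q k • (d k - B *ᵥ muF k - (B * PiF k + D) *ᵥ δ k) with hs
  have hb0E : ∀ k, ∀ j ∈ E, s k j = 0 := by
    intro k j hj
    obtain ⟨j', h1, h2, h3⟩ := hpair j hj
    have h4 := feasible_pair h1 h2 (h3 k) (PiF k) (hδ k)
    simp only [hs, Pi.smul_apply, Pi.sub_apply, smul_eq_mul] at h4 ⊢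
    rw [h4]
    ring
  -- the basic identity
  have hid : ∀ k v, v ᵥ* (B * PiBar k + D) = 0 → (v ᵥ* B) ⬝ᵥ (y k - r k) =
      v ⬝ᵥ s k - q k * (v ⬝ᵥ (d k - B *ᵥ (hat k).1 - (B * PiBar k + D) *ᵥ (hat k).2)) := by
    intro k v hv
    have h1 : v ᵥ* (B * PiF k + D) = -((v ᵥ* B) ᵥ* (PiBar k - PiF k)) := by
      have h2 : B * PiF k + D = (B * PiBar k + D) - B * (PiBar k - PiF k) := by
        rw [Matrix.mul_sub]; abel
      rw [h2, Matrix.vecMul_sub, hv, zero_sub, Matrix.vecMul_vecMul]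
    have h3 : y k - r k = q k • ((hat k).1 - muF k + (PiBar k - PiF k) *ᵥ δ k) := by
      simp only [hy, hr]
      rw [Matrix.smul_mulVec, ← smul_add, ← smul_sub]
      congr 1
      abel
    rw [h3]
    simp only [hs]
    rw [dotProduct_smul, dotProduct_smul, smul_eq_mul, smul_eq_mul, ← mul_sub]
    congr 1
    rw [dotProduct_sub v _ ((B * PiBar k + D) *ᵥ (hat k).2), Matrix.dotProduct_mulVec v
      (B * PiBar k + D), hv, zero_dotProduct, dotProduct_sub v _ ((B * PiF k + D) *ᵥ δ k),
      Matrix.dotProduct_mulVec v (B * PiF k + D), h1, dotProduct_sub, dotProduct_sub,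
      Matrix.dotProduct_mulVec v B, Matrix.dotProduct_mulVec v B, dotProduct_add, dotProduct_sub,
      neg_dotProduct, Matrix.dotProduct_mulVec (v ᵥ* B)]
    ring
  have hEK : E ⊆ K := by
    intro j hj
    rw [← hKθ 0, hKh]
    obtain ⟨j', h1, h2, h3⟩ := hpair j hj
    exact feasible_pair h1 h2 (h3 _) _ (mem_feasible_iff.mp (hargθ 0).1)
  -- A finite limit after scaling by √n means that the slack itself vanishes. So every subset of `J`
  -- is active at `δ0`, and rank stability covers those that contain `E`.
  have hJ : ∀ j ∈ J, (C0 *ᵥ δ0) j = b0 j := by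
    intro j hj
    have h1 : Tendsto (fun k => d k - B *ᵥ muF k - (B * PiF k + D) *ᵥ δ k) atTop
        (𝓝 (b0 - C0 *ᵥ δ0)) :=
      (hd.sub (tendsto_mulVec tendsto_const_nhds hmu)).sub
        (tendsto_mulVec ((hcont.tendsto _).comp hPi) hδlim)
    have h2 := hqinv.mul (hσ j hj)
    rw [zero_mul] at h2
    have h3 := tendsto_nhds_unique (tendsto_pi_nhds.mp h1 j) (h2.congr fun k => by
      rw [← mul_assoc, inv_mul_cancel₀ (hqpos k).ne', one_mul])
    simp only [Pi.sub_apply] at h3 ⊢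
    linarith
  have hδ0mem : δ0 ∈ poly C0 b0 := hδ0 ▸ (isArgmin_minNormPoint hne0).1
  refine ⟨l0, limit_multiplier B D (E := E) (K := K) (J := J) (Pi := fun k => PiBar (θ k))
    (hPiB.comp hθlim) (y := fun k => y (θ k)) (hylim.comp hθlim) (r := fun k => r (θ k))
    (hrφ.comp hτ.tendsto_atTop) (l := fun k => l' (τ k)) (s := fun k => s (θ k)) hl0
    (W := fun k => W (θ k)) hSig (hWlim.comp hθlim)
    (fun j hj => (hσ j hj).comp hθlim) (fun j hj => (hσ' j hj).comp hθlim) ?_ ?_ ?_ ?_ ?_ ?_ ?_ ?_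
    hEK hc hc0 hc1 ?_⟩
  · intro k j
    have h1 := hδ (θ k) j
    simp only [hs, Pi.smul_apply, Pi.sub_apply, smul_eq_mul] at h1 ⊢
    exact mul_nonneg (hqpos _).le (by linarith)
  · exact fun k => hb0E _
  · intro K0 h1 h2 k
    exact hrank K0 ⟨δ0, hδ0mem, fun j hj => hJ j (h2 hj)⟩ h1 _
  · intro k v hv hv0
    rw [hid _ _ hv0]
    have h1 := mem_feasible_iff.mp (hargθ k).1
    have h2 : 0 ≤ v ⬝ᵥ (d (θ k) - B *ᵥ (hat (θ k)).1 -
        (B * PiBar (θ k) + D) *ᵥ (hat (θ k)).2) := by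
      refine Finset.sum_nonneg fun j _ => ?_
      by_cases hj : j ∈ E
      · obtain ⟨j', e1, e2, e3⟩ := hpair j hj
        rw [Pi.sub_apply, ← feasible_pair e1 e2 (e3 _) _ h1, sub_self, mul_zero]
      · exact mul_nonneg (hv j hj) (sub_nonneg.mpr (h1 j))
    have := mul_nonneg (hqpos (θ k)).le h2
    linarith
  · intro k
    rw [hid _ _ (hl'C (τ k))]
    have h2 : l' (τ k) ⬝ᵥ (d (θ k) - B *ᵥ (hat (θ k)).1 -
        (B * PiBar (θ k) + D) *ᵥ (hat (θ k)).2) = 0 := by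
      refine Finset.sum_eq_zero fun j _ => ?_
      by_cases hj : j ∈ K
      · rw [← hKθ k, hKh] at hj
        rw [Pi.sub_apply, ← show _ = _ from hj, sub_self, mul_zero]
      · rw [(hl'K (τ k)).1 j hj, zero_mul]
    rw [h2, mul_zero, sub_zero]
  · exact fun k => hl'C (τ k)
  · intro k
    rw [hl'B]
    exact hlB (τ k)
  · exact fun k => hl'K _
  · intro k
    have h1 := hT (θ k)
    rwa [sInf_image_of_isArgmin (hargθ k), qform_eq, hKθ k] at h1

end Rejections

/-! ### Gaussian measure of translated cones -/

section GaussianCone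

open scoped RealInnerProductSpace ENNReal

variable {V : Type*} [NormedAddCommGroup V] [InnerProductSpace ℝ V] [FiniteDimensional ℝ V]
  [MeasurableSpace V] [BorelSpace V]

/-- The Gaussian kernel without its normalizing constant. -/
def gaussKernel (t : ℝ) : ℝ≥0∞ := ENNReal.ofReal (Real.exp (-t ^ 2 / 2))

lemma measurable_gaussKernel : Measurable gaussKernel := by
  unfold gaussKernel; fun_prop

variable (V) in
/-- The standard Gaussian measure has a density proportional to the Gaussian kernel. -/
theorem exists_stdGaussian_eq : ∃ z : ℝ≥0∞, z ≠ ∞ ∧ stdGaussian V =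
    z • (volume : Measure V).withDensity (fun x => gaussKernel ‖x‖) := by
  have hmeas : Measurable fun x : V => gaussKernel ‖x‖ := measurable_gaussKernel.comp measurable_norm
  set ρ := (volume : Measure V).withDensity (fun x => gaussKernel ‖x‖) with hρ
  have hcexp : ∀ t : V, ∫ v : V, Complex.exp (-(1 / 2 : ℂ) * ‖v‖ ^ 2 + Complex.I * ⟪t, v⟫) =
      (Real.pi / (1 / 2 : ℂ)) ^ (Module.finrank ℝ V / 2 : ℂ) *
        Complex.exp (Complex.I ^ 2 * ‖t‖ ^ 2 / (4 * (1 / 2))) :=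
    fun t => GaussianFourier.integral_cexp_neg_mul_sq_norm_add (by norm_num) Complex.I t
  -- The Fourier transform of the kernel is a constant multiple of the standard Gaussian one, so the
  -- measures are proportional. The constant is fixed by the total mass and never needs evaluating.
  have hchar : ∀ t : V, charFun ρ t =
      (Real.pi / (1 / 2 : ℂ)) ^ (Module.finrank ℝ V / 2 : ℂ) * charFun (stdGaussian V) t := by
    intro t
    rw [charFun_apply, hρ, integral_withDensity_eq_integral_toReal_smul hmeas
      (Eventually.of_forall fun _ => ENNReal.ofReal_lt_top), charFun_stdGaussian]
    have h1 := hcexp t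
    have h2 : Complex.exp (Complex.I ^ 2 * ‖t‖ ^ 2 / (4 * (1 / 2))) =
        Complex.exp (-(‖t‖ : ℂ) ^ 2 / 2) := by
      congr 1; rw [Complex.I_sq]; ring
    rw [h2] at h1
    rw [← h1]
    refine integral_congr_ae (Eventually.of_forall fun v => ?_)
    simp only [gaussKernel, ENNReal.toReal_ofReal (Real.exp_pos _).le, Complex.real_smul,
      Complex.ofReal_exp]
    rw [← Complex.exp_add]
    congr 1
    push_cast
    rw [real_inner_comm]
    ring
  have hfin : IsFiniteMeasure ρ := by
    have hint : Integrable (fun v : V => Real.exp (-‖v‖ ^ 2 / 2)) := by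
      have h1 := (GaussianFourier.integrable_cexp_neg_mul_sq_norm_add (b := 1 / 2) (by norm_num) 0
        (0 : V)).norm
      refine h1.congr (Eventually.of_forall fun v => ?_)
      simp only [Complex.norm_exp]
      congr 1
      simp only [zero_mul, add_zero]
      have : (-(1 / 2 : ℂ) * (‖v‖ : ℂ) ^ 2) = ((-(1 / 2) * ‖v‖ ^ 2 : ℝ) : ℂ) := by push_cast; ring
      rw [this, Complex.ofReal_re]
      ring
    exact isFiniteMeasure_withDensity_ofReal hint.2
  have h0 := hchar 0
  rw [charFun_zero, charFun_zero] at h0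
  have hρeq : ρ = ρ Set.univ • stdGaussian V := by
    have : IsFiniteMeasure (ρ Set.univ • stdGaussian V) :=
      Measure.smul_finite _ (measure_ne_top _ _)
    refine Measure.ext_of_charFun (funext fun t => ?_)
    have h3 : charFun (ρ Set.univ • stdGaussian V) t =
        (ρ.real Set.univ : ℂ) * charFun (stdGaussian V) t := by
      rw [charFun_apply, charFun_apply, integral_smul_measure, Complex.real_smul]
      rfl
    rw [hchar, h3, h0]
    simp
  have hne : ρ Set.univ ≠ 0 := by
    intro h
    rw [withDensity_apply _ MeasurableSet.univ, Measure.restrict_univ,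
      lintegral_eq_zero_iff hmeas] at h
    have h4 : ∀ᵐ _ : V, False := by
      filter_upwards [h] with v hv
      simp only [gaussKernel, Pi.zero_apply, ENNReal.ofReal_eq_zero, not_le.mpr (Real.exp_pos _)]
        at hv
    have h5 : (volume : Measure V) = 0 := by simpa using h4
    exact isOpen_univ.measure_ne_zero (volume : Measure V) Set.univ_nonempty (by rw [h5]; rfl)
  refine ⟨(ρ Set.univ)⁻¹, ENNReal.inv_ne_top.mpr hne, ?_⟩
  calc stdGaussian V = (ρ Set.univ)⁻¹ • (ρ Set.univ • stdGaussian V) := by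
        rw [smul_smul, ENNReal.inv_mul_cancel hne (measure_ne_top _ _), one_smul]
    _ = (ρ Set.univ)⁻¹ • ρ := by rw [← hρeq]

lemma lintegral_stdGaussian : ∃ z : ℝ≥0∞, z ≠ ∞ ∧ ∀ f : V → ℝ≥0∞, Measurable f →
    ∫⁻ x, f x ∂stdGaussian V = z * ∫⁻ x, f x * gaussKernel ‖x‖ := by
  obtain ⟨z, hz, h⟩ := exists_stdGaussian_eq V
  have hmeas : Measurable fun x : V => gaussKernel ‖x‖ := measurable_gaussKernel.comp measurable_norm
  refine ⟨z, hz, fun f hf => ?_⟩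
  rw [h, lintegral_smul_measure, lintegral_withDensity_eq_lintegral_mul _ hmeas hf, smul_eq_mul]
  simp only [Pi.mul_apply, mul_comm]

/-- Polar coordinates for the product of a function of the direction and one of the norm. -/
lemma lintegral_polar [Nontrivial V] : ∃ (S : Measure (Metric.sphere (0 : V) 1))
    (P : Measure (Set.Ioi (0 : ℝ))), ∀ (u : V → ℝ≥0∞) (h : ℝ → ℝ≥0∞), Measurable u →
      Measurable h → (∀ (x : V) (t : ℝ), 0 < t → u (t • x) = u x) →
      ∫⁻ x, u x * h ‖x‖ = (∫⁻ x, u x ∂S) * ∫⁻ t, h t ∂P := by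
  refine ⟨volume.toSphere, .volumeIoiPow (Module.finrank ℝ V - 1), fun u h hu hh hut => ?_⟩
  calc ∫⁻ x, u x * h ‖x‖ = ∫⁻ x : ({(0 : V)}ᶜ : Set V), u x * h ‖(x : V)‖
        ∂((volume : Measure V).comap (↑)) := by
        rw [lintegral_subtype_comap (measurableSet_singleton _).compl fun x => u x * h ‖x‖,
          restrict_compl_singleton]
    _ = ∫⁻ p : Metric.sphere (0 : V) 1 × Set.Ioi (0 : ℝ), u (p.1 : V) * h (p.2 : ℝ)
        ∂(volume.toSphere.prod (.volumeIoiPow (Module.finrank ℝ V - 1))) := by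
        rw [← (volume : Measure V).measurePreserving_homeomorphUnitSphereProd.lintegral_comp
          (f := fun p : Metric.sphere (0 : V) 1 × Set.Ioi (0 : ℝ) => u (p.1 : V) * h (p.2 : ℝ))
          (by fun_prop)]
        refine lintegral_congr fun x => ?_
        have hx : 0 < ‖(x : V)‖ := norm_pos_iff.mpr x.2
        have h1 := hut x ‖(x : V)‖⁻¹ (inv_pos.mpr hx)
        simp only [homeomorphUnitSphereProd_apply_fst_coe,
          homeomorphUnitSphereProd_apply_snd_coe]
        rw [h1]
    _ = _ := lintegral_prod_mul (f := fun p : Metric.sphere (0 : V) 1 => u (p : V))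
        (g := fun t : Set.Ioi (0 : ℝ) => h (t : ℝ)) (by fun_prop) (by fun_prop)

/-- Under the standard Gaussian measure, the norm is independent of the direction. -/
lemma lintegral_homogeneous [Nontrivial V] {u : V → ℝ≥0∞} (hu : Measurable u)
    (hut : ∀ (x : V) (t : ℝ), 0 < t → u (t • x) = u x) (ρ : ℝ) :
    ∫⁻ x in {x | ρ ≤ ‖x‖}, u x ∂stdGaussian V =
      stdGaussian V {x | ρ ≤ ‖x‖} * ∫⁻ x, u x ∂stdGaussian V := by
  obtain ⟨z, -, hz⟩ := lintegral_stdGaussian (V := V)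
  obtain ⟨S, P, hSP⟩ := lintegral_polar (V := V)
  have hset : MeasurableSet {x : V | ρ ≤ ‖x‖} := measurableSet_le measurable_const measurable_norm
  set k : ℝ → ℝ≥0∞ := (Set.Ici ρ).indicator gaussKernel with hk
  have hkm : Measurable k := measurable_gaussKernel.indicator measurableSet_Ici
  -- all four integrals factor
  have e : ∀ v : V → ℝ≥0∞, Measurable v → (∀ (x : V) (t : ℝ), 0 < t → v (t • x) = v x) →
      ∫⁻ x in {x | ρ ≤ ‖x‖}, v x ∂stdGaussian V = z * ((∫⁻ x, v x ∂S) * ∫⁻ t, k t ∂P) := by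
    intro v hv hvt
    rw [← lintegral_indicator hset, hz _ (hv.indicator hset), ← hSP v k hv hkm hvt]
    congr 1
    refine lintegral_congr fun x => ?_
    by_cases hx : ρ ≤ ‖x‖
    · simp [hk, Set.indicator, hx]
    · simp [hk, Set.indicator, hx]
  have e' : ∀ v : V → ℝ≥0∞, Measurable v → (∀ (x : V) (t : ℝ), 0 < t → v (t • x) = v x) →
      ∫⁻ x, v x ∂stdGaussian V = z * ((∫⁻ x, v x ∂S) * ∫⁻ t, gaussKernel t ∂P) := by
    intro v hv hvt
    rw [hz _ hv, ← hSP v gaussKernel hv measurable_gaussKernel hvt]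
  have h1 := e u hu hut
  have h2 := e' u hu hut
  have h3 := e (fun _ => 1) measurable_const (fun _ _ _ => rfl)
  have h4 := e' (fun _ => 1) measurable_const (fun _ _ _ => rfl)
  rw [setLIntegral_one] at h3
  simp only [lintegral_const, one_mul, measure_univ] at h3 h4
  rw [h1, h2, h3]
  -- The normalization `h4` is a factorization of 1; inserting it lets the angular and radial
  -- factors be regrouped.
  calc z * ((∫⁻ x, u x ∂S) * ∫⁻ t, k t ∂P)
      = 1 * (z * ((∫⁻ x, u x ∂S) * ∫⁻ t, k t ∂P)) := (one_mul _).symm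
    _ = _ := by rw [h4]; ring

/-- The density of a translate of the standard Gaussian measure. -/
lemma stdGaussian_translate (f : V) {A : Set V} (hA : MeasurableSet A) :
    stdGaussian V {x | x - f ∈ A} =
      ∫⁻ x in A, ENNReal.ofReal (Real.exp (-⟪f, x⟫ - ‖f‖ ^ 2 / 2)) ∂stdGaussian V := by
  obtain ⟨z, -, hz⟩ := lintegral_stdGaussian (V := V)
  have hA' : MeasurableSet {x | x - f ∈ A} := (measurable_id.sub_const f) hA
  have hw : Measurable fun x : V => ENNReal.ofReal (Real.exp (-⟪f, x⟫ - ‖f‖ ^ 2 / 2)) := by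
    fun_prop
  rw [← lintegral_indicator_one hA', hz _ (measurable_one.indicator hA'),
    ← lintegral_indicator hA, hz _ (hw.indicator hA)]
  congr 1
  rw [← lintegral_add_right_eq_self _ f]
  refine lintegral_congr fun x => ?_
  by_cases hx : x ∈ A
  · have h1 : x + f ∈ {x | x - f ∈ A} := by simpa using hx
    rw [Set.indicator_of_mem h1, Set.indicator_of_mem hx, Pi.one_apply, one_mul, gaussKernel,
      gaussKernel, ← ENNReal.ofReal_mul (Real.exp_pos _).le, ← Real.exp_add]
    congr 2
    rw [norm_add_sq_real, real_inner_comm]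
    ring
  · have h1 : x + f ∉ {x | x - f ∈ A} := by simpa using hx
    rw [Set.indicator_of_notMem h1, Set.indicator_of_notMem hx, zero_mul, zero_mul]

/-- Conditionally on a translated cone that points away from the origin, the distance to the apex
is stochastically dominated by the norm of a standard Gaussian vector. -/
theorem stdGaussian_cone_le [Nontrivial V] {C : Set V} (hC : MeasurableSet C)
    (hcone : ∀ r ∈ C, ∀ t : ℝ, 0 < t → t • r ∈ C) (f : V) (hf : ∀ r ∈ C, 0 ≤ ⟪f, r⟫) {ρ : ℝ}
    (hρ : 0 < ρ) :
    stdGaussian V {x | x - f ∈ C ∧ ρ ≤ ‖x - f‖} ≤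
      stdGaussian V {x | ρ ≤ ‖x‖} * stdGaussian V {x | x - f ∈ C} := by
  set γ := stdGaussian V with hγ
  set N : Set V := {x | ρ ≤ ‖x‖} with hN
  have hNm : MeasurableSet N := measurableSet_le measurable_const measurable_norm
  set w : V → ℝ≥0∞ := fun x => ENNReal.ofReal (Real.exp (-⟪f, x⟫ - ‖f‖ ^ 2 / 2)) with hw
  have hwm : Measurable w := by rw [hw]; fun_prop
  -- The translated density carries the weight `w`, decreasing along rays of `C`. Freezing it at
  -- radius `ρ` gives a function of direction alone, below `w` inside radius `ρ` and above it
  -- outside.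
  set u : V → ℝ≥0∞ := C.indicator fun x => w ((ρ / ‖x‖) • x) with hu
  have hum : Measurable u := (hwm.comp (by fun_prop)).indicator hC
  have hut : ∀ (x : V) (t : ℝ), 0 < t → u (t • x) = u x := by
    intro x t ht
    have h1 : t • x ∈ C ↔ x ∈ C := by
      refine ⟨fun h => ?_, fun h => hcone x h t ht⟩
      have := hcone _ h t⁻¹ (inv_pos.mpr ht)
      rwa [inv_smul_smul₀ ht.ne'] at this
    have h2 : (ρ / ‖t • x‖) • t • x = (ρ / ‖x‖) • x := by
      rw [norm_smul, Real.norm_eq_abs, abs_of_pos ht, smul_smul]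
      congr 1
      by_cases hx : ‖x‖ = 0
      · simp [hx]
      · field_simp
    by_cases hx : x ∈ C
    · rw [hu, Set.indicator_of_mem (h1.mpr hx), Set.indicator_of_mem hx, h2]
    · rw [hu, Set.indicator_of_notMem (fun h => hx (h1.mp h)), Set.indicator_of_notMem hx]
  have hsplit : {x | x - f ∈ C ∧ ρ ≤ ‖x - f‖} = {x | x - f ∈ C ∩ N} := rfl
  rw [hsplit, hγ, stdGaussian_translate f (hC.inter hNm), stdGaussian_translate f hC, ← hγ]
  have hq := lintegral_homogeneous hum hut ρ
  rw [← hγ] at hq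
  set H := ∫⁻ x, u x ∂γ with hH
  set q := γ N with hq'
  -- comparison of the weight with its value at distance `ρ`
  have hX : ∫⁻ x in C ∩ N, w x ∂γ ≤ q * H := by
    rw [← hq, ← lintegral_indicator (hC.inter hNm), ← lintegral_indicator hNm]
    refine lintegral_mono fun x => ?_
    by_cases hx : x ∈ C ∩ N
    · rw [Set.indicator_of_mem hx, Set.indicator_of_mem hx.2, hu, Set.indicator_of_mem hx.1]
      refine ENNReal.ofReal_le_ofReal (Real.exp_le_exp.mpr ?_)
      have h1 : ρ ≤ ‖x‖ := hx.2
      have h2 : ρ / ‖x‖ ≤ 1 := div_le_one_of_le₀ h1 (norm_nonneg _)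
      rw [inner_smul_right]
      have := mul_le_mul_of_nonneg_right h2 (hf x hx.1)
      linarith
    · rw [Set.indicator_of_notMem hx]
      exact zero_le
  have hY : H ≤ ∫⁻ x in C \ N, w x ∂γ + q * H := by
    rw [← hq, ← lintegral_indicator (hC.diff hNm), ← lintegral_indicator hNm,
      ← lintegral_add_left (hwm.indicator (hC.diff hNm))]
    refine lintegral_mono fun x => ?_
    by_cases hxN : x ∈ N
    · rw [Set.indicator_of_mem hxN]
      exact le_add_self
    · by_cases hxC : x ∈ C
      · rw [Set.indicator_of_mem (show x ∈ C \ N from ⟨hxC, hxN⟩), Set.indicator_of_notMem hxN, add_zero, hu,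
          Set.indicator_of_mem hxC]
        refine ENNReal.ofReal_le_ofReal (Real.exp_le_exp.mpr ?_)
        have h1 : ‖x‖ < ρ := not_le.mp hxN
        rw [inner_smul_right]
        by_cases hx0 : ‖x‖ = 0
        · have : x = 0 := norm_eq_zero.mp hx0
          simp [this]
        · have h2 : 1 ≤ ρ / ‖x‖ := by
            rw [le_div_iff₀ (lt_of_le_of_ne (norm_nonneg _) (Ne.symm hx0))]
            linarith
          have := mul_le_mul_of_nonneg_right h2 (hf x hxC)
          linarith
      · rw [hu, Set.indicator_of_notMem hxC]
        exact zero_le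
  have hsum : ∫⁻ x in C, w x ∂γ = ∫⁻ x in C ∩ N, w x ∂γ + ∫⁻ x in C \ N, w x ∂γ :=
    (lintegral_inter_add_sdiff w C hNm).symm
  rw [hsum]
  set X := ∫⁻ x in C ∩ N, w x ∂γ
  set Y := ∫⁻ x in C \ N, w x ∂γ
  have hw1 : ∀ x ∈ C, w x ≤ 1 := fun x hx => by
    rw [← ENNReal.ofReal_one]
    refine ENNReal.ofReal_le_ofReal (Real.exp_le_one_iff.mpr ?_)
    have := hf x hx
    have := sq_nonneg ‖f‖
    linarith
  have hbound : ∀ A : Set V, A ⊆ C → MeasurableSet A → ∫⁻ x in A, w x ∂γ ≠ ∞ := by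
    intro A hAC hA
    have h1 : ∫⁻ x in A, w x ∂γ ≤ ∫⁻ x in A, 1 ∂γ :=
      setLIntegral_mono measurable_const fun x hx => hw1 x (hAC hx)
    rw [setLIntegral_one] at h1
    exact (h1.trans_lt (measure_lt_top _ _)).ne
  have hXf : X ≠ ∞ := hbound _ Set.inter_subset_left (hC.inter hNm)
  have hYf : Y ≠ ∞ := hbound _ Set.sdiff_subset (hC.diff hNm)
  have hqf : q ≠ ∞ := measure_ne_top _ _
  have hq1 : q ≤ 1 := prob_le_one
  have hHf : H ≠ ∞ := by
    have h1 : H ≤ ∫⁻ _, 1 ∂γ := lintegral_mono fun x => by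
      by_cases hx : x ∈ C
      · rw [hu, Set.indicator_of_mem hx]
        by_cases hx0 : ‖x‖ = 0
        · rw [hx0, div_zero, zero_smul]
          rw [← ENNReal.ofReal_one]
          refine ENNReal.ofReal_le_ofReal (Real.exp_le_one_iff.mpr ?_)
          rw [inner_zero_right]
          have := sq_nonneg ‖f‖
          linarith
        · exact hw1 _ (hcone x hx _ (div_pos hρ (lt_of_le_of_ne (norm_nonneg _) (Ne.symm hx0))))
      · rw [hu, Set.indicator_of_notMem hx]
        exact zero_le
    simp only [lintegral_const, measure_univ, mul_one] at h1
    exact (h1.trans_lt ENNReal.one_lt_top).ne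
  rw [← ENNReal.toReal_le_toReal hXf (ENNReal.mul_ne_top hqf (ENNReal.add_ne_top.mpr ⟨hXf, hYf⟩)),
    ENNReal.toReal_mul, ENNReal.toReal_add hXf hYf]
  have hX' := ENNReal.toReal_mono (ENNReal.mul_ne_top hqf hHf) hX
  have hY' := ENNReal.toReal_mono (ENNReal.add_ne_top.mpr ⟨hYf, ENNReal.mul_ne_top hqf hHf⟩) hY
  rw [ENNReal.toReal_add hYf (ENNReal.mul_ne_top hqf hHf)] at hY'
  rw [ENNReal.toReal_mul] at hX' hY'
  have hq1' : q.toReal ≤ 1 := by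
    rw [← ENNReal.toReal_one]; exact ENNReal.toReal_mono ENNReal.one_ne_top hq1
  have hq0 : 0 ≤ q.toReal := ENNReal.toReal_nonneg
  -- From X ≤ qH and (1 - q)H ≤ Y follows (1 - q)X ≤ q(1 - q)H ≤ qY, that is, X ≤ q(X + Y).
  nlinarith [mul_le_mul_of_nonneg_left hX' (sub_nonneg.mpr hq1'),
    mul_le_mul_of_nonneg_left hY' hq0]

end GaussianCone

/-! ### The chi-squared distribution and its quantiles -/

section ChiSq

open scoped RealInnerProductSpace ENNReal

lemma measurable_sum_sq (s : ℕ) : Measurable fun z : Fin s → ℝ => ∑ i, z i ^ 2 := by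
  fun_prop

instance (s : ℕ) : IsProbabilityMeasure (chiSq s) :=
  Measure.isProbabilityMeasure_map (measurable_sum_sq s).aemeasurable

/-- The squared norm of a standard Gaussian vector is chi-squared distributed. -/
lemma stdGaussian_norm_sq (V : Type*) [NormedAddCommGroup V] [InnerProductSpace ℝ V]
    [FiniteDimensional ℝ V] [MeasurableSpace V] [BorelSpace V] {A : Set ℝ}
    (hA : MeasurableSet A) :
    stdGaussian V {x | ‖x‖ ^ 2 ∈ A} = chiSq (Module.finrank ℝ V) A := by
  have hm : MeasurableSet {x : V | ‖x‖ ^ 2 ∈ A} := (by fun_prop : Measurable fun x : V => ‖x‖ ^ 2) hA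
  rw [stdGaussian, chiSq, Measure.map_apply (by fun_prop) hm,
    Measure.map_apply (measurable_sum_sq _) hA]
  congr 1
  ext x
  have h1 : ‖∑ i, x i • stdOrthonormalBasis ℝ V i‖ ^ 2 = ∑ i, x i ^ 2 := by
    rw [← (stdOrthonormalBasis ℝ V).sum_sq_inner_right]
    refine Finset.sum_congr rfl fun i _ => ?_
    rw [Orthonormal.inner_right_fintype (stdOrthonormalBasis ℝ V).orthonormal]
  simp only [Set.mem_preimage, Set.mem_ofPred_eq, h1]

/-- A level set of the squared norm is contained in a sphere, which is Lebesgue null in positive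
dimension. At `s = 0` there is an atom, hence `1 ≤ s`. -/
lemma chiSq_singleton {s : ℕ} (hs : 1 ≤ s) (c : ℝ) : chiSq s {c} = 0 := by
  have h0 := stdGaussian_norm_sq (EuclideanSpace ℝ (Fin s)) (measurableSet_singleton c)
  rw [finrank_euclideanSpace_fin] at h0
  rw [← h0]
  have : NeZero s := ⟨by omega⟩
  obtain ⟨z, -, hz⟩ := exists_stdGaussian_eq (EuclideanSpace ℝ (Fin s))
  rw [hz, Measure.smul_apply, smul_eq_mul, mul_eq_zero]
  right
  refine withDensity_absolutelyContinuous _ _ ?_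
  refine measure_mono_null (t := Metric.sphere 0 (√c)) (fun x hx => ?_)
    (Measure.addHaar_sphere _ _ _)
  have hx' : ‖x‖ ^ 2 = c := hx
  rw [mem_sphere_zero_iff_norm, ← hx', Real.sqrt_sq (norm_nonneg _)]

lemma chiSq_Iic_of_neg {s : ℕ} {x : ℝ} (hx : x < 0) : chiSq s (Set.Iic x) = 0 := by
  rw [chiSq, Measure.map_apply (measurable_sum_sq s) measurableSet_Iic]
  have : (fun z : Fin s → ℝ => ∑ i, z i ^ 2) ⁻¹' Set.Iic x = ∅ := by
    ext z
    simp only [Set.mem_preimage, Set.mem_Iic, Set.mem_empty_iff_false, iff_false, not_le]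
    exact hx.trans_le (Finset.sum_nonneg fun i _ => sq_nonneg _)
  rw [this, measure_empty]

/-- Dropping one square from the sum only decreases it. -/
lemma chiSq_succ_Iic_le (s : ℕ) (x : ℝ) : chiSq (s + 1) (Set.Iic x) ≤ chiSq s (Set.Iic x) := by
  have hmp : MeasurePreserving (fun z : Fin (s + 1) → ℝ => fun i : Fin s => z i.succ)
      (Measure.pi fun _ => gaussianReal 0 1) (Measure.pi fun _ => gaussianReal 0 1) := by
    have h1 := measurePreserving_piFinSuccAbove (fun _ : Fin (s + 1) => gaussianReal 0 1) 0
    exact measurePreserving_snd.comp h1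
  rw [chiSq, chiSq, Measure.map_apply (measurable_sum_sq _) measurableSet_Iic,
    Measure.map_apply (measurable_sum_sq _) measurableSet_Iic,
    ← hmp.measure_preimage ((measurable_sum_sq s) measurableSet_Iic).nullMeasurableSet]
  refine measure_mono fun z hz => ?_
  simp only [Set.mem_preimage, Set.mem_Iic, Fin.sum_univ_succ] at hz ⊢
  have := sq_nonneg (z 0)
  linarith

variable {α : ℝ}

lemma cv_set_nonneg (hα1 : α < 1) {s : ℕ} {x : ℝ} (hx : 1 - α ≤ cdf (chiSq s) x) : 0 ≤ x := by
  by_contra! h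
  rw [cdf_eq_real, measureReal_def, chiSq_Iic_of_neg h, ENNReal.toReal_zero] at hx
  linarith

lemma cv_set_nonempty (hα0 : 0 < α) (s : ℕ) : {x | 1 - α ≤ cdf (chiSq s) x}.Nonempty := by
  obtain ⟨x, hx⟩ := ((tendsto_cdf_atTop (chiSq s)).eventually
    (lt_mem_nhds (by linarith : 1 - α < 1))).exists
  exact ⟨x, hx.le⟩

lemma cv_set_bddBelow (hα1 : α < 1) (s : ℕ) : BddBelow {x | 1 - α ≤ cdf (chiSq s) x} :=
  ⟨0, fun _ hx => cv_set_nonneg hα1 hx⟩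

lemma cv_nonneg (hα1 : α < 1) (s : ℕ) : 0 ≤ cv s α :=
  Real.sInf_nonneg fun _ hx => cv_set_nonneg hα1 hx

/-- Right continuity of the distribution function: the infimum defining the quantile is attained. -/
lemma le_cdf_cv (hα0 : 0 < α) (s : ℕ) : 1 - α ≤ cdf (chiSq s) (cv s α) := by
  have hright : Tendsto (cdf (chiSq s)) (𝓝[>] (cv s α)) (𝓝 (cdf (chiSq s) (cv s α))) :=
    ((cdf (chiSq s)).right_continuous (cv s α)).tendsto.mono_left
      (nhdsWithin_mono _ Set.Ioi_subset_Ici_self)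
  refine ge_of_tendsto hright ?_
  filter_upwards [self_mem_nhdsWithin] with x hx
  obtain ⟨y, hy, hyx⟩ := exists_lt_of_csInf_lt (cv_set_nonempty hα0 s) hx
  exact le_trans hy (monotone_cdf _ hyx.le)

lemma cv_pos (hα0 : 0 < α) (hα1 : α < 1) {s : ℕ} (hs : 1 ≤ s) : 0 < cv s α := by
  refine lt_of_le_of_ne (cv_nonneg hα1 s) fun h => ?_
  have h1 := le_cdf_cv hα0 s
  rw [← h, cdf_eq_real, measureReal_def] at h1
  have h2 : chiSq s (Set.Iic 0) = 0 := by
    have h3 : chiSq s (Set.Iio 0) = 0 := by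
      rw [chiSq, Measure.map_apply (measurable_sum_sq s) measurableSet_Iio]
      have : (fun z : Fin s → ℝ => ∑ i, z i ^ 2) ⁻¹' Set.Iio 0 = ∅ := by
        ext z
        simp only [Set.mem_preimage, Set.mem_Iio, Set.mem_empty_iff_false, iff_false, not_lt]
        exact Finset.sum_nonneg fun i _ => sq_nonneg _
      rw [this, measure_empty]
    rw [← Set.Iio_union_right]
    exact measure_union_null h3 (chiSq_singleton hs 0)
  rw [h2, ENNReal.toReal_zero] at h1
  linarith

lemma cv_mono (hα0 : 0 < α) (hα1 : α < 1) : Monotone fun s => cv s α := by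
  refine monotone_nat_of_le_succ fun s => ?_
  refine csInf_le_csInf (cv_set_bddBelow hα1 s) (cv_set_nonempty hα0 (s + 1)) fun x hx => ?_
  refine le_trans (show 1 - α ≤ _ from hx) ?_
  rw [cdf_eq_real, cdf_eq_real]
  exact ENNReal.toReal_mono (measure_ne_top _ _) (chiSq_succ_Iic_le s x)

/-- The absence of atoms makes the closed tail as small as the open one. Passing to limits of
rejecting samples weakens strict inequalities, and this is why nothing is lost. -/
lemma chiSq_Ici_cv_le (hα0 : 0 < α) {s : ℕ} (hs : 1 ≤ s) :
    chiSq s (Set.Ici (cv s α)) ≤ ENNReal.ofReal α := by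
  have h1 : (chiSq s).real (Set.Iio (cv s α)) = (chiSq s).real (Set.Iic (cv s α)) := by
    have h2 : chiSq s (Set.Iic (cv s α)) = chiSq s (Set.Iio (cv s α)) := by
      refine le_antisymm ?_ (measure_mono Set.Iio_subset_Iic_self)
      rw [← Set.Iio_union_right]
      refine (measure_union_le _ _).trans ?_
      rw [chiSq_singleton hs, add_zero]
    rw [measureReal_def, measureReal_def, h2]
  have h3 := le_cdf_cv hα0 s
  rw [cdf_eq_real, ← h1] at h3
  have h4 : (chiSq s).real (Set.Ici (cv s α)) = 1 - (chiSq s).real (Set.Iio (cv s α)) := by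
    rw [← Set.compl_Iio, probReal_compl_eq_one_sub measurableSet_Iio]
  rw [← ENNReal.ofReal_toReal (measure_ne_top (chiSq s) (Set.Ici (cv s α)))]
  refine ENNReal.ofReal_le_ofReal ?_
  rw [← measureReal_def, h4]
  linarith

/-- The tail of the norm of a standard Gaussian vector. -/
lemma stdGaussian_tail_le (V : Type*) [NormedAddCommGroup V] [InnerProductSpace ℝ V]
    [FiniteDimensional ℝ V] [MeasurableSpace V] [BorelSpace V] [Nontrivial V]
    (hα0 : 0 < α) :
    stdGaussian V {x | √(cv (Module.finrank ℝ V) α) ≤ ‖x‖} ≤ ENNReal.ofReal α := by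
  refine le_trans (measure_mono fun x hx => ?_) ((stdGaussian_norm_sq V measurableSet_Ici).trans_le
    (chiSq_Ici_cv_le hα0 (Module.finrank_pos (R := ℝ) (M := V))))
  have hx' : √(cv (Module.finrank ℝ V) α) ≤ ‖x‖ := hx
  exact (Real.sqrt_le_left (norm_nonneg _)).mp hx'

end ChiSq

/-! ### The rejection probability in the limit experiment -/

section Region

open scoped RealInnerProductSpace ENNReal

variable {V : Type*} [NormedAddCommGroup V] [InnerProductSpace ℝ V] [FiniteDimensional ℝ V]
  [MeasurableSpace V] [BorelSpace V]

/-- Independence of the components of a standard Gaussian vector in orthogonal subspaces. -/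
lemma map_add_prod_stdGaussian (W : Submodule ℝ V) :
    ((stdGaussian W).prod (stdGaussian Wᗮ)).map (fun p => (p.1 : V) + (p.2 : V)) =
      stdGaussian V := by
  have hm : Measurable fun p : W × Wᗮ => (p.1 : V) + (p.2 : V) := by fun_prop
  have : IsProbabilityMeasure
      (((stdGaussian W).prod (stdGaussian Wᗮ)).map (fun p => (p.1 : V) + (p.2 : V))) :=
    Measure.isProbabilityMeasure_map hm.aemeasurable
  refine Measure.ext_of_charFun (funext fun t => ?_)
  rw [charFun_apply, integral_map hm.aemeasurable (by fun_prop)]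
  have h1 : ∀ p : W × Wᗮ, Complex.exp (⟪(p.1 : V) + (p.2 : V), t⟫ * Complex.I) =
      Complex.exp (⟪p.1, W.orthogonalProjectionOnto t⟫ * Complex.I) *
        Complex.exp (⟪p.2, Wᗮ.orthogonalProjectionOnto t⟫ * Complex.I) := by
    intro p
    rw [← Complex.exp_add, inner_add_left, Submodule.inner_orthogonalProjectionOnto_eq_of_mem_left,
      Submodule.inner_orthogonalProjectionOnto_eq_of_mem_left]
    congr 1
    push_cast
    ring
  simp only [h1]
  rw [integral_prod_mul (fun a : W => Complex.exp (⟪a, W.orthogonalProjectionOnto t⟫ * Complex.I))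
    (fun b : Wᗮ => Complex.exp (⟪b, Wᗮ.orthogonalProjectionOnto t⟫ * Complex.I)), ← charFun_apply,
    ← charFun_apply, charFun_stdGaussian, charFun_stdGaussian, charFun_stdGaussian,
    ← Complex.exp_add]
  congr 1
  have h2 := Submodule.norm_sq_eq_add_norm_sq_projection t W
  have h3 : (‖t‖ : ℂ) ^ 2 = (‖W.orthogonalProjectionOnto t‖ : ℂ) ^ 2 +
      (‖Wᗮ.orthogonalProjectionOnto t‖ : ℂ) ^ 2 := by
    exact_mod_cast h2
  rw [h3]
  ring

/-- A set whose slices parallel to `W` are translated cones that point away from the origin has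
conditional rejection probability at most `α`. -/
theorem stdGaussian_slice_le {α : ℝ} (hα0 : 0 < α) (hα1 : α < 1) (W : Submodule ℝ V) (f : W)
    {S : Set V} (hS : MeasurableSet S)
    (hcone : ∀ (r : W), ∀ b ∈ Wᗮ, (r : V) + f + b ∈ S →
      0 ≤ ⟪f, r⟫ ∧ ∀ t : ℝ, 0 < t → t • (r : V) + f + b ∈ S) :
    stdGaussian V {z | z ∈ S ∧ W.orthogonalProjectionOnto z - f ≠ 0 ∧
      cv (Module.finrank ℝ W) α ≤ ‖W.orthogonalProjectionOnto z - f‖ ^ 2} ≤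
      ENNReal.ofReal α * stdGaussian V S := by
  -- In dimension 0 the critical value may be 0, but a nonzero residual is then impossible.
  rcases subsingleton_or_nontrivial W with hW | hW
  · have : {z | z ∈ S ∧ W.orthogonalProjectionOnto z - f ≠ 0 ∧
      cv (Module.finrank ℝ W) α ≤ ‖W.orthogonalProjectionOnto z - f‖ ^ 2} = ∅ := by
      ext z
      simp only [Set.mem_ofPred_eq, Set.mem_empty_iff_false, iff_false, not_and]
      exact fun _ h => absurd (Subsingleton.elim _ _) h
    rw [this, measure_empty]
    exact zero_le
  have hcpos : 0 < cv (Module.finrank ℝ W) α :=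
    cv_pos hα0 hα1 (Module.finrank_pos (R := ℝ) (M := W))
  set ρ := √(cv (Module.finrank ℝ W) α) with hρ
  have hρpos : 0 < ρ := Real.sqrt_pos.mpr hcpos
  set S' : Set V := {z | z ∈ S ∧ ρ ≤ ‖W.orthogonalProjectionOnto z - f‖} with hS'
  have hproj : Continuous fun z : V => W.orthogonalProjectionOnto z - f :=
    (W.orthogonalProjectionOnto).continuous.sub continuous_const
  have hS'm : MeasurableSet S' :=
    hS.inter (measurableSet_le measurable_const hproj.norm.measurable)
  refine (measure_mono (t := S') fun z hz => ⟨hz.1, ?_⟩).trans ?_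
  · rw [hρ, Real.sqrt_le_left (norm_nonneg _)]
    exact hz.2.2
  have hm : Measurable fun p : W × Wᗮ => (p.1 : V) + (p.2 : V) := by fun_prop
  rw [← map_add_prod_stdGaussian W, Measure.map_apply hm hS'm, Measure.map_apply hm hS,
    Measure.prod_apply_symm (hm hS'm), Measure.prod_apply_symm (hm hS),
    ← lintegral_const_mul _ (measurable_measure_prodMk_right (hm hS))]
  -- Condition on the component in the orthogonal complement: each slice is a cone translated by
  -- `f`, to which the domination of the distance from the apex applies.
  refine lintegral_mono fun b => ?_
  set C : Set W := {r | (r : V) + f + b ∈ S} with hC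
  have hCm : MeasurableSet C := (by fun_prop : Measurable fun r : W => (r : V) + f + b) hS
  have h1 := stdGaussian_cone_le hCm (fun r hr t ht => by
      have := (hcone r b b.2 hr).2 t ht
      simpa [hC] using this) f (fun r hr => (hcone r b b.2 hr).1) hρpos
  have e1 : (fun a : W => (a, b)) ⁻¹' ((fun p : W × Wᗮ => (p.1 : V) + (p.2 : V)) ⁻¹' S') =
      {x | x - f ∈ C ∧ ρ ≤ ‖x - f‖} := by
    ext a
    have h2 : W.orthogonalProjectionOnto ((a : V) + (b : V)) = a := by
      rw [map_add, Submodule.orthogonalProjectionOnto_mem_subspace_eq_self,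
        Submodule.orthogonalProjectionOnto_apply_of_mem_orthogonal b.2, add_zero]
    simp only [Set.mem_preimage, hS', hC, Set.mem_ofPred_eq, h2]
    simp
  have e2 : (fun a : W => (a, b)) ⁻¹' ((fun p : W × Wᗮ => (p.1 : V) + (p.2 : V)) ⁻¹' S) =
      {x | x - f ∈ C} := by
    ext a
    simp [hC]
  rw [e1, e2]
  exact h1.trans (mul_le_mul_left (stdGaussian_tail_le W hα0) _)

/-- The limit experiment: `P` contains the projections, `C i` the residuals, which span subspaces
`W i`. -/
theorem stdGaussian_region_le {α : ℝ} (hα0 : 0 < α) (hα1 : α < 1) {ι : Type*} [Finite ι]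
    {P : Set V} (hP : IsClosed P) (h0 : (0 : V) ∈ P) (W : ι → Submodule ℝ V) (f : ∀ i, W i)
    {C : ι → Set V} (hC : ∀ i, IsClosed (C i)) (hCW : ∀ i, C i ⊆ W i)
    (hcone : ∀ i, ∀ r ∈ C i, ∀ t : ℝ, 0 < t → t • r ∈ C i)
    (hnorm : ∀ i, ∀ p ∈ P, ∀ r ∈ C i, ⟪r, p⟫ ≤ ⟪r, (f i : V)⟫) :
    stdGaussian V {z | ∃ i, ∃ p ∈ P, ∃ r ∈ C i, (W i).orthogonalProjectionOnto p = f i ∧ z = p + r ∧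
      r ≠ 0 ∧ cv (Module.finrank ℝ (W i)) α ≤ ‖r‖ ^ 2} ≤ ENNReal.ofReal α := by
  classical
  have := Fintype.ofFinite ι
  -- the set of points with a decomposition of type `i`
  set D : ι → Set V := fun i => {z | ∃ p ∈ P, ∃ r ∈ C i, (W i).orthogonalProjectionOnto p = f i ∧
    z = p + r} with hD
  have hprojr : ∀ i, ∀ p r : V, r ∈ C i → (W i).orthogonalProjectionOnto p = f i →
      ((W i).orthogonalProjectionOnto (p + r) - f i : V) = r := by
    intro i p r hr hp
    rw [map_add, hp, Submodule.coe_add]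
    have := (W i).orthogonalProjectionOnto_mem_subspace_eq_self ⟨r, hCW i hr⟩
    rw [this]
    simp
  have hDm : ∀ i, MeasurableSet (D i) := by
    intro i
    have hcont : Continuous fun z : V => ((W i).orthogonalProjectionOnto z - f i : V) := by fun_prop
    have : D i = (fun z : V => z - ((W i).orthogonalProjectionOnto z - f i : V)) ⁻¹' P ∩
        (fun z : V => ((W i).orthogonalProjectionOnto z - f i : V)) ⁻¹' C i := by
      ext z
      constructor
      · rintro ⟨p, hp, r, hr, hpf, rfl⟩
        have h1 := hprojr i p r hr hpf
        refine ⟨?_, ?_⟩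
        · simp only [Set.mem_preimage, h1, add_sub_cancel_right]
          exact hp
        · simp only [Set.mem_preimage, h1]
          exact hr
      · rintro ⟨h1, h2⟩
        refine ⟨_, h1, _, h2, ?_, (sub_add_cancel z _).symm⟩
        have h3 : (W i).orthogonalProjectionOnto (((W i).orthogonalProjectionOnto z - f i : W i) : V) =
            (W i).orthogonalProjectionOnto z - f i :=
          (W i).orthogonalProjectionOnto_mem_subspace_eq_self _
        rw [map_sub, ← Submodule.coe_sub, h3]
        abel
    rw [this]
    exact ((hP.preimage (continuous_id.sub hcont)).inter ((hC i).preimage hcont)).measurableSet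
  -- uniqueness of decompositions
  have huniq : ∀ i j, ∀ p ∈ P, ∀ r ∈ C i, ∀ p' ∈ P, ∀ r' ∈ C j,
      (W i).orthogonalProjectionOnto p = f i → (W j).orthogonalProjectionOnto p' = f j →
      p + r = p' + r' → p = p' ∧ r = r' := by
    intro i j p hp r hr p' hp' r' hr' hpf hpf' heq
    have e1 : ⟪r, p⟫ = ⟪r, (f i : V)⟫ := by
      rw [← hpf]
      exact ((W i).inner_orthogonalProjectionOnto_eq_of_mem_left ⟨r, hCW i hr⟩ p).symm
    have e2 : ⟪r', p'⟫ = ⟪r', (f j : V)⟫ := by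
      rw [← hpf']
      exact ((W j).inner_orthogonalProjectionOnto_eq_of_mem_left ⟨r', hCW j hr'⟩ p').symm
    have h1 := hnorm i p' hp' r hr
    have h2 := hnorm j p hp r' hr'
    have h3 : r - r' = p' - p := by
      rw [sub_eq_sub_iff_add_eq_add, add_comm r p, heq]
    -- Monotonicity of normal cones: `r` and `r'` are outward normals at `p` and `p'`, and `r - r' =
    -- p' - p`.
    have h4 : ⟪p' - p, p' - p⟫ ≤ 0 := by
      have : ⟪p' - p, p' - p⟫ = ⟪r - r', p' - p⟫ := by rw [h3]
      rw [this, inner_sub_left, inner_sub_right, inner_sub_right]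
      linarith
    have h5 : p' - p = 0 := real_inner_self_nonpos.mp h4
    exact ⟨(sub_eq_zero.mp h5).symm, sub_eq_zero.mp (h3.trans h5)⟩
  -- order the types by dimension
  set key : ι → ℕ ×ₗ ℕ := fun i =>
    toLex (Module.finrank ℝ (W i), (Fintype.equivFin ι i : ℕ)) with hkey
  have hkinj : Function.Injective key := by
    intro i j h
    have h1 := (Prod.ext_iff.mp (toLex.injective h)).2
    exact (Fintype.equivFin ι).injective (Fin.ext h1)
  have hkdim : ∀ i j, key i ≤ key j → Module.finrank ℝ (W i) ≤ Module.finrank ℝ (W j) := by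
    intro i j h
    rcases (Prod.Lex.le_iff).mp h with h | h
    · exact h.le
    · exact h.1.le
  -- Each decomposable point is kept only for its type of least key. The key is lexicographic, with
  -- dimension first and an arbitrary enumeration to break ties.
  set D' : ι → Set V := fun i => D i \ ⋃ j ∈ {j | key j < key i}, D j with hD'
  have hD'm : ∀ i, MeasurableSet (D' i) := fun i =>
    (hDm i).diff (MeasurableSet.biUnion (Set.to_countable _) fun j _ => hDm j)
  have hdisj : Pairwise (Function.onFun Disjoint D') := by
    intro i j hij
    rw [Function.onFun, Set.disjoint_left]
    intro z hz hz'
    rcases lt_or_gt_of_ne (hkinj.ne hij) with h | h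
    · exact hz'.2 (Set.mem_biUnion (show i ∈ {i | key i < key j} from h) hz.1)
    · exact hz.2 (Set.mem_biUnion (show j ∈ {j | key j < key i} from h) hz'.1)
  have hslice : ∀ i, stdGaussian V {z | z ∈ D' i ∧ (W i).orthogonalProjectionOnto z - f i ≠ 0 ∧
      cv (Module.finrank ℝ (W i)) α ≤ ‖(W i).orthogonalProjectionOnto z - f i‖ ^ 2} ≤
      ENNReal.ofReal α * stdGaussian V (D' i) := by
    intro i
    refine stdGaussian_slice_le hα0 hα1 (W i) (f i) (hD'm i) fun r b hb hz => ?_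
    obtain ⟨p, hp, r', hr', hpf, heq⟩ := hz.1
    have h1 := hprojr i p r' hr' hpf
    rw [← heq] at h1
    have h2 : (W i).orthogonalProjectionOnto ((r : V) + f i + b) = r + f i := by
      rw [map_add, map_add, Submodule.orthogonalProjectionOnto_mem_subspace_eq_self,
        Submodule.orthogonalProjectionOnto_mem_subspace_eq_self,
        Submodule.orthogonalProjectionOnto_apply_of_mem_orthogonal hb, add_zero]
    rw [h2, Submodule.coe_add, add_sub_cancel_right] at h1
    have hpb : p = f i + b := by
      have : p = (r : V) + f i + b - r' := by rw [heq]; abel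
      rw [this, ← h1]
      abel
    refine ⟨?_, fun t ht => ?_⟩
    -- The cone points away from the origin because the origin satisfies all the inequalities.
    · have h3 := hnorm i 0 h0 r' hr'
      rw [inner_zero_right, ← h1, real_inner_comm] at h3
      exact h3
    · have hmem : t • (r : V) + f i + b = p + t • r' := by rw [hpb, ← h1]; abel
      rw [hmem]
      refine ⟨⟨p, hp, t • r', hcone i r' hr' t ht, hpf, rfl⟩, fun hun => ?_⟩
      obtain ⟨j, hj, q, hq, s, hs, hqf, hqs⟩ := Set.mem_iUnion₂.mp hun
      obtain ⟨e1, e2⟩ := huniq i j p hp _ (hcone i r' hr' t ht) q hq s hs hpf hqf hqs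
      -- An earlier type of the rescaled point would, by uniqueness of the decomposition, be a type
      -- of the original point after undoing the scaling. So removing earlier types preserves the
      -- cone structure.
      refine hz.2 (Set.mem_biUnion hj ⟨q, hq, t⁻¹ • s, hcone j s hs _ (inv_pos.mpr ht), hqf, ?_⟩)
      rw [heq, ← e1, ← e2, inv_smul_smul₀ ht.ne']
  calc stdGaussian V {z | ∃ i, ∃ p ∈ P, ∃ r ∈ C i, (W i).orthogonalProjectionOnto p = f i ∧
        z = p + r ∧ r ≠ 0 ∧ cv (Module.finrank ℝ (W i)) α ≤ ‖r‖ ^ 2}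
      ≤ stdGaussian V (⋃ i, {z | z ∈ D' i ∧ (W i).orthogonalProjectionOnto z - f i ≠ 0 ∧
          cv (Module.finrank ℝ (W i)) α ≤ ‖(W i).orthogonalProjectionOnto z - f i‖ ^ 2}) := by
        refine measure_mono ?_
        rintro z ⟨i, p, hp, r, hr, hpf, rfl, hr0, hcr⟩
        obtain ⟨j, hj, hmin⟩ := Finset.exists_min_image
          (Finset.univ.filter fun j => p + r ∈ D j) key
          ⟨i, Finset.mem_filter.mpr ⟨Finset.mem_univ _, p, hp, r, hr, hpf, rfl⟩⟩
        have hjD := (Finset.mem_filter.mp hj).2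
        obtain ⟨p', hp', r', hr', hpf', heq⟩ := hjD
        obtain ⟨e1, e2⟩ := huniq i j p hp r hr p' hp' r' hr' hpf hpf' heq
        have h1 := hprojr j p' r' hr' hpf'
        rw [← heq, ← e2] at h1
        refine Set.mem_iUnion.mpr ⟨j, ⟨⟨p', hp', r', hr', hpf', heq⟩, fun hun => ?_⟩, fun h => ?_,
          ?_⟩
        · obtain ⟨k, hk, hkD⟩ := Set.mem_iUnion₂.mp hun
          exact absurd (hmin k (Finset.mem_filter.mpr ⟨Finset.mem_univ _, hkD⟩))
            (not_le.mpr hk)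
        · rw [← Submodule.coe_sub, h, Submodule.coe_zero] at h1
          exact hr0 h1.symm
        · rw [← Submodule.norm_coe, Submodule.coe_sub, h1]
          -- The chosen type has no larger dimension, hence no larger critical value, while the
          -- residual is the same.
          refine le_trans (cv_mono hα0 hα1 (hkdim j i (hmin i ?_))) hcr
          exact Finset.mem_filter.mpr ⟨Finset.mem_univ _, p, hp, r, hr, hpf, rfl⟩
    _ ≤ ∑ i, stdGaussian V {z | z ∈ D' i ∧ (W i).orthogonalProjectionOnto z - f i ≠ 0 ∧
          cv (Module.finrank ℝ (W i)) α ≤ ‖(W i).orthogonalProjectionOnto z - f i‖ ^ 2} :=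
        measure_iUnion_fintype_le _ _
    _ ≤ ∑ i, ENNReal.ofReal α * stdGaussian V (D' i) := Finset.sum_le_sum fun i _ => hslice i
    _ = ENNReal.ofReal α * stdGaussian V (⋃ i, D' i) := by
        rw [← Finset.mul_sum, measure_iUnion hdisj hD'm, tsum_fintype]
    _ ≤ ENNReal.ofReal α * 1 := mul_le_mul_right prob_le_one _
    _ = ENNReal.ofReal α := mul_one _

end Region

/-! ### The limit experiment -/

section GaussianMap

open scoped RealInnerProductSpace

/-- A linear image of a centered Gaussian vector with identity covariance is standard Gaussian. -/
theorem multivariateGaussian_map_eq_stdGaussian {ι κ : Type*} [Fintype ι] [DecidableEq ι]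
    [Fintype κ] [DecidableEq κ] {S : Matrix ι ι ℝ} (hS : S.PosSemidef) (G : Matrix κ ι ℝ)
    (hG : G * S * Gᵀ = 1) :
    (multivariateGaussian 0 S).map (fun x => WithLp.toLp 2 (G *ᵥ x.ofLp)) =
      stdGaussian (EuclideanSpace ℝ κ) := by
  have hc : Continuous fun x : EuclideanSpace ℝ ι => WithLp.toLp 2 (G *ᵥ x.ofLp) := by fun_prop
  have : IsFiniteMeasure ((multivariateGaussian 0 S).map
      (fun x => WithLp.toLp 2 (G *ᵥ x.ofLp))) := Measure.isFiniteMeasure_map _ _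
  refine Measure.ext_of_charFun ?_
  ext t
  rw [charFun_stdGaussian, charFun_apply, integral_map hc.aemeasurable (by fun_prop)]
  have h1 : ∀ x : EuclideanSpace ℝ ι, ⟪WithLp.toLp 2 (G *ᵥ x.ofLp), t⟫ =
      ⟪x, WithLp.toLp 2 (t.ofLp ᵥ* G)⟫ := by
    intro x
    rw [EuclideanSpace.inner_eq_star_dotProduct, EuclideanSpace.inner_eq_star_dotProduct]
    simp [Matrix.dotProduct_mulVec]
  simp only [h1]
  rw [← charFun_apply, charFun_multivariateGaussian hS]
  have h2 : (t.ofLp ᵥ* G) ⬝ᵥ S *ᵥ (t.ofLp ᵥ* G) = ‖t‖ ^ 2 := by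
    rw [← real_inner_self_eq_norm_sq, EuclideanSpace.inner_eq_star_dotProduct,
      ← Matrix.dotProduct_mulVec, ← Matrix.mulVec_transpose, Matrix.mulVec_mulVec,
      Matrix.mulVec_mulVec, hG, Matrix.one_mulVec]
    rfl
  simp only [h2, inner_zero_right]
  congr 1
  push_cast
  ring

end GaussianMap

/-! ### Factorization of the limit variance -/

section Factor

open scoped MatrixOrder Matrix.Norms.L2Operator

/-- The C⋆-algebra characterization of nonnegative elements supplies the factor, and a positive
determinant makes it invertible; it serves to whiten the limit experiment. -/
lemma exists_eq_transpose_mul_self {n : Type*} [Fintype n] [DecidableEq n] {M : Matrix n n ℝ}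
    (hM : M.PosDef) : ∃ A : Matrix n n ℝ, IsUnit A.det ∧ M = Aᵀ * A := by
  obtain ⟨A, hA⟩ := CStarAlgebra.nonneg_iff_eq_star_mul_self.mp hM.posSemidef.nonneg
  refine ⟨A, ?_, by rw [hA, Matrix.star_eq_conjTranspose, Matrix.conjTranspose_eq_transpose_of_trivial]⟩
  have h := hM.det_pos
  rw [hA, Matrix.det_mul] at h
  exact isUnit_iff_ne_zero.mpr (right_ne_zero_of_mul h.ne')

end Factor

/-! ### The rejection region, sorted by the support of the multiplier -/

section LimitExperiment

open scoped RealInnerProductSpace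

variable {dC dμ dδ : ℕ}

/-- The rejection region of the limit experiment: the observation `y` differs from its projection
on a polyhedral set by the image of the multiplier `l`, and the squared length of that
difference reaches the critical value. -/
def LimitReject (B : Matrix (Fin dC) (Fin dμ) ℝ) (C : Matrix (Fin dC) (Fin dδ) ℝ)
    (Sig : Matrix (Fin dμ) (Fin dμ) ℝ) (J : Set (Fin dC)) (σ : Fin dC → ℝ) (c : ℕ → ℝ)
    (y : Fin dμ → ℝ) : Prop :=
  ∃ l : Fin dC → ℝ, (∀ j, 0 ≤ l j) ∧ (∀ j, j ∉ J → l j = 0) ∧ l ᵥ* C = 0 ∧ l ᵥ* B ≠ 0 ∧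
    (∀ v : Fin dC → ℝ, (∀ j, 0 ≤ v j) → (∀ j, j ∉ J → v j = 0) → v ᵥ* C = 0 →
      (v ᵥ* B) ⬝ᵥ (y - Sig *ᵥ (l ᵥ* B)) ≤ v ⬝ᵥ σ) ∧
    (l ᵥ* B) ⬝ᵥ (y - Sig *ᵥ (l ᵥ* B)) = l ⬝ᵥ σ ∧
    c (Module.finrank ℝ (multSpace B C {j | l j ≠ 0})) ≤ (l ᵥ* B) ⬝ᵥ (Sig *ᵥ (l ᵥ* B))

/-- If a linear inequality over nonnegative multipliers is tight at `l`, it is tight for all signed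
multipliers with support in that of `l`. -/
lemma eq_of_tight {C : Matrix (Fin dC) (Fin dδ) ℝ} {J : Set (Fin dC)}
    (g h : (Fin dC → ℝ) →ₗ[ℝ] ℝ)
    (hgh : ∀ v : Fin dC → ℝ, (∀ j, 0 ≤ v j) → (∀ j, j ∉ J → v j = 0) → v ᵥ* C = 0 → g v ≤ h v)
    {l : Fin dC → ℝ} (hl : ∀ j, 0 ≤ l j) (hJ : ∀ j, j ∉ J → l j = 0) (hlC : l ᵥ* C = 0)
    (heq : g l = h l) {v : Fin dC → ℝ} (hv : ∀ j, j ∉ {j | l j ≠ 0} → v j = 0)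
    (hvC : v ᵥ* C = 0) : g v = h v := by
  have hv' : ∀ j, l j = 0 → v j = 0 := fun j hj => hv j (by simpa using hj)
  -- A small perturbation of `l` within its own support stays nonnegative. Since the inequality is
  -- tight at `l`, it holds for the direction `w`, and likewise for its negative.
  have key : ∀ w : Fin dC → ℝ, (∀ j, l j = 0 → w j = 0) → w ᵥ* C = 0 → g w ≤ h w := by
    intro w hw hwC
    have h1 : ∀ᶠ ε : ℝ in 𝓝[>] 0, ∀ j, 0 ≤ l j + ε * w j := by
      rw [eventually_all]
      intro j
      rcases (hl j).eq_or_lt with h0 | h0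
      · exact Eventually.of_forall fun ε => by simp [hw j h0.symm, ← h0]
      · have h2 : Tendsto (fun ε : ℝ => l j + ε * w j) (𝓝[>] 0) (𝓝 (l j + 0 * w j)) :=
          ((continuous_const.add (continuous_id.mul continuous_const)).tendsto 0).mono_left
            nhdsWithin_le_nhds
        rw [zero_mul, add_zero] at h2
        exact (h2.eventually_const_lt h0).mono fun _ h => h.le
    obtain ⟨ε, hε, hε0⟩ := (h1.and self_mem_nhdsWithin).exists
    have h3 := hgh (l + ε • w) hε (fun j hj => by simp [hJ j hj, hw j (hJ j hj)])
      (by rw [Matrix.add_vecMul, Matrix.smul_vecMul, hlC, hwC]; simp)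
    rw [map_add, map_add, map_smul, map_smul, heq] at h3
    have h4 : ε * g w ≤ ε * h w := by simpa using h3
    exact le_of_mul_le_mul_left h4 hε0
  refine le_antisymm (key v hv' hvC) ?_
  have h5 := key (-v) (fun j hj => by simp [hv' j hj]) (by rw [Matrix.neg_vecMul, hvC, neg_zero])
  rw [map_neg, map_neg] at h5
  linarith

/-- In the limit experiment, the rejection probability is at most `α`. -/
theorem stdGaussian_limitReject_le {α : ℝ} (hα0 : 0 < α) (hα1 : α < 1)
    (B : Matrix (Fin dC) (Fin dμ) ℝ) (C : Matrix (Fin dC) (Fin dδ) ℝ)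
    {A : Matrix (Fin dμ) (Fin dμ) ℝ} (hA : IsUnit A.det) {J : Set (Fin dC)} {σ : Fin dC → ℝ}
    (hσ : ∀ j ∈ J, 0 ≤ σ j) :
    stdGaussian (EuclideanSpace ℝ (Fin dμ))
      {z | LimitReject B C (Aᵀ * A) J σ (fun s => cv s α) (Aᵀ *ᵥ z.ofLp)} ≤ ENNReal.ofReal α := by
  classical
  set e : (Fin dμ → ℝ) →ₗ[ℝ] EuclideanSpace ℝ (Fin dμ) :=
    (WithLp.linearEquiv 2 ℝ (Fin dμ → ℝ)).symm.toLinearMap ∘ₗ A.mulVecLin with he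
  have he' : ∀ w, e w = WithLp.toLp 2 (A *ᵥ w) := fun w => rfl
  have heinj : Function.Injective e :=
    (WithLp.linearEquiv 2 ℝ (Fin dμ → ℝ)).symm.injective.comp
      (Matrix.mulVec_injective_of_isUnit ((Matrix.isUnit_iff_isUnit_det A).mpr hA))
  have hinner : ∀ (w : Fin dμ → ℝ) (p : EuclideanSpace ℝ (Fin dμ)), ⟪e w, p⟫ = w ⬝ᵥ (Aᵀ *ᵥ p.ofLp) := by
    intro w p
    rw [he', EuclideanSpace.inner_eq_star_dotProduct, star_trivial, Matrix.mulVec_transpose,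
      dotProduct_comm w, Matrix.dotProduct_mulVec]
  set gen : (Fin dC → ℝ) →ₗ[ℝ] EuclideanSpace ℝ (Fin dμ) := e ∘ₗ B.vecMulLinear with hgen
  have hgen' : ∀ v, gen v = e (v ᵥ* B) := fun v => rfl
  set P : Set (EuclideanSpace ℝ (Fin dμ)) := {p | ∀ v : Fin dC → ℝ, (∀ j, 0 ≤ v j) → (∀ j, j ∉ J → v j = 0) →
    v ᵥ* C = 0 → ⟪gen v, p⟫ ≤ v ⬝ᵥ σ} with hPdef
  have hP : IsClosed P := by
    have : P = ⋂ (v : Fin dC → ℝ) (_ : ∀ j, 0 ≤ v j) (_ : ∀ j, j ∉ J → v j = 0)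
      (_ : v ᵥ* C = 0), {p | ⟪gen v, p⟫ ≤ v ⬝ᵥ σ} := by
      ext p
      simp [hPdef]
    rw [this]
    exact isClosed_iInter fun v => isClosed_iInter fun _ => isClosed_iInter fun _ =>
      isClosed_iInter fun _ => isClosed_le (by fun_prop) continuous_const
  have h0P : (0 : EuclideanSpace ℝ (Fin dμ)) ∈ P := by
    intro v hv hJ _
    rw [inner_zero_right]
    refine Finset.sum_nonneg fun j _ => ?_
    by_cases hj : j ∈ J
    · exact mul_nonneg (hv j) (hσ j hj)
    · rw [hJ j hj, zero_mul]
  set tight : Set (Fin dC) → EuclideanSpace ℝ (Fin dμ) → Prop := fun S p =>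
    ∀ v : Fin dC → ℝ, (∀ j, j ∉ S → v j = 0) → v ᵥ* C = 0 → ⟪gen v, p⟫ = v ⬝ᵥ σ with htight
  -- Types are the supports at which all inequalities can be tight at once. Tightness at any one
  -- point `p₀ S` determines the common projection on `W S`.
  let ι := {S : Set (Fin dC) // S ⊆ J ∧ ∃ p ∈ P, tight S p}
  choose p₀ hp₀P hp₀ using fun S : ι => S.2.2
  set W : ι → Submodule ℝ (EuclideanSpace ℝ (Fin dμ)) := fun S => (multSpace B C S).map e with hW
  have hfin : ∀ S : ι, Module.finrank ℝ (W S) = Module.finrank ℝ (multSpace B C S.1) := fun S =>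
    LinearEquiv.finrank_eq (Submodule.equivMapOfInjective e heinj _).symm
  have hgenW : ∀ (S : ι) (v : Fin dC → ℝ), (∀ j, j ∉ S.1 → v j = 0) → v ᵥ* C = 0 →
      gen v ∈ W S := fun S v hv hvC => ⟨v ᵥ* B, ⟨v, hv, hvC, rfl⟩, rfl⟩
  set Cn : ι → Set (EuclideanSpace ℝ (Fin dμ)) := fun S => gen '' {v | v ∈ signCone S.1 ∅ ∧ v ᵥ* C = 0} with hCn
  have hCclosed : ∀ S, IsClosed (Cn S) := by
    intro S
    -- The constraint `v ᵥ* C = 0` is absorbed as a second block of columns; the cone is then the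
    -- section of a finitely generated cone where that block vanishes.
    have hcl := isClosed_image_signCone S.1 ∅ (Matrix.fromCols (B * Aᵀ) C)
    have hcont : Continuous fun p : EuclideanSpace ℝ (Fin dμ) => (Sum.elim (WithLp.ofLp p) 0 : Fin dμ ⊕ Fin dδ → ℝ) := by
      refine continuous_pi fun i => ?_
      rcases i with i | i
      · simp only [Sum.elim_inl]; fun_prop
      · simp only [Sum.elim_inr]; fun_prop
    have : Cn S = (fun p : EuclideanSpace ℝ (Fin dμ) => (Sum.elim (WithLp.ofLp p) 0 : Fin dμ ⊕ Fin dδ → ℝ)) ⁻¹'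
        ((fun l => l ᵥ* Matrix.fromCols (B * Aᵀ) C) '' signCone S.1 ∅) := by
      ext p
      have hg : ∀ v, gen v = WithLp.toLp 2 (v ᵥ* (B * Aᵀ)) := by
        intro v
        rw [hgen', he', ← Matrix.vecMul_vecMul, Matrix.vecMul_transpose]
      constructor
      · rintro ⟨v, ⟨hv, hvC⟩, rfl⟩
        refine ⟨v, hv, ?_⟩
        simp only [Matrix.vecMul_fromCols, hvC, hg]
      · rintro ⟨v, hv, hvp⟩
        simp only [Matrix.vecMul_fromCols] at hvp
        refine ⟨v, ⟨hv, funext fun i => congrFun hvp (Sum.inr i)⟩, ?_⟩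
        rw [hg]
        ext i
        exact congrFun hvp (Sum.inl i)
    rw [this]
    exact hcl.preimage hcont
  have hregion := stdGaussian_region_le hα0 hα1 hP h0P W
    (fun S => (W S).orthogonalProjectionOnto (p₀ S)) (C := Cn) hCclosed
    (by
      rintro S _ ⟨v, ⟨hv, hvC⟩, rfl⟩
      exact hgenW S v hv.1 hvC)
    (by
      rintro S _ ⟨v, ⟨hv, hvC⟩, rfl⟩ t ht
      exact ⟨t • v, ⟨signCone_smul hv ht.le, by rw [Matrix.smul_vecMul, hvC, smul_zero]⟩,
        map_smul _ _ _⟩)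
    (by
      rintro S p hp _ ⟨v, ⟨hv, hvC⟩, rfl⟩
      have h1 := (W S).inner_orthogonalProjectionOnto_eq_of_mem_left
        ⟨gen v, hgenW S v hv.1 hvC⟩ (p₀ S)
      refine (hp v (fun j => hv.2 j (by simp)) (fun j hj => hv.1 j fun h => hj (S.2.1 h)) hvC).trans
        (le_of_eq ?_)
      rw [← hp₀ S v hv.1 hvC]
      exact h1.symm)
  refine le_trans (measure_mono ?_) hregion
  rintro z ⟨l, hl, hlJ, hlC, hlB, hle, heq, hcv⟩
  set p : EuclideanSpace ℝ (Fin dμ) := z - gen l with hp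
  have hip : ∀ w : Fin dμ → ℝ, ⟪e w, p⟫ =
      w ⬝ᵥ (Aᵀ *ᵥ z.ofLp - (Aᵀ * A) *ᵥ (l ᵥ* B)) := by
    intro w
    rw [hinner, hp, WithLp.ofLp_sub, Matrix.mulVec_sub, hgen', he', Matrix.mulVec_mulVec]
  have hpP : p ∈ P := by
    intro v hv hJ hvC
    rw [hgen', hip]
    exact hle v hv hJ hvC
  have hpt : tight {j | l j ≠ 0} p := by
    intro v hv hvC
    have := eq_of_tight (C := C) (J := J) ((innerₛₗ ℝ p) ∘ₗ gen)
      (dotProductBilin ℝ ℝ σ) (fun v hv hJ hvC => ?_) hl hlJ hlC ?_ hv hvC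
    · simpa [real_inner_comm, dotProduct_comm] using this
    · simpa [real_inner_comm, dotProduct_comm] using hpP v hv hJ hvC
    · have h1 : ⟪gen l, p⟫ = l ⬝ᵥ σ := by rw [hgen', hip]; exact heq
      simpa [real_inner_comm, dotProduct_comm] using h1
  have hSJ : {j | l j ≠ 0} ⊆ J := fun j hj => by
    by_contra h
    exact hj (hlJ j h)
  refine ⟨⟨{j | l j ≠ 0}, hSJ, p, hpP, hpt⟩, p, hpP, gen l,
    ⟨l, ⟨⟨fun j hj => by simpa using hj, fun j _ => hl j⟩, hlC⟩, rfl⟩, ?_, ?_, ?_, ?_⟩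
  · set S : ι := ⟨{j | l j ≠ 0}, hSJ, p, hpP, hpt⟩
    rw [← sub_eq_zero, ← map_sub, Submodule.orthogonalProjectionOnto_apply_of_mem_orthogonal]
    rw [Submodule.mem_orthogonal]
    rintro _ ⟨_, ⟨v, hv, hvC, rfl⟩, rfl⟩
    rw [inner_sub_right]
    have h1 := hpt v hv hvC
    have h2 := hp₀ S v hv hvC
    rw [hgen'] at h1 h2
    rw [h1, h2, sub_self]
  · rw [hp, sub_add_cancel]
  · rw [hgen', map_ne_zero_iff _ heinj]
    exact hlB
  · rw [hfin]
    refine hcv.trans (le_of_eq ?_)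
    rw [← real_inner_self_eq_norm_sq, hgen', hinner, he', Matrix.mulVec_mulVec]

/-- The rejection probability of the limit experiment, in terms of the limit of the scaled
estimation errors. -/
theorem multivariateGaussian_limitReject_le {α : ℝ} (hα0 : 0 < α) (hα1 : α < 1)
    (B : Matrix (Fin dC) (Fin dμ) ℝ) (C : Matrix (Fin dC) (Fin dδ) ℝ)
    {Om : Matrix (StackIdx dμ dδ) (StackIdx dμ dδ) ℝ} (hOm : Om.PosSemidef) {δ : Fin dδ → ℝ}
    (hSig : (sandwich Om δ).PosDef) {J : Set (Fin dC)} {σ : Fin dC → ℝ} (hσ : ∀ j ∈ J, 0 ≤ σ j) :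
    ∃ Z : Set (EuclideanSpace ℝ (StackIdx dμ dδ)), MeasurableSet Z ∧
      {x | LimitReject B C (sandwich Om δ) J σ (fun s => cv s α) ((loading δ)ᵀ *ᵥ x.ofLp)} ⊆ Z ∧
      multivariateGaussian 0 Om Z ≤ ENNReal.ofReal α := by
  obtain ⟨A, hA, hAA⟩ := exists_eq_transpose_mul_self hSig
  have hAT : IsUnit Aᵀ.det := by rwa [Matrix.det_transpose]
  -- The whitening map: it sends the limit of the scaled errors to a standard Gaussian `z`, from
  -- which `Aᵀ` recovers the observation of the limit experiment.
  set G : Matrix (Fin dμ) (StackIdx dμ dδ) ℝ := (Aᵀ)⁻¹ * (loading (dμ := dμ) δ)ᵀ with hG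
  have hcont : Continuous fun x : EuclideanSpace ℝ (StackIdx dμ dδ) =>
    WithLp.toLp 2 (G *ᵥ x.ofLp) := by fun_prop
  have hGS : G * Om * Gᵀ = 1 := by
    have h1 : G * Om * Gᵀ = (Aᵀ)⁻¹ * sandwich Om δ * A⁻¹ := by
      change _ = (Aᵀ)⁻¹ * ((loading (dμ := dμ) δ)ᵀ * Om * loading (dμ := dμ) δ : Matrix _ _ ℝ) * A⁻¹
      rw [hG, Matrix.transpose_mul, Matrix.transpose_nonsing_inv,
        Matrix.transpose_transpose, Matrix.transpose_transpose]
      simp only [Matrix.mul_assoc]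
    rw [h1, hAA, Matrix.nonsing_inv_mul_cancel_left _ _ hAT, Matrix.mul_nonsing_inv _ hA]
  have hmap := multivariateGaussian_map_eq_stdGaussian hOm G hGS
  set R := {z : EuclideanSpace ℝ (Fin dμ) |
    LimitReject B C (Aᵀ * A) J σ (fun s => cv s α) (Aᵀ *ᵥ z.ofLp)} with hR
  have hle := stdGaussian_limitReject_le hα0 hα1 B C hA hσ
  -- A measurable hull of the region has the same measure, so measurability of the region itself is
  -- not required.
  refine ⟨_, hcont.measurable (measurableSet_toMeasurable (stdGaussian _) R), fun x hx => ?_, ?_⟩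
  · refine subset_toMeasurable _ _ ?_
    have h2 : Aᵀ *ᵥ (G *ᵥ x.ofLp) = (loading δ)ᵀ *ᵥ x.ofLp := by
      rw [hG, Matrix.mulVec_mulVec, Matrix.mul_nonsing_inv_cancel_left _ _ hAT]
    change LimitReject B C (Aᵀ * A) J σ (fun s => cv s α) (Aᵀ *ᵥ (G *ᵥ x.ofLp))
    rw [h2, ← hAA]
    exact hx
  · rw [← Measure.map_apply hcont.measurable (measurableSet_toMeasurable _ _), hmap,
      measure_toMeasurable]
    exact hle

end LimitExperiment

/-! ### From sample paths to rejection probabilities -/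

section Portmanteau

open scoped ENNReal

/-- An extended portmanteau inequality: if the limits of the values of `X` along sample points that
lie in `R` and eventually in every `G m` all belong to `Z`, then the asymptotic probability of `R`
is at most that of `Z` under the limit distribution. -/
theorem le_measure_of_tendstoInDistribution {E : Type*} [PseudoMetricSpace E] [MeasurableSpace E]
    [BorelSpace E] {Ω : ℕ → Type*} [∀ q, MeasurableSpace (Ω q)] {P : ∀ q, Measure (Ω q)}
    [∀ q, IsProbabilityMeasure (P q)] {X : ∀ q, Ω q → E} {ν : Measure E} [IsProbabilityMeasure ν]
    (hX : TendstoInDistribution X atTop id P ν) {R : ∀ q, Set (Ω q)} {G : ∀ q, ℕ → Set (Ω q)}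
    (hGanti : ∀ q, Antitone (G q)) (hG : ∀ m, Tendsto (fun q => P q (G q m)ᶜ) atTop (𝓝 0))
    {Z : Set E}
    (hZ : ∀ (x : E) (k : ℕ → ℕ) (ω : ∀ m, Ω (k m)), (∀ m, m ≤ k m) → (∀ m, ω m ∈ R (k m)) →
      (∀ m, ω m ∈ G (k m) m) → Tendsto (fun m => X (k m) (ω m)) atTop (𝓝 x) → x ∈ Z)
    {a : ℝ≥0∞} (ha : a ≠ ∞) (hR : ∀ q, a ≤ P q (R q)) : a ≤ ν Z := by
  -- The closed sets `A m` collect the values at good points of `R` from index `m` on. The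
  -- portmanteau theorem bounds their limiting probability, and their intersection consists of
  -- limits along such points, hence lies in `Z`.
  set A : ℕ → Set E := fun m => closure (⋃ q, ⋃ (_ : m ≤ q), X q '' (R q ∩ G q m)) with hA
  have hAanti : Antitone A := by
    intro m m' hmm
    refine closure_mono (Set.iUnion_subset fun q => Set.iUnion_subset fun hq => ?_)
    exact (Set.image_mono (Set.inter_subset_inter_right _ (hGanti q hmm))).trans
      (Set.subset_iUnion₂_of_subset q (hmm.trans hq) subset_rfl)
  have hAZ : ⋂ m, A m ⊆ Z := by
    intro x hx
    have h1 : ∀ m : ℕ, ∃ q, m ≤ q ∧ ∃ ω, (ω ∈ R q ∧ ω ∈ G q m) ∧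
        dist x (X q ω) < 1 / ((m : ℝ) + 1) := by
      intro m
      obtain ⟨y, hy, hxy⟩ := Metric.mem_closure_iff.mp (Set.mem_iInter.mp hx m)
        (1 / ((m : ℝ) + 1)) (by positivity)
      obtain ⟨q, hq, ω, hω, rfl⟩ := Set.mem_iUnion₂.mp hy
      exact ⟨q, hq, ω, hω, hxy⟩
    choose k hk ω hω hd using h1
    refine hZ x k ω hk (fun m => (hω m).1) (fun m => (hω m).2) ?_
    rw [tendsto_iff_dist_tendsto_zero]
    refine squeeze_zero (fun _ => dist_nonneg) (fun m => ?_) tendsto_one_div_add_atTop_nhds_zero_nat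
    rw [dist_comm]
    exact (hd m).le
  have hle : ∀ m, a ≤ ν (A m) := by
    intro m
    have h1 := ProbabilityMeasure.limsup_measure_closed_le_of_tendsto hX.tendsto
      (isClosed_closure : IsClosed (A m))
    have h2 : Tendsto (fun q => a - P q (G q m)ᶜ) atTop (𝓝 a) := by
      have := ENNReal.Tendsto.sub (tendsto_const_nhds (x := a)) (hG m) (Or.inl ha)
      rwa [tsub_zero] at this
    have h3 : ∀ᶠ q in atTop, a - P q (G q m)ᶜ ≤ (P q).map (X q) (A m) := by
      filter_upwards [eventually_ge_atTop m] with q hq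
      rw [tsub_le_iff_right, Measure.map_apply_of_aemeasurable (hX.forall_aemeasurable q)
        isClosed_closure.measurableSet]
      -- Only monotonicity and subadditivity are used on the sample side, so `R` may be
      -- non-measurable. This matters because the solution `hat` is an arbitrary selection.
      refine (hR q).trans ((measure_mono fun ω hω => ?_).trans (measure_union_le _ _))
      by_cases hg : ω ∈ G q m
      · exact Or.inl (subset_closure (Set.mem_iUnion₂.mpr ⟨q, hq, ω, ⟨hω, hg⟩, rfl⟩))
      · exact Or.inr hg
    have h4 := limsup_le_limsup h3
    rw [h2.limsup_eq] at h4
    refine h4.trans (h1.trans (le_of_eq ?_))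
    simp [hA]
  have hlim := tendsto_measure_iInter_atTop (μ := ν)
    (fun m => (isClosed_closure : IsClosed (A m)).measurableSet.nullMeasurableSet) hAanti
    ⟨0, measure_ne_top _ _⟩
  exact (ge_of_tendsto' hlim hle).trans (measure_mono hAZ)

end Portmanteau

/-! ### Measurability of rank events -/

section Rank

/-- The rank of a random matrix is measurable. -/
lemma measurableSet_rank_eq {Ω κ m : Type*} [MeasurableSpace Ω] [Finite κ] [Fintype m]
    {M : Ω → Matrix κ m ℝ} (hM : ∀ i j, Measurable fun ω => M ω i j) (r : ℕ) :
    MeasurableSet {ω | (M ω).rank = r} := by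
  classical
  have := Fintype.ofFinite κ
  -- Rank is lower semicontinuous, so the matrices of rank at least `n` form an open set.
  have key : ∀ n : ℕ, MeasurableSet {ω | n ≤ (M ω).rank} := by
    intro n
    have h1 : IsOpen {f : κ → m → ℝ | n ≤ (Matrix.of f).rank} := by
      have h2 := (isOpen_setOfPred_nat_le_rank (𝕜 := ℝ) (E := m → ℝ) (F := κ → ℝ) n).preimage
        (continuous_toCLM (κ := κ) (m := m))
      have h3 : Continuous fun f : κ → m → ℝ => Matrix.of f := continuous_id
      convert h2.preimage h3 using 1
      ext f
      simp only [Set.mem_ofPred_eq, Set.mem_preimage, Matrix.rank, LinearMap.rank]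
      rw [← Nat.cast_le (α := Cardinal), Module.finrank_eq_rank]
      rfl
    have h2 : Measurable fun ω => (fun i j => M ω i j : κ → m → ℝ) :=
      measurable_pi_iff.mpr fun i => measurable_pi_iff.mpr fun j => hM i j
    exact h2 h1.measurableSet
  have : {ω | (M ω).rank = r} = {ω | r ≤ (M ω).rank} \ {ω | r + 1 ≤ (M ω).rank} := by
    ext ω
    simp only [Set.mem_ofPred_eq, Set.mem_sdiff]
    omega
  rw [this]
  exact (key r).diff (key _)

end Rank

/-! ### Rejection probabilities along convergent subsequences -/

namespace Setup

open scoped ENNReal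

variable {dC dμ dδ : ℕ} (S : Setup dC dμ dδ)

lemma measurable_CBar (n : ℕ+) (i : Fin dC) (j : Fin dδ) :
    Measurable fun ω => S.CBar n ω i j := by
  simp only [CBar, Matrix.add_apply, Matrix.mul_apply]
  exact (Finset.measurable_sum _ fun k _ =>
    (S.measurable_PiBar n k j).const_mul _).add_const _

lemma loading_transpose_mulVec (δ : Fin dδ → ℝ) (x : StackIdx dμ dδ → ℝ) :
    (loading δ)ᵀ *ᵥ x = (fun i => x (Sum.inl i)) +
      (Matrix.of fun i j => x (Sum.inr (j, i)) : Matrix (Fin dμ) (Fin dδ) ℝ) *ᵥ δ := by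
  ext i
  simp only [Matrix.mulVec, dotProduct, Matrix.transpose_apply, loading, Fintype.sum_sum_type,
    Matrix.fromRows_apply_inl, Matrix.fromRows_apply_inr, Matrix.of_apply, Pi.add_apply,
    Fintype.sum_prod_type, Matrix.one_apply]
  simp [mul_comm]

lemma isCountablyGenerated_nhds_matrix {m n : Type*} [Countable m] [Countable n]
    (M : Matrix m n ℝ) : (𝓝 M).IsCountablyGenerated := by
  have h : ∀ f : m → n → ℝ, (𝓝 f).IsCountablyGenerated := fun f => inferInstance
  exact h M

/-- Along a subsequence of null distributions with all the limits that matter, rejection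
probabilities cannot stay above `α`. -/
theorem le_of_le_rejection_prob {hat : ∀ n, S.Sample n → (Fin dμ → ℝ) × (Fin dδ → ℝ)}
    (hhat : ∀ n ω, (∃ p, IsArgmin (S.crit n ω) (S.constr n ω) p) →
      IsArgmin (S.crit n ω) (S.constr n ω) (hat n ω))
    {α : ℝ} (hα0 : 0 < α) (hα1 : α < 1) {F : ∀ n, ProbabilityMeasure (S.Sample n)}
    {ns : ℕ → ℕ+} (hns : Tendsto (fun q => ((ns q : ℕ) : ℝ)) atTop atTop)
    {mu0 : Fin dμ → ℝ} {d0 : Fin dC → ℝ} {Pi0 : Matrix (Fin dμ) (Fin dδ) ℝ}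
    {Om0 : Matrix (StackIdx dμ dδ) (StackIdx dμ dδ) ℝ} {Ups0 : Matrix (Fin dμ) (Fin dμ) ℝ}
    (hOm0 : Om0.PosSemidef) (hUps0 : Ups0.PosDef) (hpar : S.ParamLimit F ns mu0 Pi0 d0)
    (hX : TendstoInDistribution (fun q => S.scaledError (ns q) (F (ns q))) atTop id
      (fun q => (F (ns q) : Measure (S.Sample (ns q)))) (multivariateGaussian 0 Om0))
    {δ0 : Fin dδ → ℝ} (hδ0 : δ0 = minNormPoint (S.B * Pi0 + S.D) (d0 - S.B *ᵥ mu0))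
    (hSig : (sandwich Om0 δ0).PosDef)
    (hOm : TendstoInProb (fun q => (F (ns q) : Measure (S.Sample (ns q))))
      (fun q => S.OmBar (ns q)) Om0)
    (hUps : TendstoInProb (fun q => (F (ns q) : Measure (S.Sample (ns q))))
      (fun q => S.Ups (ns q)) Ups0)
    (hne0 : (poly (S.B * Pi0 + S.D) (d0 - S.B *ᵥ mu0)).Nonempty)
    (hrank : ∀ K ∈ Activ (S.B * Pi0 + S.D) (d0 - S.B *ᵥ mu0), S.Keq ⊆ K →
      Tendsto (fun q => (F (ns q) : Measure (S.Sample (ns q)))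
        {ω | (rows K (S.CBar (ns q) ω)).rank = (rows K (S.B * Pi0 + S.D)).rank}) atTop (𝓝 1))
    {δ : ℕ → Fin dδ → ℝ}
    (hδ : ∀ q, δ q ∈ poly (S.CF (ns q) (F (ns q))) (S.bF (ns q) (F (ns q))))
    (hδlim : Tendsto δ atTop (𝓝 δ0)) {J : Set (Fin dC)} {σ : Fin dC → ℝ}
    (hσ : ∀ j ∈ J, Tendsto (fun q => √((ns q : ℕ) : ℝ) *
      (S.bF (ns q) (F (ns q)) - S.CF (ns q) (F (ns q)) *ᵥ δ q) j) atTop (𝓝 (σ j)))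
    (hσ' : ∀ j, j ∉ J → Tendsto (fun q => √((ns q : ℕ) : ℝ) *
      (S.bF (ns q) (F (ns q)) - S.CF (ns q) (F (ns q)) *ᵥ δ q) j) atTop atTop)
    {a : ℝ≥0∞} (ha : a ≠ ∞) (hR : ∀ q, a ≤ (F (ns q) : Measure (S.Sample (ns q)))
      {ω | cv (S.dof (ns q) ω (hat (ns q) ω)) α < S.T (ns q) ω}) : a ≤ ENNReal.ofReal α := by
  set C0 := S.B * Pi0 + S.D with hC0
  have := isCountablyGenerated_nhds_matrix Om0
  have := isCountablyGenerated_nhds_matrix Ups0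
  obtain ⟨U, hU⟩ := (𝓝 Om0).exists_antitone_basis
  obtain ⟨U', hU'⟩ := (𝓝 Ups0).exists_antitone_basis
  let 𝒦 := {K : Set (Fin dC) // K ∈ Activ C0 (d0 - S.B *ᵥ mu0) ∧ S.Keq ⊆ K}
  let P := fun q => (F (ns q) : Measure (S.Sample (ns q)))
  let rk : ∀ q, 𝒦 → Set (S.Sample (ns q)) := fun q K =>
    {ω | (rows K.1 (S.CBar (ns q) ω)).rank = (rows K.1 C0).rank}
  -- Shrinking neighbourhoods turn convergence in probability into ordinary convergence along the
  -- selected sample points, and there the ranks hold exactly.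
  let G : ∀ q, ℕ → Set (S.Sample (ns q)) := fun q m =>
    {ω | S.OmBar (ns q) ω ∈ U m ∧ S.Ups (ns q) ω ∈ U' m ∧ ∀ K : 𝒦, ω ∈ rk q K}
  have hσ0 : ∀ j ∈ J, 0 ≤ σ j := fun j hj => ge_of_tendsto' (hσ j hj) fun q =>
    mul_nonneg (Real.sqrt_nonneg _) (by
      have h1 : S.CF (ns q) (F (ns q)) *ᵥ δ q ≤ S.bF (ns q) (F (ns q)) := hδ q
      exact sub_nonneg.mpr (h1 j))
  obtain ⟨Z, -, hZ, hZα⟩ := multivariateGaussian_limitReject_le hα0 hα1 S.B C0 hOm0 hSig hσ0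
  refine le_trans (le_measure_of_tendstoInDistribution hX (G := G) (Z := Z) ?_ ?_ ?_ ha hR) hZα
  · intro q m m' hmm ω hω
    exact ⟨hU.antitone hmm hω.1, hU'.antitone hmm hω.2.1, hω.2.2⟩
  · intro m
    have := Fintype.ofFinite 𝒦
    have h1 : ∀ K : 𝒦, Tendsto (fun q => P q (rk q K)ᶜ) atTop (𝓝 0) := by
      intro K
      -- Without measurability, probability tending to 1 would say nothing about the complement.
      have hm : ∀ q, MeasurableSet (rk q K) := fun q =>
        measurableSet_rank_eq (M := fun ω => rows K.1 (S.CBar (ns q) ω))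
          (fun i j => S.measurable_CBar (ns q) i.1 j) _
      have h2 := ENNReal.Tendsto.sub (tendsto_const_nhds (x := (1 : ℝ≥0∞)))
        (hrank K.1 K.2.1 K.2.2) (Or.inl ENNReal.one_ne_top)
      rw [tsub_self] at h2
      refine h2.congr fun q => ?_
      exact (prob_compl_eq_one_sub (hm q)).symm
    have h2 := ((hOm (U m) (hU.mem m)).add (hUps (U' m) (hU'.mem m))).add
      (tendsto_finsetSum Finset.univ fun K _ => h1 K)
    simp only [add_zero, Finset.sum_const_zero] at h2
    refine tendsto_of_tendsto_of_tendsto_of_le_of_le tendsto_const_nhds h2 (fun _ => zero_le)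
      fun q => ?_
    refine (measure_mono fun ω hω => ?_).trans ((measure_union_le _ _).trans
      (add_le_add (measure_union_le _ _) (measure_iUnion_fintype_le (P q) fun K => (rk q K)ᶜ)))
    by_contra hcon
    simp only [Set.mem_union, Set.mem_ofPred_eq, Set.mem_iUnion, Set.mem_compl_iff, not_or,
      not_exists, not_not] at hcon
    exact hω ⟨hcon.1.1, hcon.1.2, hcon.2⟩
  · intro x k ω hk hω hG hx
    refine hZ ?_
    have hkt : Tendsto k atTop atTop := tendsto_atTop_mono hk tendsto_id
    have hxi : ∀ i, Tendsto (fun m => √((ns (k m) : ℕ) : ℝ) *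
        stack (S.muBar (ns (k m)) (ω m) - S.muF (ns (k m)) (F (ns (k m))))
          (S.PiBar (ns (k m)) (ω m) - S.PiF (ns (k m)) (F (ns (k m)))) i) atTop (𝓝 (x i)) :=
      fun i => ((EuclideanSpace.proj (𝕜 := ℝ) i).continuous.tendsto x).comp hx
    have hmain := rejection_limit S.B S.D (E := S.Keq) (J := J) (N := fun m => ns (k m))
      (hns.comp hkt) (muF := fun m => S.muF (ns (k m)) (F (ns (k m))))
      (muBar := fun m => S.muBar (ns (k m)) (ω m))
      (PiF := fun m => S.PiF (ns (k m)) (F (ns (k m))))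
      (PiBar := fun m => S.PiBar (ns (k m)) (ω m))
      (d := fun m => S.d (ns (k m))) (Om := fun m => S.OmBar (ns (k m)) (ω m))
      (Ups := fun m => S.Ups (ns (k m)) (ω m)) (mu0 := mu0) (xmu := fun i => x (Sum.inl i))
      (Pi0 := Pi0) (xPi := Matrix.of fun i j => x (Sum.inr (j, i))) (d0 := d0) (Om0 := Om0)
      (Ups0 := Ups0) (hpar.1.comp hkt) (hpar.2.1.comp hkt) (hpar.2.2.comp hkt)
      (tendsto_pi_nhds.mpr fun i => hxi (Sum.inl i))
      (tendsto_pi_nhds.mpr fun i => tendsto_pi_nhds.mpr fun j => hxi (Sum.inr (j, i)))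
      (hU.tendsto fun m => (hG m).1) (hU'.tendsto fun m => (hG m).2.1) hUps0 hδ0 hne0 hSig
      (fun j hj => by
        obtain ⟨j', h1, h2, h3⟩ := S.Keq_pair j hj
        exact ⟨j', h1, h2, fun m => h3 _⟩)
      (δ := fun m => δ (k m)) (fun m => hδ (k m)) (hδlim.comp hkt) (σ := σ)
      (fun j hj => (hσ j hj).comp hkt) (fun j hj => (hσ' j hj).comp hkt)
      (fun K h1 h2 m => (hG m).2.2 ⟨K, h1, h2⟩) (c := fun s => cv s α)
      (cv_mono hα0 hα1) (cv_nonneg hα1 0) (cv_pos hα0 hα1 le_rfl)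
      (muT := fun m => S.muTilde (ns (k m)) (ω m)) (fun m => rfl)
      (W := fun m => (S.SigTilde (ns (k m)) (ω m))⁻¹) (fun m => rfl)
      (hat := fun m => hat (ns (k m)) (ω m)) (fun m => hhat _ _)
      (Kh := fun m => S.active (ns (k m)) (ω m) (hat (ns (k m)) (ω m))) (fun m => rfl)
      (fun m => hω m)
    rw [Set.mem_ofPred_eq, loading_transpose_mulVec]
    exact hmain

end Setup

/-! ### Asymptotic size -/

section Size

/-- Along a subsequence, every coordinate of a nonnegative sequence converges or diverges to
infinity. -/
lemma exists_subseq_tendsto_or_atTop {ι : Type*} [Finite ι] {s : ℕ → ι → ℝ}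
    (hs : ∀ q j, 0 ≤ s q j) :
    ∃ (φ : ℕ → ℕ) (J : Set ι) (σ : ι → ℝ), StrictMono φ ∧
      (∀ j ∈ J, Tendsto (fun q => s (φ q) j) atTop (𝓝 (σ j))) ∧
      ∀ j, j ∉ J → Tendsto (fun q => s (φ q) j) atTop atTop := by
  have := Fintype.ofFinite ι
  -- Compactness of a finite product of copies of [0, ∞]; the coordinates with finite limit form the
  -- set `J`.
  obtain ⟨l, φ, hφ, h⟩ := CompactSpace.tendsto_subseq
    (fun q j => ENNReal.ofReal (s q j) : ℕ → ι → ENNReal)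
  have h' := tendsto_pi_nhds.mp h
  refine ⟨φ, {j | l j ≠ ⊤}, fun j => (l j).toReal, hφ, fun j hj => ?_, fun j hj => ?_⟩
  · refine ((ENNReal.tendsto_toReal hj).comp (h' j)).congr fun q => ?_
    exact ENNReal.toReal_ofReal (hs _ j)
  · have h1 := h' j
    have h2 : l j = ⊤ := by simpa using hj
    rw [h2] at h1
    exact ENNReal.tendsto_ofReal_nhds_top.mp h1

lemma exists_strictMono_pnat {p : ℕ+ → Prop} (h : ∃ᶠ n in atTop, p n) :
    ∃ φ : ℕ → ℕ+, StrictMono φ ∧ ∀ q, p (φ q) := by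
  have h1 : ∃ᶠ m : ℕ in atTop, p m.succPNat := by
    rw [frequently_atTop]
    intro N
    obtain ⟨n, hn, hpn⟩ := frequently_atTop.mp h N.succPNat
    refine ⟨n.natPred, ?_, by rwa [PNat.succPNat_natPred]⟩
    have : N + 1 ≤ (n : ℕ) := hn
    rw [PNat.natPred]
    omega
  obtain ⟨φ, hφ, hp⟩ := extraction_of_frequently_atTop h1
  exact ⟨fun q => (φ q).succPNat, fun a b hab => Nat.succPNat_lt_succPNat.mpr (hφ hab), hp⟩

lemma tendsto_cast_of_strictMono {φ : ℕ → ℕ+} (hφ : StrictMono φ) :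
    Tendsto (fun q => ((φ q : ℕ) : ℝ)) atTop atTop := by
  have h : StrictMono fun q => (φ q : ℕ) := fun a b hab => hφ hab
  exact tendsto_natCast_atTop_atTop.comp h.tendsto_atTop

end Size

end

end GCC

/-- `hat n ω` is an arbitrary solution `(μ, δ)` of the second-step quadratic program (whenever that
program has a solution), and the degrees of freedom of the test are computed from it. -/
theorem theorem3 {dC dμ dδ : ℕ} (S : GCC.Setup dC dμ dδ)
    (hnull : ∀ n, (S.null n).Nonempty)
    (hnormal : S.AsymptoticNormality) (hrank : S.StableRank)
    (hat : ∀ n, S.Sample n → (Fin dμ → ℝ) × (Fin dδ → ℝ))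
    (hhat : ∀ n ω, (∃ p, GCC.IsArgmin (S.crit n ω) (S.constr n ω) p) →
      GCC.IsArgmin (S.crit n ω) (S.constr n ω) (hat n ω))
    (α : ℝ) (hα0 : 0 < α) (hα1 : α < 1) :
    Filter.limsup
      (fun n : ℕ+ => ⨆ F ∈ S.null n,
        (F : MeasureTheory.Measure (S.Sample n))
          {ω | GCC.cv (S.dof n ω (hat n ω)) α < S.T n ω})
      Filter.atTop ≤ ENNReal.ofReal α := by
  by_contra! hlt
  obtain ⟨a, ha, hlt⟩ := exists_between hlt
  obtain ⟨φ, hφ, hfreq⟩ := GCC.exists_strictMono_pnat (frequently_lt_of_lt_limsup (h := hlt))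
  -- The assumptions concern full sequences of null distributions, so at indices where the supremum
  -- does not exceed `a` an arbitrary null distribution is used.
  have hF : ∀ n, ∃ F ∈ S.null n, (a < ⨆ F ∈ S.null n, (F : Measure (S.Sample n))
      {ω | GCC.cv (S.dof n ω (hat n ω)) α < S.T n ω}) →
      a < (F : Measure (S.Sample n)) {ω | GCC.cv (S.dof n ω (hat n ω)) α < S.T n ω} := by
    intro n
    by_cases h : a < ⨆ F ∈ S.null n, (F : Measure (S.Sample n))
      {ω | GCC.cv (S.dof n ω (hat n ω)) α < S.T n ω}
    · obtain ⟨F, hF⟩ := lt_iSup_iff.mp h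
      obtain ⟨hF, h1⟩ := lt_iSup_iff.mp hF
      exact ⟨F, hF, fun _ => h1⟩
    · exact ⟨_, (hnull n).some_mem, fun h' => absurd h' h⟩
  choose F hFnull hFa using hF
  obtain ⟨ψ, hψ, mu0, d0, Pi0, Om0, Ups0, hOm0, hUps0, hpar, hX, hSig, hOm, hUps, hne0⟩ :=
    hnormal F hFnull φ hφ
  obtain ⟨ψ', hψ', hK⟩ := hrank F hFnull (φ ∘ ψ) (hφ.comp hψ) mu0 Pi0 d0 hpar
  set C0 := S.B * Pi0 + S.D with hC0
  set b0 := d0 - S.B *ᵥ mu0 with hb0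
  set θ : ℕ → ℕ+ := fun q => φ (ψ (ψ' q)) with hθ
  have hθmono : StrictMono θ := hφ.comp (hψ.comp hψ')
  have ht' := hψ'.tendsto_atTop
  -- approximation of the minimum norm point by points that satisfy the null constraints
  have hCt : Tendsto (fun q => S.CF (θ q) (F (θ q))) atTop (𝓝 C0) := by
    have h1 : Continuous fun P : Matrix (Fin dμ) (Fin dδ) ℝ => S.B * P + S.D := by fun_prop
    exact (h1.tendsto Pi0).comp (hpar.2.1.comp ht')
  have hbt : Tendsto (fun q => S.bF (θ q) (F (θ q))) atTop (𝓝 b0) :=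
    (hpar.2.2.comp ht').sub (GCC.tendsto_mulVec tendsto_const_nhds (hpar.1.comp ht'))
  obtain ⟨δ, hδ, hδlim⟩ := GCC.exists_tendsto_poly hCt hbt (E := S.Keq)
    (fun q x hx j hj => by
      obtain ⟨j', h1, h2, h3⟩ := S.Keq_pair j hj
      exact GCC.feasible_pair h1 h2 (h3 _) _ hx)
    (fun x hx j hj => by
      obtain ⟨j', h1, h2, h3⟩ := S.Keq_pair j hj
      refine GCC.feasible_pair h1 h2 ?_ _ hx
      refine tendsto_nhds_unique (tendsto_pi_nhds.mp hpar.2.2 j') ?_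
      simp only [h3]
      exact (tendsto_pi_nhds.mp hpar.2.2 j).neg)
    -- The rank of the true Jacobian is not random: once the event has positive probability it is
    -- nonempty, and any of its points yields the equality of ranks.
    (fun K h1 h2 => by
      filter_upwards [(hK K h1 h2).eventually_const_lt zero_lt_one] with q hq
      obtain ⟨ω, hω⟩ := nonempty_of_measure_ne_zero hq.ne'
      exact hω.2)
    (fun q => (hFnull (θ q)).2) (GCC.isArgmin_minNormPoint hne0).1
  have hδle : ∀ q, S.CF (θ q) (F (θ q)) *ᵥ δ q ≤ S.bF (θ q) (F (θ q)) := hδ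
  obtain ⟨χ, J, σ, hχ, hσ, hσ'⟩ := GCC.exists_subseq_tendsto_or_atTop
    (s := fun q j => √((θ q : ℕ) : ℝ) *
      (S.bF (θ q) (F (θ q)) - S.CF (θ q) (F (θ q)) *ᵥ δ q) j)
    (fun q j => mul_nonneg (Real.sqrt_nonneg _) (sub_nonneg.mpr (hδle q j)))
  have ht := hψ'.tendsto_atTop.comp hχ.tendsto_atTop
  refine absurd (S.le_of_le_rejection_prob hhat hα0 hα1 (F := F) (ns := fun q => θ (χ q))
    (GCC.tendsto_cast_of_strictMono (hθmono.comp hχ)) hOm0 hUps0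
    ⟨hpar.1.comp ht, hpar.2.1.comp ht, hpar.2.2.comp ht⟩
    ⟨fun q => hX.forall_aemeasurable _, hX.aemeasurable_limit, hX.tendsto.comp ht⟩ rfl hSig
    (fun U hU => (hOm U hU).comp ht) (fun U hU => (hUps U hU).comp ht) hne0 (fun K h1 h2 => ?_)
    (δ := fun q => δ (χ q)) (fun q => hδ (χ q)) (hδlim.comp hχ.tendsto_atTop) hσ hσ'
    hlt.ne_top (fun q => (hFa _ (hfreq _)).le)) (not_le.mpr ha)
  -- The stable rank event is contained in the event that the estimated Jacobian has the limit rank.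
  refine tendsto_of_tendsto_of_tendsto_of_le_of_le ((hK K h1 h2).comp hχ.tendsto_atTop)
    tendsto_const_nhds (fun q => ?_) fun q => prob_le_one
  exact measure_mono fun ω hω => hω.1.trans hω.2
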